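/- Let $0<|p|,|q|<1$. Write $(z;p)_\infty=\prod_{j\ge0}(1-zp^j)$, $(z;p,q)_\infty=\prod_{j,k\ge 0}(1-zp^jq^k)$, $\theta(z;p)=(z;p)_\infty(pz^{-1};p)_\infty$, $\Gamma(z)=\prod_{j,k\ge0}\frac{1-z^{-1}p^{j+1}q^{k+1}}{1-zp^jq^k}$, $\theta(z_1,\dots,z_k;p)=\prod_i\theta(z_i;p)$, $\Gamma(z_1,\dots,z_k)=\prod_i\Gamma(z_i)$ and $\Gamma(tz^{\pm})=\Gamma(tz)\Gamma(tz^{-1})$. For $t_1,\dots,t_8\in\mathbb C^*$ with $\prod_{j=1}^8t_j=p^2q^2$ and all $|t_j|<1$ let $$V(t_1,\dots,t_8)=\kappa\int_{\mathbb T}\frac{\prod_{j=1}^8\Gamma(t_jz^{\pm})}{\Gamma(z^{\pm2})}\frac{dz}{z},\qquad \kappa=\frac{(p;p)_\infty(q;q)_\infty}{4\pi i},$$ where $\mathbb T$ is the unit circle; for other parameters $V$ is the meromorphic continuation along the hypersurface $\prod_j t_j=p^2q^2$ (the product $V(t)\prod_{j<k}(t_jt_k;p,q)_\infty$ continues holomorphically).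 Put $U(t)=V(t)/\Gamma(t_7t_6^{\pm},t_8t_6^{\pm})$. Put $t_7=cx^{-1}$, $t_8=cx$, $(T f)(x)=f(qx)$, and $$\mathcal D(t)=a(t_1,\dots,t_6,t_7,t_8)(T-1)+a(t_1,\dots,t_6,t_8,t_7)(T^{-1}-1)+\kappa(t),$$ $$a(t)=\frac{\theta(t_8/qt_6,t_6t_8,t_6/t_8;p)}{\theta(t_8/t_7,t_7/qt_8;p)}\prod_{k=1}^5\theta(t_7t_k/q;p),\qquad \kappa(t)=\theta(t_7t_8/q;p)\prod_{k=1}^5\theta(t_6t_k;p).$$ Let $t'$ be $t$ with $t_3,t_4$ replaced by $t_3',t_4'$, where $t_3t_4=t_3't_4'$, and let $t''$ be obtained similarly from $t_3'',t_4''$. (1) Operator identity. If $\theta(t_3/t_3'',t_3/t_4'';p)\ne0$, then $$\mathcal D(t')-\frac{\theta(t_3/t_3',t_3/t_4';p)}{\theta(t_3/t_3'',t_3/t_4'';p)}\mathcal D(t'')=\frac{t_3}{t_3'}\,\frac{\theta(t_3'/t_3'',t_3'/t_4'';p)}{\theta(t_3/t_3'',t_3/t_4'';p)}\mathcal D(t).$$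 (2) Contiguous relation. Let $\prod_{j=1}^8 t_j=p^2q^2$. Wherever the values of $U$ that occur are defined and no denominator vanishes, $$\frac{\mathcal D(t')U(t)}{\theta(\frac{t_3}{t_3'},\frac{t_3}{t_4'};p)}=R(t),$$ where $$R(t)=t_4t_6\frac{\theta(\frac{t_3t_4t_7t_8}{q^2},t_7t_6,t_8t_6;p)}{\theta(\frac{t_3t_7}q,\frac{t_3t_8}q,\frac{t_4t_7}q,\frac{t_4t_8}q,\frac{qt_6}{t_5};p)}\prod_{\substack{1\le j\le8\\ j\ne5,6}}\theta\Big(\frac{t_5t_j}q;p\Big)\,U(q^{-1}t_5,qt_6)$$ $$-\frac{\theta(\frac{qt_6}{t_8};p)\prod_{j=1}^4\theta(t_6t_j;p)}{\theta(\frac{t_3t_8}q,\frac q{t_4t_8};p)}\left(\frac{\theta(t_6t_8,\frac{t_7}{t_5},\frac{t_5t_7}q,\frac{t_3t_4t_7t_8}{q^2};p)}{\theta(\frac{qt_6}{t_5},\frac{t_3t_7}q,\frac{t_4t_7}q;p)}-\frac{\theta(\frac{t_7t_8}q,t_5t_6,\frac{t_3t_4t_6t_8}q;p)}{\theta(t_3t_6,t_4t_6;p)}\right)U(t),$$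 and $U(q^{-1}t_5,qt_6)$ is $U$ with $t_5,t_6$ replaced by $q^{-1}t_5,qt_6$. (3) Biorthogonality. Put $\varepsilon_k=q/(ct_k)$ $(1\le k\le5)$, $\varepsilon_6=ct_6p^4$, $\varepsilon_8=c/t_6$, $\varepsilon_7=\varepsilon_8/q$, and let $\varepsilon'$ be the corresponding parameters for $t'$. Let $$\mathcal D_x(\varepsilon)=A_\varepsilon(x)(T-1)+A_\varepsilon(x^{-1})(T^{-1}-1)+\prod_{k=1}^6\theta\Big(\frac{\varepsilon_k\varepsilon_8}q;p\Big),\quad A_\varepsilon(x)=\frac{\prod_{k=1}^8\theta(\varepsilon_kx;p)}{\theta(x^2,qx^2;p)},$$ $\alpha_\varepsilon(x)=\prod_{k=1}^8\Gamma(\varepsilon_kx^{\pm})$, $\mathcal D_x^*(\varepsilon)=\alpha_\varepsilon\,\mathcal D_x(\varepsilon)\,\alpha_\varepsilon^{-1}$, $\psi(x;\varepsilon)=U(t_1,\dots,t_6,cx^{-1},cx)$, $\chi(x;\varepsilon)=\alpha_\varepsilon(x)\psi(x;\varepsilon)$ and $$\langle\chi,\phi\rangle=\kappa\int_{\mathbb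 T}\frac{\chi(x)\phi(x)}{\Gamma(x^{\pm2})}\frac{dx}x .$$ Suppose that $V(t_1,\dots,t_6,cy^{-1},cy)$ and the same function with $t'$ in place of $t$ are defined for $y=x,qx,q^{-1}x$, for all but countably many $x\in\mathbb T$. Let $\beta$ be a function with $\beta(x^{-1})=\beta(x)$ such that, up to countably many removable points, $\chi(x;\varepsilon')A_{\varepsilon'}(x)\beta(qx)\psi(qx;\varepsilon)/\Gamma(x^{\pm2})$ is holomorphic in $1<|x|<|q|^{-1}$ and continuous on the closed annulus. Then $$0=\langle\mathcal D_x^*(\varepsilon')\chi(x;\varepsilon'),\beta(x)\psi(x;\varepsilon)\rangle=\langle\chi(x;\varepsilon'),\mathcal D_x(\varepsilon')\beta(x)\psi(x;\varepsilon)\rangle,$$ where the last integral converges. If moreover $\beta(qx)=\beta(x)$ (for instance $\beta=1$), $\theta(t_3/t_3',t_3/t_4';p)\ne0$, $\theta(qt_6/t_5,t_3t_6,t_4t_6;p)\neq0$, and $V(t_1,\dots,t_4,q^{-1}t_5,qt_6,cy^{-1},cy)$ is defined in the same sense, then $\chi(\cdot\,;\varepsilon')$ is orthogonal to $\beta R$,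 where $R$ is the right-hand side of the relation in (2) as a function of $x$; that integral converges too. -/

import Mathlib

namespace EllipticHypergeometric

noncomputable section

/-! ### Theta functions and the elliptic gamma function -/

/-- `(z; p)_∞ = ∏_{j ≥ 0} (1 - z p^j)`. -/
def poch (z p : ℂ) : ℂ := ∏' j : ℕ, (1 - z * p ^ j)

/-- `(z; p, q)_∞ = ∏_{j, k ≥ 0} (1 - z p^j q^k)`. -/
def poch₂ (z p q : ℂ) : ℂ := ∏' n : ℕ × ℕ, (1 - z * p ^ n.1 * q ^ n.2)

/-- The short theta function `θ(z; p) = (z; p)_∞ (p z⁻¹; p)_∞`. -/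
def theta (z p : ℂ) : ℂ := poch z p * poch (p * z⁻¹) p

/-- `θ(z₁, …, z_k; p) = θ(z₁; p) ⋯ θ(z_k; p)`. -/
def thetas (l : List ℂ) (p : ℂ) : ℂ := (l.map fun z => theta z p).prod

/-- The elliptic gamma function
`Γ_{p,q}(z) = ∏_{j, k ≥ 0} (1 - z⁻¹ p^{j+1} q^{k+1}) / (1 - z p^j q^k)`. -/
def ellGamma (p q z : ℂ) : ℂ :=
  (∏' n : ℕ × ℕ, (1 - z⁻¹ * p ^ (n.1 + 1) * q ^ (n.2 + 1))) /
    ∏' n : ℕ × ℕ, (1 - z * p ^ n.1 * q ^ n.2)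

/-! ### The elliptic hypergeometric function `V(t₁, …, t₈)`

Vectors of parameters are indexed from `0`: `t i` is the parameter `t_{i+1}`. -/

/-- `κ = (p;p)_∞ (q;q)_∞ / (4 π i)`. -/
def kappa (p q : ℂ) : ℂ := poch p p * poch q q / (4 * Real.pi * Complex.I)

/-- The kernel `∏_{j=1}^8 Γ(t_j z^±) / Γ(z^{±2})`. -/
def kernel (p q : ℂ) (t : Fin 8 → ℂ) (z : ℂ) : ℂ :=
  (∏ j, ellGamma p q (t j * z) * ellGamma p q (t j * z⁻¹)) /
    (ellGamma p q (z ^ 2) * ellGamma p q (z⁻¹ ^ 2))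

/-- The integral over the unit circle that defines `V(t)` when all `|t_j| < 1`. -/
def vIntegral (p q : ℂ) (t : Fin 8 → ℂ) : ℂ :=
  kappa p q * ∮ z in C(0, 1), kernel p q t z / z

/-- The balancing condition `∏ t_j = p² q²`, for non-zero parameters. -/
def Balanced (p q : ℂ) (t : Fin 8 → ℂ) : Prop :=
  (∀ j, t j ≠ 0) ∧ ∏ j, t j = p ^ 2 * q ^ 2

/-- `∏_{j<k} (t_j t_k; p, q)_∞`. Its zeros are the possible poles of `V`. -/
def poleFactor (p q : ℂ) (t : Fin 8 → ℂ) : ℂ :=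
  ∏ j, ∏ k ∈ Finset.Ioi j, poch₂ (t j * t k) p q

/-- The balanced vector whose first seven entries are given. The map is a global chart, with
domain `(ℂ^*)^7`, of the balancing hypersurface. -/
def complete (p q : ℂ) (s : Fin 7 → ℂ) : Fin 8 → ℂ :=
  Fin.snoc (α := fun _ => ℂ) s (p ^ 2 * q ^ 2 / ∏ i, s i)

/-- `F` is the holomorphic function on the whole balancing hypersurface that equals
`∏_{j<k} (t_j t_k; p, q)_∞ V(t)` where all `|t_j| < 1`. It is unique by the identity theorem. -/
def IsContinuation (p q : ℂ) (F : (Fin 7 → ℂ) → ℂ) : Prop :=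
  DifferentiableOn ℂ F {s | ∀ i, s i ≠ 0} ∧
  ∀ s : Fin 7 → ℂ, (∀ i, s i ≠ 0) → (∀ j, ‖complete p q s j‖ < 1) →
    F s = poleFactor p q (complete p q s) * vIntegral p q (complete p q s)

open Classical in
/-- The elliptic hypergeometric function: the integral over the unit circle if all `|t_j| < 1`,
and its meromorphic continuation along the balancing hypersurface elsewhere. -/
def V (p q : ℂ) (t : Fin 8 → ℂ) : ℂ :=
  if ∀ j, ‖t j‖ < 1 then vIntegral p q t
  else if h : ∃ F, IsContinuation p q F then
    h.choose (fun i => t i.castSucc) / poleFactor p q t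
  else 0

/-- `V` is defined (and regular) at the balanced vector `t`: either the integral over the unit
circle applies, or its continuation does, away from the poles `t_j t_k = p^{-m} q^{-n}`. -/
def VDefined (p q : ℂ) (t : Fin 8 → ℂ) : Prop :=
  Balanced p q t ∧
  ((∀ j, ‖t j‖ < 1) ∨
    ((∃ F, IsContinuation p q F) ∧
      ∀ j k : Fin 8, j < k → ∀ m n : ℕ, t j * t k * p ^ m * q ^ n ≠ 1))

/-- `U(t) = V(t) / Γ(t₇ t₆^±, t₈ t₆^±)`. -/
def U (p q : ℂ) (t : Fin 8 → ℂ) : ℂ :=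
  V p q t / (ellGamma p q (t 6 * t 5) * ellGamma p q (t 6 / t 5) *
    ellGamma p q (t 7 * t 5) * ellGamma p q (t 7 / t 5))

/-- `U` is defined (and regular) at `t`: `V` is, and `1 / Γ(t₇ t₆^±, t₈ t₆^±)` has no pole. -/
def UDefined (p q : ℂ) (t : Fin 8 → ℂ) : Prop :=
  VDefined p q t ∧
  ∀ z ∈ [t 6 * t 5, t 6 / t 5, t 7 * t 5, t 7 / t 5],
    ∀ m n : ℕ, z ≠ p ^ (m + 1) * q ^ (n + 1)

/-! ### The operator of the elliptic hypergeometric equation -/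

/-- The vector `(t₁, …, t₆, t₇, t₈)` with `t₇ = c x⁻¹`, `t₈ = c x`. -/
def par (t : Fin 6 → ℂ) (c x : ℂ) : Fin 8 → ℂ :=
  ![t 0, t 1, t 2, t 3, t 4, t 5, c * x⁻¹, c * x]

/-- The vector `t` with `t₃`, `t₄` replaced by `u`, `v`. -/
def replace34 (t : Fin 6 → ℂ) (u v : ℂ) : Fin 6 → ℂ := ![t 0, t 1, u, v, t 4, t 5]

/-- The vector `t` with `t₅`, `t₆` replaced by `q⁻¹ t₅`, `q t₆`. -/
def shift56 (q : ℂ) (t : Fin 6 → ℂ) : Fin 6 → ℂ :=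
  ![t 0, t 1, t 2, t 3, q⁻¹ * t 4, q * t 5]

/-- `a(t₁,…,t₈) = θ(t₈/qt₆, t₆t₈, t₆/t₈; p) / θ(t₈/t₇, t₇/qt₈; p) ∏_{k=1}^5 θ(t₇t_k/q; p)`. -/
def coeffA (p q : ℂ) (t : Fin 8 → ℂ) : ℂ :=
  thetas [t 7 / (q * t 5), t 5 * t 7, t 5 / t 7] p / thetas [t 7 / t 6, t 6 / (q * t 7)] p *
    thetas [t 6 * t 0 / q, t 6 * t 1 / q, t 6 * t 2 / q, t 6 * t 3 / q, t 6 * t 4 / q] p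

/-- `κ(t₁,…,t₈) = θ(t₇t₈/q; p) ∏_{k=1}^5 θ(t₆t_k; p)`. -/
def coeffK (p q : ℂ) (t : Fin 8 → ℂ) : ℂ :=
  theta (t 6 * t 7 / q) p *
    thetas [t 5 * t 0, t 5 * t 1, t 5 * t 2, t 5 * t 3, t 5 * t 4] p

/-- Interchange of `t₇` and `t₈`. -/
def swap78 (t : Fin 8 → ℂ) : Fin 8 → ℂ := t ∘ Equiv.swap 6 7

/-- The operator `𝒟(t) = a(t₁,…,t₇,t₈)(T - 1) + a(t₁,…,t₈,t₇)(T⁻¹ - 1) + κ(t)` in the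
variable `x`, where `(T f)(x) = f(q x)`, `t₇ = c x⁻¹` and `t₈ = c x`. -/
def opD (p q : ℂ) (t : Fin 6 → ℂ) (c : ℂ) (f : ℂ → ℂ) (x : ℂ) : ℂ :=
  coeffA p q (par t c x) * (f (q * x) - f x) +
    coeffA p q (swap78 (par t c x)) * (f (q⁻¹ * x) - f x) +
    coeffK p q (par t c x) * f x

/-- The function `x ↦ U(t₁, …, t₆, c x⁻¹, c x)`. -/
def Ufun (p q : ℂ) (t : Fin 6 → ℂ) (c x : ℂ) : ℂ := U p q (par t c x)

/-- The combination of `U(q⁻¹t₅, qt₆)` and `U(t)` in the contiguous relation, as a function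
of `x`, where `t₇ = c x⁻¹` and `t₈ = c x`. -/
def contiguousRHS (p q : ℂ) (t : Fin 6 → ℂ) (c x : ℂ) : ℂ :=
  let t₁ := t 0
  let t₂ := t 1
  let t₃ := t 2
  let t₄ := t 3
  let t₅ := t 4
  let t₆ := t 5
  let t₇ := c * x⁻¹
  let t₈ := c * x
  t₄ * t₆ * (thetas [t₃ * t₄ * t₇ * t₈ / q ^ 2, t₇ * t₆, t₈ * t₆] p /
      thetas [t₃ * t₇ / q, t₃ * t₈ / q, t₄ * t₇ / q, t₄ * t₈ / q, q * t₆ / t₅] p) *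
    thetas [t₅ * t₁ / q, t₅ * t₂ / q, t₅ * t₃ / q, t₅ * t₄ / q, t₅ * t₇ / q, t₅ * t₈ / q] p *
    Ufun p q (shift56 q t) c x -
  thetas [q * t₆ / t₈, t₆ * t₁, t₆ * t₂, t₆ * t₃, t₆ * t₄] p /
      thetas [t₃ * t₈ / q, q / (t₄ * t₈)] p *
    (thetas [t₆ * t₈, t₇ / t₅, t₅ * t₇ / q, t₃ * t₄ * t₇ * t₈ / q ^ 2] p /
        thetas [q * t₆ / t₅, t₃ * t₇ / q, t₄ * t₇ / q] p -
      thetas [t₇ * t₈ / q, t₅ * t₆, t₃ * t₄ * t₆ * t₈ / q] p / thetas [t₃ * t₆, t₄ * t₆] p) *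
    Ufun p q t c x

/-- The theta functions of `x` in the denominators of `𝒟` and of `contiguousRHS`. -/
def xDenominators (p q : ℂ) (t : Fin 6 → ℂ) (c x : ℂ) : ℂ :=
  let t₃ := t 2
  let t₄ := t 3
  let t₇ := c * x⁻¹
  let t₈ := c * x
  thetas [t₈ / t₇, t₇ / (q * t₈), t₇ / t₈, t₈ / (q * t₇),
    t₃ * t₇ / q, t₃ * t₈ / q, t₄ * t₇ / q, t₄ * t₈ / q, q / (t₄ * t₈)] p

/-- The theta functions independent of `x` in the denominators of `contiguousRHS`. -/
def constDenominators (p q : ℂ) (t : Fin 6 → ℂ) : ℂ :=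
  thetas [q * t 5 / t 4, t 2 * t 5, t 3 * t 5] p

/-! ### The symmetric form of the operator, its conjugate and the inner product -/

/-- `ε_k = q/(c t_k)` (`k = 1,…,5`), `ε₆ = c t₆ p⁴`, `ε₈ = c/t₆`, `ε₇ = ε₈/q`. -/
def eps (p q : ℂ) (t : Fin 6 → ℂ) (c : ℂ) : Fin 8 → ℂ :=
  ![q / (c * t 0), q / (c * t 1), q / (c * t 2), q / (c * t 3), q / (c * t 4),
    c * t 5 * p ^ 4, c / t 5 / q, c / t 5]

/-- `A(x) = ∏_{k=1}^8 θ(ε_k x; p) / θ(x², q x²; p)`. -/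
def potA (p q : ℂ) (e : Fin 8 → ℂ) (x : ℂ) : ℂ :=
  (∏ k, theta (e k * x) p) / thetas [x ^ 2, q * x ^ 2] p

/-- `ν = ∏_{k=1}^6 θ(ε_k ε₈ / q; p)`. -/
def potNu (p q : ℂ) (e : Fin 8 → ℂ) : ℂ :=
  ∏ k : Fin 6, theta (e (Fin.castAdd 2 k) * e 7 / q) p

/-- `𝒟_x(ε) = A(x)(T - 1) + A(x⁻¹)(T⁻¹ - 1) + ν`, where `(T f)(x) = f(q x)`. -/
def opDx (p q : ℂ) (e : Fin 8 → ℂ) (f : ℂ → ℂ) (x : ℂ) : ℂ :=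
  potA p q e x * (f (q * x) - f x) + potA p q e x⁻¹ * (f (q⁻¹ * x) - f x) + potNu p q e * f x

/-- `α(x) = ∏_{k=1}^8 Γ(ε_k x^±)`. -/
def alphaFun (p q : ℂ) (e : Fin 8 → ℂ) (x : ℂ) : ℂ :=
  ∏ k, ellGamma p q (e k * x) * ellGamma p q (e k * x⁻¹)

/-- The conjugate operator `𝒟_x^*(ε) = α(x) 𝒟_x(ε) α(x)⁻¹`. -/
def opDxStar (p q : ℂ) (e : Fin 8 → ℂ) (f : ℂ → ℂ) (x : ℂ) : ℂ :=
  alphaFun p q e x * opDx p q e (fun y => (alphaFun p q e y)⁻¹ * f y) x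

/-- The weight `1 / Γ(x^{±2})`. -/
def weight (p q x : ℂ) : ℂ := 1 / (ellGamma p q (x ^ 2) * ellGamma p q (x⁻¹ ^ 2))

/-- The inner product `⟨χ, ψ⟩ = κ ∫_𝕋 χ(x) ψ(x) / Γ(x^{±2}) dx/x`. -/
def pairing (p q : ℂ) (χ ψ : ℂ → ℂ) : ℂ :=
  kappa p q * ∮ x in C(0, 1), χ x * ψ x * weight p q x / x

/-- The integral that defines `⟨χ, ψ⟩` converges. -/
def PairingConverges (p q : ℂ) (χ ψ : ℂ → ℂ) : Prop :=
  CircleIntegrable (fun x => χ x * ψ x * weight p q x / x) 0 1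

/-- `χ(x; ε) = α(x) U(t₁, …, t₆, c x⁻¹, c x)`. -/
def chiFun (p q : ℂ) (t : Fin 6 → ℂ) (c x : ℂ) : ℂ :=
  alphaFun p q (eps p q t c) x * Ufun p q t c x

/-- For all but countably many `x` on the unit circle, `V(t₁, …, t₆, c y⁻¹, c y)` is defined
at `y = x`, `y = q x` and `y = q⁻¹ x`. -/
def DefinedOnCircle (p q : ℂ) (t : Fin 6 → ℂ) (c : ℂ) : Prop :=
  ∃ S : Set ℂ, S.Countable ∧ ∀ x, ‖x‖ = 1 → x ∉ S →
    VDefined p q (par t c x) ∧ VDefined p q (par t c (q * x)) ∧ VDefined p q (par t c (q⁻¹ * x))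

/-- Up to a countable set of removable points, `h` is holomorphic in the annulus
`1 < |x| < |q|⁻¹` and continuous on its closure. -/
def RegularInAnnulus (q : ℂ) (h : ℂ → ℂ) : Prop :=
  ∃ g : ℂ → ℂ, ContinuousOn g {x | 1 ≤ ‖x‖ ∧ ‖x‖ ≤ ‖q‖⁻¹} ∧
    DifferentiableOn ℂ g {x | 1 < ‖x‖ ∧ ‖x‖ < ‖q‖⁻¹} ∧
    ∃ S : Set ℂ, S.Countable ∧ ∀ x, 1 ≤ ‖x‖ → ‖x‖ ≤ ‖q‖⁻¹ → x ∉ S → h x = g x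

/-- No singularities obstruct the conjugation of `𝒟_x(ε)` in `⟨χ, 𝒟_x(ε) φ⟩`: the function
`χ(x) A(x) φ(q x) / Γ(x^{±2})`, which is integrated over the circles `|x| = 1` and
`|x| = |q|⁻¹`, has none in the annulus between them. -/
def NoObstruction (p q : ℂ) (e : Fin 8 → ℂ) (χ φ : ℂ → ℂ) : Prop :=
  RegularInAnnulus q fun x => χ x * potA p q e x * φ (q * x) * weight p q x

end

end EllipticHypergeometric

namespace EllipticHypergeometric
open Complex Filter Topology

/-! ### Infinite products ∏ (1 - z wᵢ) with summable w -/

section Products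

variable {ι : Type*} {w : ι → ℂ}

/-! The engine is a zero count: a holomorphic function on ℂ^* with f(pz) = C z⁻ⁿ f(z) vanishes
identically once it has more than n zeros inequivalent modulo p^ℤ (`eq_zero_of_quasiPeriodic`). With
n = 2 it gives the three-term relation for θ (`addition_formula`), with n = 8 a partial fraction
identity (`defect_eq_zero`).

Operator identity. When t₃t₄ is fixed, each coefficient of 𝒟 depends on t₃, t₄ only through θ(yt₃,
yt₄; p), with y = t₇/q, t₈/q or t₆. The addition formula gives one linear relation, with
coefficients free of y, between these products for the three pairs (`theta_exchange`).

The equation 𝒟(t)U = 0. Replacing a parameter s by qs multiplies the kernel by θ(sz^±; p), so the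
addition formula becomes a relation between values of V. The normalisation of U is such that the
term a(T - 1)U collapses to a multiple of a single V, at (qt₆, q⁻¹t₇, t₈) (`coeffA_mul_sub`), and
likewise for T⁻¹. Then 𝒟(t)U is a combination of three values of V. By the partial fraction identity
the corresponding integrand is g(z) - g(qz) with g holomorphic near |q| ≤ |z| ≤ 1, and Cauchy's
theorem makes its integral vanish (`vIntegral_combination`).

Contiguous relation. Since 𝒟(t)U = 0, the operator identity shows that 𝒟(t')U divided by θ(t₃/t₃',
t₃/t₄'; p) does not depend on t₃'. For t₃' = q/t₈ the coefficient of T⁻¹ contains θ(1; p) = 0, and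
the two remaining terms are evaluated by the same two relations for V (`contiguous_special`).

The relations for U are proved with all parameters in the unit disc and then carried along entire
curves in the balancing hypersurface by the identity theorem (`eq_zero_of_balanced`).

Biorthogonality. Up to a constant, 𝒟(t) is 𝒟_x(ε), which is formally symmetric for the weight
α(x)/Γ(x^{±2}). As 𝒟_x(ε')ψ(x; ε') = 0, the integrand of ⟨χ, 𝒟_xφ⟩ is a sum of differences of
boundary values on |x| = 1 and |x| = |q|⁻¹ (`integrand_eq`), whose integral is zero by Cauchy's
theorem (`integral_boundary`). A q-periodic β commutes with 𝒟_x, so the contiguous relation turns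
𝒟_x(ε')βψ into a constant multiple of βR. -/

theorem summable_neg_mul (hw : Summable fun i => ‖w i‖) (z : ℂ) :
    Summable fun i => ‖-(z * w i)‖ := by
  simpa only [norm_neg, norm_mul] using hw.mul_left ‖z‖

theorem multipliable_one_sub (hw : Summable fun i => ‖w i‖) (z : ℂ) :
    Multipliable fun i => 1 - z * w i := by
  simpa only [sub_eq_add_neg] using multipliable_one_add_of_summable (summable_neg_mul hw z)

theorem tprod_one_sub_ne_zero (hw : Summable fun i => ‖w i‖) {z : ℂ} (hz : ∀ i, z * w i ≠ 1) :
    ∏' i, (1 - z * w i) ≠ 0 := by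
  have := tprod_one_add_ne_zero_of_summable (f := fun i => -(z * w i))
    (fun i h => hz i (by linear_combination -h)) (summable_neg_mul hw z)
  simpa only [sub_eq_add_neg] using this

theorem tprod_one_sub_eq_zero {z : ℂ} (i : ι) (hz : z * w i = 1) :
    ∏' i, (1 - z * w i) = 0 :=
  tprod_of_exists_eq_zero ⟨i, by rw [hz, sub_self]⟩

/-- On each disc about 0 the terms z wᵢ are dominated by a constant times |wᵢ|, so the finite
products converge locally uniformly, and they are polynomials in z. -/
theorem differentiable_tprod_one_sub (hw : Summable fun i => ‖w i‖) :
    Differentiable ℂ fun z => ∏' i, (1 - z * w i) := by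
  intro z
  have key : HasProdLocallyUniformlyOn (fun i (x : ℂ) => 1 + -(x * w i))
      (fun x => ∏' i, (1 + -(x * w i))) (Metric.ball 0 (‖z‖ + 1)) := by
    refine Summable.hasProdLocallyUniformlyOn_one_add Metric.isOpen_ball
      (hw.mul_left (‖z‖ + 1)) (Eventually.of_forall fun i x hx => ?_) fun i => by fun_prop
    rw [norm_neg, norm_mul]
    gcongr
    exact (mem_ball_zero_iff.1 hx).le
  have h2 := TendstoLocallyUniformlyOn.differentiableOn
    (hasProdLocallyUniformlyOn_iff_tendstoLocallyUniformlyOn.1 key)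
    (Eventually.of_forall fun s => by
      apply Differentiable.differentiableOn
      fun_prop) Metric.isOpen_ball
  have h3 := h2.differentiableAt (Metric.isOpen_ball.mem_nhds
    (mem_ball_zero_iff.2 (lt_add_one ‖z‖)))
  simpa only [sub_eq_add_neg] using h3

end Products

/-! ### Simple and double q-Pochhammer products -/

section Pochhammer

variable {p q : ℂ}

theorem summable_norm_pow (hp : ‖p‖ < 1) : Summable fun j : ℕ => ‖p ^ j‖ := by
  simpa only [norm_pow] using summable_geometric_of_lt_one (norm_nonneg p) hp

theorem summable_norm_pow_mul_pow (hp : ‖p‖ < 1) (hq : ‖q‖ < 1) :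
    Summable fun n : ℕ × ℕ => ‖p ^ n.1 * q ^ n.2‖ := by
  simpa only [norm_mul] using (summable_norm_pow hp).mul_of_nonneg (summable_norm_pow hq)
    (fun _ => norm_nonneg _) (fun _ => norm_nonneg _)

theorem poch₂_eq (z p q : ℂ) : poch₂ z p q = ∏' n : ℕ × ℕ, (1 - z * (p ^ n.1 * q ^ n.2)) := by
  simp only [poch₂, mul_assoc]

theorem differentiable_poch (hp : ‖p‖ < 1) : Differentiable ℂ fun z => poch z p :=
  differentiable_tprod_one_sub (summable_norm_pow hp)

theorem differentiable_poch₂ (hp : ‖p‖ < 1) (hq : ‖q‖ < 1) :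
    Differentiable ℂ fun z => poch₂ z p q := by
  simpa only [poch₂_eq] using differentiable_tprod_one_sub (summable_norm_pow_mul_pow hp hq)

theorem poch_eq_zero_iff (hp : ‖p‖ < 1) {z : ℂ} : poch z p = 0 ↔ ∃ j : ℕ, z * p ^ j = 1 := by
  refine ⟨fun h => ?_, fun ⟨j, hj⟩ => tprod_one_sub_eq_zero j hj⟩
  by_contra! hz
  exact tprod_one_sub_ne_zero (summable_norm_pow hp) hz h

theorem poch₂_eq_zero_iff (hp : ‖p‖ < 1) (hq : ‖q‖ < 1) {z : ℂ} :
    poch₂ z p q = 0 ↔ ∃ m n : ℕ, z * p ^ m * q ^ n = 1 := by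
  rw [poch₂_eq]
  refine ⟨fun h => ?_, fun ⟨m, n, h⟩ =>
    tprod_one_sub_eq_zero (m, n) (by simpa only [mul_assoc] using h)⟩
  by_contra! hz
  exact tprod_one_sub_ne_zero (summable_norm_pow_mul_pow hp hq)
    (fun n => by simpa only [mul_assoc] using hz n.1 n.2) h

theorem norm_pow_mul_pow_le (hp : ‖p‖ < 1) (hq : ‖q‖ < 1) (m n : ℕ) :
    ‖p ^ m * q ^ n‖ ≤ 1 := by
  rw [norm_mul, norm_pow, norm_pow]
  exact mul_le_one₀ (pow_le_one₀ (norm_nonneg _) hp.le) (pow_nonneg (norm_nonneg _) _)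
    (pow_le_one₀ (norm_nonneg _) hq.le)

theorem poch_ne_zero_of_norm_lt (hp : ‖p‖ < 1) {z : ℂ} (hz : ‖z‖ < 1) : poch z p ≠ 0 := by
  rw [Ne, poch_eq_zero_iff hp]
  rintro ⟨j, h⟩
  have h1 : ‖z‖ * ‖p ^ j‖ = 1 := by rw [← norm_mul, h, norm_one]
  have h2 : ‖p ^ j‖ ≤ 1 := by
    rw [norm_pow]; exact pow_le_one₀ (norm_nonneg _) hp.le
  nlinarith [norm_nonneg z]

theorem poch₂_ne_zero_of_norm_lt (hp : ‖p‖ < 1) (hq : ‖q‖ < 1) {z : ℂ} (hz : ‖z‖ < 1) :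
    poch₂ z p q ≠ 0 := by
  rw [Ne, poch₂_eq_zero_iff hp hq]
  rintro ⟨m, n, h⟩
  have h1 : ‖z‖ * ‖p ^ m * q ^ n‖ = 1 := by rw [← norm_mul, ← mul_assoc, h, norm_one]
  nlinarith [norm_nonneg z, norm_pow_mul_pow_le hp hq m n]

theorem poch_eq_mul (hp : ‖p‖ < 1) (z : ℂ) : poch z p = (1 - z) * poch (p * z) p := by
  have h : (fun j : ℕ => 1 - p * z * p ^ j) = fun j : ℕ => 1 - z * p ^ (j + 1) := by
    funext j; ring
  have h2 := (multipliable_one_sub (summable_norm_pow hp) (p * z)).hasProd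
  rw [h] at h2
  have h3 := (multipliable_one_sub (summable_norm_pow hp) z).hasProd.unique
    (HasProd.zero_mul (f := fun j : ℕ => 1 - z * p ^ j) h2)
  have h4 : poch (p * z) p = ∏' j : ℕ, (1 - z * p ^ (j + 1)) := by rw [← h]; rfl
  rw [h4]
  rw [poch]
  simpa using h3

theorem poch₂_comm (z p q : ℂ) : poch₂ z p q = poch₂ z q p := by
  rw [poch₂_eq, poch₂_eq, ← (Equiv.prodComm ℕ ℕ).tprod_eq]
  simp [mul_comm]

/-- The double product is taken row by row, with the exponent of q fixed in each row; splitting off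
the first row gives the effect of z ↦ qz. -/
theorem hasProd_poch (hp : ‖p‖ < 1) (hq : ‖q‖ < 1) (z : ℂ) :
    HasProd (fun n : ℕ => poch (z * q ^ n) p) (poch₂ z p q) := by
  have h := (multipliable_one_sub (summable_norm_pow_mul_pow hq hp) z).hasProd
  rw [poch₂_comm, poch₂_eq]
  refine h.prod_fiberwise fun n => ?_
  have := (multipliable_one_sub (summable_norm_pow hp) (z * q ^ n)).hasProd
  simpa only [mul_assoc, poch] using this

theorem poch₂_eq_mul (hp : ‖p‖ < 1) (hq : ‖q‖ < 1) (z : ℂ) :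
    poch₂ z p q = poch z p * poch₂ (q * z) p q := by
  have h := hasProd_poch hp hq (q * z)
  have h0 : (fun n : ℕ => poch (q * z * q ^ n) p) = fun n : ℕ => poch (z * q ^ (n + 1)) p := by
    funext n; congr 1; ring
  rw [h0] at h
  simpa using (hasProd_poch hp hq z).unique h.zero_mul

theorem poch₂_eq_mul' (hp : ‖p‖ < 1) (hq : ‖q‖ < 1) (z : ℂ) :
    poch₂ z p q = poch z q * poch₂ (p * z) p q := by
  rw [poch₂_comm, poch₂_eq_mul hq hp, poch₂_comm]

end Pochhammer

/-! ### Quasi-periodicity and zeros of θ -/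

section Theta

variable {p q : ℂ}

theorem differentiableAt_theta (hp : ‖p‖ < 1) {z : ℂ} (hz : z ≠ 0) :
    DifferentiableAt ℂ (fun z => theta z p) z := by
  unfold theta
  exact ((differentiable_poch hp) z).mul
    (((differentiable_poch hp) (p * z⁻¹)).comp z
      ((differentiableAt_const p).mul (differentiableAt_inv hz)))

theorem theta_mul_left (hp₀ : p ≠ 0) (hp : ‖p‖ < 1) {z : ℂ} (hz : z ≠ 0) :
    theta (p * z) p = -z⁻¹ * theta z p := by
  have h1 : p * (p * z)⁻¹ = z⁻¹ := by field_simp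
  rw [theta, theta, h1, poch_eq_mul hp z⁻¹, poch_eq_mul hp z]
  field_simp
  ring

theorem theta_inv (hp : ‖p‖ < 1) {z : ℂ} (hz : z ≠ 0) :
    theta z⁻¹ p = -z⁻¹ * theta z p := by
  rw [theta, theta, inv_inv, poch_eq_mul hp z⁻¹, poch_eq_mul hp z]
  field_simp
  ring

theorem theta_div_left (hp₀ : p ≠ 0) (hp : ‖p‖ < 1) {z : ℂ} (hz : z ≠ 0) :
    theta (z / p) p = -(z / p) * theta z p := by
  have h := theta_mul_left hp₀ hp (div_ne_zero hz hp₀)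
  rw [mul_div_cancel₀ _ hp₀] at h
  rw [h]
  field_simp

theorem theta_one (hp : ‖p‖ < 1) : theta 1 p = 0 := by
  rw [theta, poch_eq_mul hp 1]; simp

theorem theta_eq_zero_iff (hp₀ : p ≠ 0) (hp : ‖p‖ < 1) {z : ℂ} (hz : z ≠ 0) :
    theta z p = 0 ↔ ∃ k : ℤ, z = p ^ k := by
  rw [theta, mul_eq_zero, poch_eq_zero_iff hp, poch_eq_zero_iff hp]
  constructor
  · rintro (⟨j, hj⟩ | ⟨j, hj⟩)
    · exact ⟨-(j : ℤ), by rw [zpow_neg, zpow_natCast]; exact eq_inv_of_mul_eq_one_left hj⟩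
    · refine ⟨(j : ℤ) + 1, ?_⟩
      rw [zpow_add₀ hp₀, zpow_natCast, zpow_one]
      field_simp at hj
      linear_combination -hj
  · rintro ⟨k, rfl⟩
    rcases le_or_gt k 0 with hk | hk
    · obtain ⟨n, rfl⟩ := Int.exists_eq_neg_ofNat hk
      exact Or.inl ⟨n, by rw [zpow_neg, zpow_natCast]; exact inv_mul_cancel₀ (pow_ne_zero _ hp₀)⟩
    · obtain ⟨n, hn⟩ := Int.eq_ofNat_of_zero_le hk.le
      obtain ⟨m, rfl⟩ : ∃ m, n = m + 1 := ⟨n - 1, by omega⟩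
      refine Or.inr ⟨m, ?_⟩
      rw [hn, zpow_natCast, pow_succ]
      field_simp

/-- Iterate θ(pz) = -z⁻¹θ(z) in both directions. Only the power of z matters later, so the constant
stays implicit. -/
theorem theta_zpow_mul (hp₀ : p ≠ 0) (hp : ‖p‖ < 1) (k : ℤ) :
    ∃ c : ℂ, c ≠ 0 ∧ ∀ z : ℂ, z ≠ 0 → theta (p ^ k * z) p = c * z ^ (-k) * theta z p := by
  induction k with
  | zero => exact ⟨1, one_ne_zero, fun z _ => by simp⟩
  | succ k ih =>
    obtain ⟨c, hc, h⟩ := ih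
    refine ⟨-c * (p ^ (k : ℤ))⁻¹, by simp [hc, hp₀], fun z hz => ?_⟩
    have h1 : p ^ ((k : ℤ) + 1) * z = p * (p ^ (k : ℤ) * z) := by rw [zpow_add_one₀ hp₀]; ring
    rw [h1, theta_mul_left hp₀ hp (mul_ne_zero (zpow_ne_zero _ hp₀) hz), h z hz,
      show -((k : ℤ) + 1) = -k - 1 by ring, zpow_sub_one₀ hz]
    field_simp
  | pred k ih =>
    obtain ⟨c, hc, h⟩ := ih
    refine ⟨-c * p ^ (-(k : ℤ)) / p, by simp [hc, hp₀], fun z hz => ?_⟩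
    have h1 : p ^ (-(k : ℤ) - 1) * z = (p ^ (-(k : ℤ)) * z) / p := by
      rw [zpow_sub_one₀ hp₀]; ring
    rw [h1, theta_div_left hp₀ hp (mul_ne_zero (zpow_ne_zero _ hp₀) hz), h z hz,
      show -(-(k : ℤ) - 1) = -(-k) + 1 by ring, zpow_add_one₀ hz]
    ring

end Theta

/-! ### The elliptic gamma function and its reciprocal -/

section Gamma

variable {p q : ℂ}

theorem ellGamma_eq (p q z : ℂ) : ellGamma p q z = poch₂ (p * q / z) p q / poch₂ z p q := by
  unfold ellGamma poch₂
  congr 2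
  ext n
  ring

theorem ellGamma_ne_zero {z : ℂ} (h1 : poch₂ z p q ≠ 0) (h2 : poch₂ (p * q / z) p q ≠ 0) :
    ellGamma p q z ≠ 0 := by
  rw [ellGamma_eq]; exact div_ne_zero h2 h1

theorem differentiableAt_poch₂_div (hp : ‖p‖ < 1) (hq : ‖q‖ < 1) (a : ℂ) {z : ℂ} (hz : z ≠ 0) :
    DifferentiableAt ℂ (fun z => poch₂ (a / z) p q) z :=
  ((differentiable_poch₂ hp hq) (a / z)).comp z ((differentiableAt_const a).div
    differentiableAt_id hz)

theorem differentiableAt_ellGamma (hp : ‖p‖ < 1) (hq : ‖q‖ < 1) {z : ℂ} (hz : z ≠ 0)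
    (h : poch₂ z p q ≠ 0) : DifferentiableAt ℂ (ellGamma p q) z := by
  have : ellGamma p q = fun z => poch₂ (p * q / z) p q / poch₂ z p q := by
    funext z; exact ellGamma_eq p q z
  rw [this]
  exact (differentiableAt_poch₂_div hp hq _ hz).div (differentiable_poch₂ hp hq z) h

theorem differentiableAt_ellGamma_inv (hp : ‖p‖ < 1) (hq : ‖q‖ < 1) {z : ℂ} (hz : z ≠ 0)
    (h : poch₂ (p * q / z) p q ≠ 0) : DifferentiableAt ℂ (fun z => (ellGamma p q z)⁻¹) z := by
  have : (fun z => (ellGamma p q z)⁻¹) = fun z => poch₂ z p q / poch₂ (p * q / z) p q := by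
    funext z; rw [ellGamma_eq, inv_div]
  rw [this]
  exact (differentiable_poch₂ hp hq z).div (differentiableAt_poch₂_div hp hq _ hz) h

theorem poch₂_div_eq (hp : ‖p‖ < 1) (hq : ‖q‖ < 1) (z : ℂ) :
    poch₂ (p / z) p q = poch (p * z⁻¹) p * poch₂ (p * q / z) p q := by
  rw [poch₂_eq_mul hp hq, ← div_eq_mul_inv]
  congr 2
  ring

theorem ellGamma_mul (hp : ‖p‖ < 1) (hq₀ : q ≠ 0) (hq : ‖q‖ < 1) {z : ℂ}
    (h : poch₂ z p q ≠ 0) : ellGamma p q (q * z) = theta z p * ellGamma p q z := by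
  have h1 : p * q / (q * z) = p / z := by rw [mul_comm p q, mul_div_mul_left _ _ hq₀]
  have h2 := poch₂_eq_mul hp hq z
  have h3 : poch z p ≠ 0 := left_ne_zero_of_mul (h2 ▸ h)
  have h4 : poch₂ (q * z) p q ≠ 0 := right_ne_zero_of_mul (h2 ▸ h)
  rw [ellGamma_eq, ellGamma_eq, h1, poch₂_div_eq hp hq, h2, theta]
  field_simp

/-- For 1/Γ only the zeros of Γ need to be excluded: at a pole of Γ the convention x/0 = 0 gives
`ellGamma` the value 0, whose inverse 0 is the true value of 1/Γ. -/
theorem ellGamma_inv_eq (hp : ‖p‖ < 1) (hq₀ : q ≠ 0) (hq : ‖q‖ < 1) {z : ℂ}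
    (h : poch₂ (p / z) p q ≠ 0) :
    (ellGamma p q z)⁻¹ = theta z p * (ellGamma p q (q * z))⁻¹ := by
  have h1 : p * q / (q * z) = p / z := by rw [mul_comm p q, mul_div_mul_left _ _ hq₀]
  have h2 := poch₂_div_eq hp hq z
  have h3 : poch (p * z⁻¹) p ≠ 0 := left_ne_zero_of_mul (h2 ▸ h)
  have h4 : poch₂ (p * q / z) p q ≠ 0 := right_ne_zero_of_mul (h2 ▸ h)
  rw [ellGamma_eq, ellGamma_eq, h1, h2, theta, inv_div, inv_div, poch₂_eq_mul hp hq z]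
  generalize poch (p * z⁻¹) p = a at *
  generalize poch₂ (p * q / z) p q = b at *
  field_simp

/-- Splitting one row in p and one in q off the double products leaves only simple products. This is
why 1/Γ(z^{±2}) is a product of two theta functions on the unit circle. -/
theorem ellGamma_mul_ellGamma_inv (hp : ‖p‖ < 1) (hq : ‖q‖ < 1) {z : ℂ}
    (h1 : poch₂ (p * q * z) p q ≠ 0) (h2 : poch₂ (p * q / z) p q ≠ 0) :
    (ellGamma p q z * ellGamma p q z⁻¹)⁻¹ = theta z p * theta z⁻¹ q := by
  have e1 : p * q / z⁻¹ = p * q * z := by rw [div_inv_eq_mul]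
  have e2 : poch₂ z p q = poch z p * (poch (q * z) q * poch₂ (p * q * z) p q) := by
    rw [poch₂_eq_mul hp hq z, poch₂_eq_mul' hp hq (q * z), mul_assoc]
  have e3 : poch₂ z⁻¹ p q = poch z⁻¹ q * (poch (p * z⁻¹) p * poch₂ (p * q / z) p q) := by
    rw [poch₂_eq_mul' hp hq z⁻¹, ← div_eq_mul_inv p z, poch₂_div_eq hp hq, div_eq_mul_inv p z]
  rw [ellGamma_eq, ellGamma_eq, e1, e2, e3, theta, theta, inv_inv]
  field_simp

end Gamma

end EllipticHypergeometric

namespace EllipticHypergeometric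
open Complex Filter Topology

variable {p : ℂ}

/-! ### Zeros of theta functions -/

/-- By the identity theorem on the connected set ℂ^*, the alternative is that θ vanishes everywhere.
Its zeros lie in the countable set p^ℤ, so that is impossible. -/
theorem theta_eventually_ne_zero (hp₀ : p ≠ 0) (hp : ‖p‖ < 1) {a z : ℂ} (ha : a ≠ 0)
    (hz : z ≠ 0) : ∀ᶠ w in 𝓝[≠] z, theta (w / a) p ≠ 0 := by
  have han : AnalyticOnNhd ℂ (fun w => theta (w / a) p) {0}ᶜ := by
    refine DifferentiableOn.analyticOnNhd (fun w hw => ?_) isOpen_compl_singleton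
    exact ((differentiableAt_theta hp (div_ne_zero hw ha)).comp w
      (differentiableAt_id.div_const a)).differentiableWithinAt
  have hconn : IsPreconnected ({0}ᶜ : Set ℂ) :=
    (isConnected_compl_singleton_of_one_lt_rank (by simp) 0).isPreconnected
  rcases (han z hz).eventually_eq_zero_or_eventually_ne_zero with h | h
  · exfalso
    have h0 := han.eqOn_zero_of_preconnected_of_eventuallyEq_zero hconn hz h
    have hb : ∃ b : ℂ, b ≠ 0 ∧ theta b p ≠ 0 := by
      by_contra! hcon
      have hc : (Set.range fun k : ℤ => p ^ k).Countable := Set.countable_range _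
      have hd : ({0}ᶜ : Set ℂ) ⊆ Set.range fun k : ℤ => p ^ k := by
        intro b hb
        obtain ⟨k, hk⟩ := (theta_eq_zero_iff hp₀ hp hb).1 (hcon b hb)
        exact ⟨k, hk.symm⟩
      have hu : (Set.univ : Set ℂ).Countable := by
        have := (hc.mono hd).union (Set.countable_singleton (0 : ℂ))
        rwa [Set.compl_union_self] at this
      exact not_countable_complex hu
    obtain ⟨b, hb, hb'⟩ := hb
    apply hb'
    have := h0 (mul_ne_zero hb ha : b * a ∈ ({0}ᶜ : Set ℂ))
    simpa [ha] using this
  · exact h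

/-- Quasi-periodicity moves a zero p^k to 1, where the factor 1 - z/p^k splits off and leaves a
cofactor that is nonzero at the zero. So all zeros of θ are simple. -/
theorem deriv_theta_ne_zero (hp₀ : p ≠ 0) (hp : ‖p‖ < 1) {z : ℂ} (hz : z ≠ 0)
    (h : theta z p = 0) : deriv (fun z => theta z p) z ≠ 0 := by
  obtain ⟨k, rfl⟩ := (theta_eq_zero_iff hp₀ hp hz).1 h
  obtain ⟨c, hc, hk⟩ := theta_zpow_mul hp₀ hp k
  set b := p ^ k with hb
  have hev : (fun z => theta z p) =ᶠ[𝓝 b] fun z => (1 - z / b) *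
      (c * (z / b) ^ (-k) * (poch (p * (z / b)) p * poch (p * (z / b)⁻¹) p)) := by
    filter_upwards [isOpen_compl_singleton.mem_nhds hz] with w hw
    have hw' : w / b ≠ 0 := div_ne_zero hw hz
    have := hk (w / b) hw'
    rw [mul_div_cancel₀ _ hz] at this
    rw [this, theta, poch_eq_mul hp (w / b)]
    ring
  have hd : DifferentiableAt ℂ (fun z : ℂ => c * (z / b) ^ (-k) *
      (poch (p * (z / b)) p * poch (p * (z / b)⁻¹) p)) b := by
    have h1 : DifferentiableAt ℂ (fun z : ℂ => z / b) b := differentiableAt_id.div_const b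
    have hbb : b / b ≠ 0 := div_ne_zero hz hz
    have h2 : DifferentiableAt ℂ (fun z : ℂ => (z / b) ^ (-k)) b := h1.zpow (Or.inl hbb)
    have h3 : DifferentiableAt ℂ (fun z : ℂ => poch (p * (z / b)) p) b :=
      (differentiable_poch hp _).comp b (h1.const_mul p)
    have h4 : DifferentiableAt ℂ (fun z : ℂ => poch (p * (z / b)⁻¹) p) b :=
      (differentiable_poch hp _).comp b ((h1.inv hbb).const_mul p)
    exact (h2.const_mul c).mul (h3.mul h4)
  have h5 : HasDerivAt (fun z : ℂ => 1 - z / b) (-(1 / b)) b := by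
    simpa using ((hasDerivAt_id b).div_const b).const_sub 1
  rw [hev.deriv_eq, (h5.fun_mul hd.hasDerivAt).deriv]
  simp only [div_self hz, sub_self, zero_mul, add_zero, one_zpow, mul_one, inv_one]
  have := poch_ne_zero_of_norm_lt hp hp
  simp [hc, hz, this]

/-- A holomorphic function on `ℂ^*` which vanishes at the zeros of `θ(z/a; p)` is divisible by
that theta function. -/
theorem exists_eq_theta_mul (hp₀ : p ≠ 0) (hp : ‖p‖ < 1) {a : ℂ} (ha : a ≠ 0) {f : ℂ → ℂ}
    (hf : DifferentiableOn ℂ f {0}ᶜ) (h0 : ∀ z, z ≠ 0 → theta (z / a) p = 0 → f z = 0) :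
    ∃ g : ℂ → ℂ, DifferentiableOn ℂ g {0}ᶜ ∧ ∀ z, z ≠ 0 → f z = theta (z / a) p * g z := by
  set Θ : ℂ → ℂ := fun z => theta (z / a) p with hΘ
  have hΘd : DifferentiableOn ℂ Θ {0}ᶜ := fun w hw =>
    (DifferentiableAt.comp w (g := fun z => theta z p) (f := fun z => z / a)
      (differentiableAt_theta hp (div_ne_zero hw ha))
      (differentiableAt_id.div_const a)).differentiableWithinAt
  -- At the zeros of θ(z/a) the quotient is given its limit f'/Θ'. Near such a point it equals the
  -- quotient of the difference quotients `dslope`, which is holomorphic.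
  refine ⟨fun z => if Θ z = 0 then deriv f z / deriv Θ z else f z / Θ z, ?_, ?_⟩
  · intro w hw
    have hw0 : ({0}ᶜ : Set ℂ) ∈ 𝓝 w := isOpen_compl_singleton.mem_nhds hw
    apply DifferentiableAt.differentiableWithinAt
    by_cases hw1 : Θ w = 0
    · have hder : deriv Θ w ≠ 0 := by
        have h1 := (((differentiableAt_theta hp (div_ne_zero hw ha)).hasDerivAt).comp w
          ((hasDerivAt_id w).div_const a)).deriv
        have h2 := deriv_theta_ne_zero hp₀ hp (div_ne_zero hw ha) hw1
        have h3 : deriv Θ w = deriv (fun z => theta z p) (w / a) * (1 / a) := h1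
        rw [h3]
        exact mul_ne_zero h2 (one_div_ne_zero ha)
      have d1 := ((Complex.differentiableOn_dslope hw0).2 hf).differentiableAt hw0
      have d2 := ((Complex.differentiableOn_dslope hw0).2 hΘd).differentiableAt hw0
      refine (d1.div d2 (by rwa [dslope_same])).congr_of_eventuallyEq ?_
      have hev := theta_eventually_ne_zero hp₀ hp ha hw
      rw [eventually_nhdsWithin_iff] at hev
      filter_upwards [hev] with z hz
      by_cases hzw : z = w
      · subst hzw
        simp [hw1]
      · have hz1 : Θ z ≠ 0 := hz hzw
        rw [if_neg hz1, Pi.div_apply, dslope_of_ne _ hzw, dslope_of_ne _ hzw, slope_def_field,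
          slope_def_field, h0 w hw hw1, hw1, sub_zero, sub_zero,
          div_div_div_cancel_right₀ (sub_ne_zero.2 hzw)]
    · have hc : ∀ᶠ z in 𝓝 w, Θ z ≠ 0 :=
        (hΘd.differentiableAt hw0).continuousAt.eventually_ne hw1
      refine ((hf.differentiableAt hw0).div (hΘd.differentiableAt hw0) hw1).congr_of_eventuallyEq ?_
      filter_upwards [hc] with z hz
      simp [hz]
  · intro z hz
    by_cases h1 : Θ z = 0
    · simp only [if_pos h1]
      rw [h0 z hz h1, show theta (z / a) p = 0 from h1, zero_mul]
    · simp only [if_neg h1]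
      rw [mul_div_cancel₀ _ h1]

/-! ### Quasi-periodic functions on `ℂ^*` -/

theorem exists_zpow_mul_mem_annulus (hp₀ : p ≠ 0) (hp : ‖p‖ < 1) {z : ℂ} (hz : z ≠ 0) :
    ∃ k : ℤ, ‖p‖ ≤ ‖p ^ k * z‖ ∧ ‖p ^ k * z‖ ≤ 1 := by
  have hb : 1 < ‖p‖⁻¹ := (one_lt_inv₀ (norm_pos_iff.2 hp₀)).2 hp
  obtain ⟨k, hk1, hk2⟩ := exists_mem_Ioc_zpow (norm_pos_iff.2 hz) hb
  refine ⟨k + 1, ?_, ?_⟩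
  · rw [norm_mul, norm_zpow, zpow_add_one₀ (norm_pos_iff.2 hp₀).ne']
    rw [inv_zpow, ← zpow_neg] at hk1
    have h2 : 0 < ‖p‖ ^ k := zpow_pos (norm_pos_iff.2 hp₀) _
    rw [zpow_neg] at hk1
    have : 1 < ‖z‖ * ‖p‖ ^ k := by
      rwa [← inv_lt_iff_one_lt_mul₀ h2]
    nlinarith [norm_nonneg p]
  · rw [norm_mul, norm_zpow]
    rw [inv_zpow] at hk2
    have h2 : 0 < ‖p‖ ^ (k + 1) := zpow_pos (norm_pos_iff.2 hp₀) _
    calc ‖p‖ ^ (k + 1) * ‖z‖ ≤ ‖p‖ ^ (k + 1) * (‖p‖ ^ (k + 1))⁻¹ := by gcongr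
      _ = 1 := mul_inv_cancel₀ h2.ne'

/-- Liouville: u ↦ f(exp u) is entire, and it is bounded because every orbit of p^ℤ meets the
compact annulus |p| ≤ |z| ≤ 1. -/
theorem elliptic_eq (hp₀ : p ≠ 0) (hp : ‖p‖ < 1) {f : ℂ → ℂ}
    (hf : DifferentiableOn ℂ f {0}ᶜ) (h : ∀ z, z ≠ 0 → f (p * z) = f z) {z w : ℂ}
    (hz : z ≠ 0) (hw : w ≠ 0) : f z = f w := by
  have hk : ∀ (k : ℤ) (z : ℂ), z ≠ 0 → f (p ^ k * z) = f z := by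
    intro k
    induction k with
    | zero => intro z _; simp
    | succ k ih =>
      intro z hz
      rw [zpow_add_one₀ hp₀, mul_assoc, ih _ (mul_ne_zero hp₀ hz), h z hz]
    | pred k ih =>
      intro z hz
      rw [zpow_sub_one₀ hp₀, mul_assoc, ih _ (mul_ne_zero (inv_ne_zero hp₀) hz),
        ← h _ (mul_ne_zero (inv_ne_zero hp₀) hz), mul_inv_cancel_left₀ hp₀]
  have hd : Differentiable ℂ fun u => f (Complex.exp u) := fun u =>
    (hf.differentiableAt (isOpen_compl_singleton.mem_nhds (Complex.exp_ne_zero u))).comp u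
      Complex.differentiableAt_exp
  have hcomp : IsCompact {z : ℂ | ‖p‖ ≤ ‖z‖ ∧ ‖z‖ ≤ 1} := by
    refine Metric.isCompact_of_isClosed_isBounded
      ((isClosed_le continuous_const continuous_norm).inter
        (isClosed_le continuous_norm continuous_const)) ?_
    exact (Metric.isBounded_closedBall (x := (0 : ℂ)) (r := 1)).subset fun z hz =>
      mem_closedBall_zero_iff.2 hz.2
  have hne : ∀ z ∈ {z : ℂ | ‖p‖ ≤ ‖z‖ ∧ ‖z‖ ≤ 1}, z ≠ 0 := fun z hz h0 => by
    rw [Set.mem_ofPred_eq, h0, norm_zero] at hz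
    exact (norm_pos_iff.2 hp₀).not_ge hz.1
  obtain ⟨C, hC⟩ := hcomp.exists_bound_of_continuousOn
    (hf.continuousOn.mono fun z hz => hne z hz)
  have hbd : Bornology.IsBounded (Set.range fun u => f (Complex.exp u)) := by
    refine (Metric.isBounded_closedBall (x := (0 : ℂ)) (r := C)).subset ?_
    rintro _ ⟨u, rfl⟩
    obtain ⟨k, hk1⟩ := exists_zpow_mul_mem_annulus hp₀ hp (Complex.exp_ne_zero u)
    rw [mem_closedBall_zero_iff]
    simp only []
    rw [← hk k _ (Complex.exp_ne_zero u)]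
    exact hC _ hk1
  have := hd.apply_eq_apply_of_bounded hbd (Complex.log z) (Complex.log w)
  simpa only [Complex.exp_log hz, Complex.exp_log hw] using this

theorem eq_zero_of_theta_mul_eq_zero (hp₀ : p ≠ 0) (hp : ‖p‖ < 1) {a : ℂ} (ha : a ≠ 0)
    {f : ℂ → ℂ} (hf : DifferentiableOn ℂ f {0}ᶜ)
    (h : ∀ z, z ≠ 0 → theta (z / a) p ≠ 0 → f z = 0) {z : ℂ} (hz : z ≠ 0) : f z = 0 := by
  have h1 : Tendsto f (𝓝[≠] z) (𝓝 (f z)) :=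
    (hf.differentiableAt (isOpen_compl_singleton.mem_nhds hz)).continuousAt.tendsto.mono_left
      nhdsWithin_le_nhds
  refine tendsto_nhds_unique h1 (tendsto_const_nhds.congr' ?_)
  have h2 : ∀ᶠ w in 𝓝[≠] z, w ≠ 0 :=
    nhdsWithin_le_nhds (isOpen_compl_singleton.mem_nhds hz)
  filter_upwards [theta_eventually_ne_zero hp₀ hp ha hz, h2] with w hw hw0
  exact (h w hw0 hw).symm

/-- A holomorphic function on `ℂ^*` with `f(pz) = C z^m f(z)`, where `m ≥ 1`, vanishes. -/
theorem eq_zero_of_quasiPeriodic_pos (hp₀ : p ≠ 0) (hp : ‖p‖ < 1) {f : ℂ → ℂ} {C : ℂ} {m : ℕ}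
    (hm : 0 < m) (hf : DifferentiableOn ℂ f {0}ᶜ)
    (h : ∀ z, z ≠ 0 → f (p * z) = C * z ^ m * f z) {z : ℂ} (hz : z ≠ 0) : f z = 0 := by
  by_cases hC : C = 0
  · have := h (z / p) (div_ne_zero hz hp₀)
    rwa [mul_div_cancel₀ _ hp₀, hC, zero_mul, zero_mul] at this
  -- With this a the function f(z) θ(z/a)^m is invariant under z ↦ pz, hence constant; it vanishes
  -- at z = a.
  obtain ⟨a, ha⟩ := IsAlgClosed.exists_pow_nat_eq (((-1) ^ m * C)⁻¹) hm
  have ha0 : a ≠ 0 := by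
    rintro rfl
    rw [zero_pow hm.ne'] at ha
    exact inv_ne_zero (mul_ne_zero (pow_ne_zero _ (by norm_num)) hC) ha.symm
  have hCa : C * (-a) ^ m = 1 := by
    rw [neg_pow, ha]
    field_simp
  have hd : DifferentiableOn ℂ (fun z => f z * theta (z / a) p ^ m) {0}ᶜ := fun w hw =>
    (hf w hw).mul (((differentiableAt_theta hp (div_ne_zero hw ha0)).comp w
      (differentiableAt_id.div_const a)).pow m).differentiableWithinAt
  have hper : ∀ z, z ≠ 0 → f (p * z) * theta (p * z / a) p ^ m = f z * theta (z / a) p ^ m := by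
    intro z hz
    rw [h z hz, mul_div_assoc, theta_mul_left hp₀ hp (div_ne_zero hz ha0), mul_pow, inv_div]
    have : C * z ^ m * (-(a / z)) ^ m = 1 := by
      rw [← hCa, mul_assoc, ← mul_pow]
      congr 2
      field_simp
    linear_combination (f z * theta (z / a) p ^ m) * this
  refine eq_zero_of_theta_mul_eq_zero hp₀ hp ha0 hf (fun w hw hθ => ?_) hz
  have := elliptic_eq hp₀ hp hd hper hw ha0
  simp only [div_self ha0, theta_one hp, zero_pow hm.ne', mul_zero] at this
  exact (mul_eq_zero.1 this).resolve_right (pow_ne_zero _ hθ)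

/-- A holomorphic function on `ℂ^*` with `f(pz) = C z^{-n} f(z)` and more than `n` zeros that
are inequivalent modulo `p^ℤ` vanishes. -/
theorem eq_zero_of_quasiPeriodic (hp₀ : p ≠ 0) (hp : ‖p‖ < 1) (l : List ℂ) :
    ∀ (n : ℤ) (C : ℂ) (f : ℂ → ℂ), n < l.length → DifferentiableOn ℂ f {0}ᶜ →
      (∀ z, z ≠ 0 → f (p * z) = C * z ^ (-n) * f z) → (∀ a ∈ l, a ≠ 0 ∧ f a = 0) →
      l.Pairwise (fun a b => theta (b / a) p ≠ 0) → ∀ z, z ≠ 0 → f z = 0 := by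
  induction l with
  | nil =>
    intro n C f hn hf h _ _ z hz
    obtain ⟨m, hm⟩ : ∃ m : ℕ, -n = m := Int.eq_ofNat_of_zero_le (by simp at hn; omega)
    refine eq_zero_of_quasiPeriodic_pos hp₀ hp (C := C) (m := m) (by simp at hn; omega) hf ?_ hz
    intro z hz
    rw [h z hz, hm, zpow_natCast]
  | cons a l ih =>
    intro n C f hn hf h hl hpw z hz
    obtain ⟨ha, hfa⟩ := hl a (by simp)
    rw [List.pairwise_cons] at hpw
    -- The zero at a propagates to its whole orbit, as division by θ(z/a) requires. The case C = 0
    -- is separate since C must be cancelled when going down.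
    have hk : ∀ (k : ℤ), f (p ^ k * a) = 0 := by
      have hC : ∀ z, z ≠ 0 → f z = 0 → f (p * z) = 0 := fun z hz h0 => by
        rw [h z hz, h0, mul_zero]
      by_cases hC0 : C = 0
      · intro k
        have := h (p ^ k * a / p) (div_ne_zero (mul_ne_zero (zpow_ne_zero _ hp₀) ha) hp₀)
        rwa [mul_div_cancel₀ _ hp₀, hC0, zero_mul, zero_mul] at this
      intro k
      induction k with
      | zero => simpa using hfa
      | succ k ihk =>
        rw [add_comm, zpow_add₀ hp₀, zpow_one, mul_assoc]
        exact hC _ (mul_ne_zero (zpow_ne_zero _ hp₀) ha) ihk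
      | pred k ihk =>
        have hne : p ^ (-(k : ℤ) - 1) * a ≠ 0 := mul_ne_zero (zpow_ne_zero _ hp₀) ha
        have h1 := h _ hne
        rw [← mul_assoc, ← zpow_one_add₀ hp₀, add_sub_cancel, ihk] at h1
        exact (mul_eq_zero.1 h1.symm).resolve_left (mul_ne_zero hC0 (zpow_ne_zero _ hne))
    obtain ⟨g, hg, hfg⟩ := exists_eq_theta_mul hp₀ hp ha hf fun z hz h0 => by
      obtain ⟨k, hk'⟩ := (theta_eq_zero_iff hp₀ hp (div_ne_zero hz ha)).1 h0
      rw [div_eq_iff ha] at hk'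
      rw [hk']; exact hk k
    have hd : DifferentiableOn ℂ (fun z => g (p * z) - C * (-a)⁻¹ * z ^ (-(n - 1)) * g z) {0}ᶜ := by
      intro w hw
      have h1 : DifferentiableAt ℂ g (p * w) :=
        hg.differentiableAt (isOpen_compl_singleton.mem_nhds (mul_ne_zero hp₀ hw))
      have h2 : DifferentiableAt ℂ g w := hg.differentiableAt (isOpen_compl_singleton.mem_nhds hw)
      have h3 : DifferentiableAt ℂ (fun z => g (p * z)) w :=
        h1.comp w (differentiableAt_id.const_mul p)
      have h4 : DifferentiableAt ℂ (fun z : ℂ => z ^ (-(n - 1))) w :=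
        differentiableAt_zpow.2 (Or.inl hw)
      exact (h3.sub ((h4.const_mul _).mul h2)).differentiableWithinAt
    -- Dividing by θ(z/a) lowers n by one. The relation for g is clear where θ(z/a) ≠ 0 and extends
    -- by continuity.
    have hgp : ∀ z, z ≠ 0 → g (p * z) = C * (-a)⁻¹ * z ^ (-(n - 1)) * g z := by
      intro z hz
      refine sub_eq_zero.1 (eq_zero_of_theta_mul_eq_zero hp₀ hp ha hd (fun w hw hθ => ?_) hz)
      have h1 := h w hw
      rw [hfg _ (mul_ne_zero hp₀ hw), hfg w hw, mul_div_assoc,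
        theta_mul_left hp₀ hp (div_ne_zero hw ha)] at h1
      rw [show -(n - 1) = -n + 1 by ring, zpow_add_one₀ hw]
      have h2 : -(w / a)⁻¹ * g (p * w) = C * w ^ (-n) * g w :=
        mul_left_cancel₀ hθ (by linear_combination h1)
      have h3 : g (p * w) = -(w / a) * (-(w / a)⁻¹ * g (p * w)) := by
        field_simp
      rw [h3, h2]
      field_simp
      ring
    have := ih (n - 1) _ g (by simp at hn; omega) hg hgp (fun b hb => by
      obtain ⟨hb0, hfb⟩ := hl b (List.mem_cons_of_mem _ hb)
      refine ⟨hb0, ?_⟩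
      rw [hfg b hb0] at hfb
      exact (mul_eq_zero.1 hfb).resolve_left (hpw.1 b hb)) hpw.2 z hz
    rw [hfg z hz, this, mul_zero]

end EllipticHypergeometric

namespace EllipticHypergeometric
open Complex Filter Topology

variable {p : ℂ}

/-! ### Regularity of theta functions along curves -/

@[fun_prop]
theorem DifferentiableAt.theta {f : ℂ → ℂ} {x : ℂ} (hf : DifferentiableAt ℂ f x) (hp : ‖p‖ < 1)
    (h0 : f x ≠ 0) : DifferentiableAt ℂ (fun x => theta (f x) p) x :=
  DifferentiableAt.comp x (g := fun z => EllipticHypergeometric.theta z p)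
    (differentiableAt_theta hp h0) hf

/-- Used to deform parameters: along exponential curves a nonconstant monomial in the parameters
meets p^ℤ only for countably many u, so genericity assumptions can be removed by continuity. -/
theorem countable_zpow_exp (p : ℂ) {a : ℂ} (ha : a ≠ 0) {n : ℂ} (hn : n ≠ 0) :
    {u : ℂ | ∃ k : ℤ, a * Complex.exp (n * u) = p ^ k}.Countable := by
  have h1 : (Set.range fun k : ℤ => a⁻¹ * p ^ k).Countable := Set.countable_range _
  have h2 := h1.preimage_cexp.preimage (mul_right_injective₀ hn)
  refine h2.mono ?_
  rintro u ⟨k, hk⟩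
  refine ⟨k, ?_⟩
  change a⁻¹ * p ^ k = Complex.exp (n * u)
  rw [← hk, inv_mul_cancel_left₀ ha]

theorem eq_zero_of_countable {f : ℂ → ℂ} (hf : Continuous f) {S : Set ℂ} (hS : S.Countable)
    (h : ∀ u, u ∉ S → f u = 0) (u : ℂ) : f u = 0 :=
  congrFun (Continuous.ext_on (hS.dense_compl ℂ) hf continuous_const fun u hu => h u hu) u

theorem theta_inv_eq_zero_iff (hp : ‖p‖ < 1) {z : ℂ} (hz : z ≠ 0) :
    theta z⁻¹ p = 0 ↔ theta z p = 0 := by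
  rw [theta_inv hp hz]; simp [hz]

theorem theta_div_comm (hp : ‖p‖ < 1) {a b : ℂ} (ha : a ≠ 0) (hb : b ≠ 0) :
    theta (a / b) p = -(a / b) * theta (b / a) p := by
  rw [← inv_div, theta_inv hp (div_ne_zero hb ha), inv_div]

/-- `θ(az^±; p)`. -/
noncomputable def phi (p a z : ℂ) : ℂ := theta (a * z) p * theta (a * z⁻¹) p

theorem phi_inv (p a z : ℂ) : phi p a z⁻¹ = phi p a z := by
  rw [phi, phi, inv_inv, mul_comm]

theorem phi_self (hp : ‖p‖ < 1) {a : ℂ} (ha : a ≠ 0) : phi p a a = 0 := by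
  rw [phi, mul_inv_cancel₀ ha, theta_one hp, mul_zero]

theorem theta_mul_mul (hp₀ : p ≠ 0) (hp : ‖p‖ < 1) {a z : ℂ} (ha : a ≠ 0) (hz : z ≠ 0) :
    theta (a * (p * z)) p = -(a * z)⁻¹ * theta (a * z) p := by
  rw [mul_left_comm, theta_mul_left hp₀ hp (mul_ne_zero ha hz)]

theorem theta_mul_mul_inv (hp₀ : p ≠ 0) (hp : ‖p‖ < 1) {a z : ℂ} (ha : a ≠ 0) (hz : z ≠ 0) :
    theta (a * (p * z)⁻¹) p = -(a * z⁻¹ / p) * theta (a * z⁻¹) p := by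
  rw [mul_inv, mul_left_comm, inv_mul_eq_div,
    theta_div_left hp₀ hp (mul_ne_zero ha (inv_ne_zero hz))]

theorem phi_mul (hp₀ : p ≠ 0) (hp : ‖p‖ < 1) {a z : ℂ} (ha : a ≠ 0) (hz : z ≠ 0) :
    phi p a (p * z) = (p * z ^ 2)⁻¹ * phi p a z := by
  rw [phi, theta_mul_mul hp₀ hp ha hz, theta_mul_mul_inv hp₀ hp ha hz, phi]
  field_simp

/-- The parameters `a`, `b` of two theta functions are inequivalent modulo inversion
and `p^ℤ`. -/
theorem theta_ne_zero_of_phi (hp : ‖p‖ < 1) {a b : ℂ} (ha : a ≠ 0) (hb : b ≠ 0)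
    (h : phi p a b ≠ 0) : theta (b / a) p ≠ 0 ∧ theta (b⁻¹ / a) p ≠ 0 ∧
      theta (b / a⁻¹) p ≠ 0 ∧ theta (b⁻¹ / a⁻¹) p ≠ 0 := by
  have h1 := left_ne_zero_of_mul h
  have h2 := right_ne_zero_of_mul h
  have h1' := (theta_inv_eq_zero_iff hp (mul_ne_zero ha hb)).not.2 h1
  have h2' := (theta_inv_eq_zero_iff hp (mul_ne_zero ha (inv_ne_zero hb))).not.2 h2
  refine ⟨?_, ?_, ?_, ?_⟩
  · convert h2' using 2; field_simp
  · convert h1' using 2; field_simp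
  · convert h1 using 2; field_simp
  · convert h2 using 2; field_simp

/-- Here e is a half period of the multiplicative torus; if e/a or ea were in p^ℤ, then a² would be
too. -/
theorem theta_ne_zero_of_sq (hp₀ : p ≠ 0) (hp : ‖p‖ < 1) {a e : ℂ} {m : ℤ} (ha : a ≠ 0)
    (he : e ^ 2 = p ^ m) (h : theta (a ^ 2) p ≠ 0) :
    theta (e / a) p ≠ 0 ∧ theta (e / a⁻¹) p ≠ 0 := by
  have he0 : e ≠ 0 := by
    rintro rfl
    rw [zero_pow two_ne_zero] at he
    exact zpow_ne_zero m hp₀ he.symm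
  rw [Ne, theta_eq_zero_iff hp₀ hp (pow_ne_zero 2 ha)] at h
  push Not at h
  constructor
  · rw [Ne, theta_eq_zero_iff hp₀ hp (div_ne_zero he0 ha)]
    rintro ⟨k, hk⟩
    refine h (m - 2 * k) ?_
    rw [zpow_sub₀ hp₀, ← he, mul_comm 2 k, zpow_mul, ← hk]
    norm_cast
    field_simp
  · rw [Ne, theta_eq_zero_iff hp₀ hp (div_ne_zero he0 (inv_ne_zero ha))]
    rintro ⟨k, hk⟩
    refine h (2 * k - m) ?_
    rw [zpow_sub₀ hp₀, ← he, mul_comm 2 k, zpow_mul, ← hk]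
    norm_cast
    field_simp

theorem zpow_eq_of_sq_eq (hp₀ : p ≠ 0) (hp : ‖p‖ < 1) {e : ℂ} {m k : ℤ} (he : e ^ 2 = p ^ m)
    (hk : e = p ^ k) : m = 2 * k := by
  have h : ‖p‖ ^ m = ‖p‖ ^ (2 * k) := by
    rw [← norm_zpow, ← norm_zpow, ← he, hk, mul_comm 2 k, zpow_mul]
    norm_cast
  exact (zpow_right_inj₀ (norm_pos_iff.2 hp₀) hp.ne).1 h

/-! ### The addition formula -/

/-- As a function of z the difference of the two sides is multiplied by p⁻¹z⁻² under z ↦ pz, and it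
vanishes at w, w⁻¹ and b: three zeros where only two are allowed. -/
theorem addition_formula_of_generic (hp₀ : p ≠ 0) (hp : ‖p‖ < 1) {a b w z : ℂ} (ha : a ≠ 0)
    (hb : b ≠ 0) (hw : w ≠ 0) (hz : z ≠ 0) (hw2 : theta (w ^ 2) p ≠ 0) (hbw : phi p w b ≠ 0) :
    phi p a z * phi p b w - phi p b z * phi p a w = -(b / w) * phi p a b * phi p w z := by
  have key := eq_zero_of_quasiPeriodic hp₀ hp [w, w⁻¹, b] 2 p⁻¹
    (fun z => phi p a z * phi p b w - phi p b z * phi p a w + (b / w) * phi p a b * phi p w z)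
    (by simp) (fun z hz => ?_) (fun z hz => ?_) ?_ ?_ z hz
  · linear_combination key
  · have hz0 : z ≠ 0 := hz
    unfold phi
    apply DifferentiableAt.differentiableWithinAt
    fun_prop (disch := simp_all)
  · simp only [phi_mul hp₀ hp ha hz, phi_mul hp₀ hp hb hz, phi_mul hp₀ hp hw hz]
    rw [zpow_neg]
    norm_cast
    field_simp
  · have h1 : phi p a w * phi p b w - phi p b w * phi p a w + b / w * phi p a b * phi p w w = 0 := by
      rw [phi_self hp hw]; ring
    have h2 : phi p a b * phi p b w - phi p b b * phi p a w
        + b / w * phi p a b * phi p w b = 0 := by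
      rw [phi_self hp hb, phi, phi, phi, phi, ← div_eq_mul_inv b w, ← div_eq_mul_inv w b,
        theta_div_comm hp hw hb, mul_comm w b]
      field_simp
      ring_nf
    simp only [List.forall_mem_cons, phi_inv]
    exact ⟨⟨hw, h1⟩, ⟨inv_ne_zero hw, h1⟩, ⟨hb, h2⟩, by simp⟩
  · have h1 := theta_ne_zero_of_phi hp hw hb hbw
    have h2 := (theta_inv_eq_zero_iff hp (pow_ne_zero 2 hw)).not.2 hw2
    have h3 : w⁻¹ / w = (w ^ 2)⁻¹ := by field_simp
    have h4 := h1.2.2.1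
    rw [div_inv_eq_mul] at h4
    simp [h1, h2, h3, h4]

theorem addition_formula (hp₀ : p ≠ 0) (hp : ‖p‖ < 1) {a b w z : ℂ} (ha : a ≠ 0)
    (hb : b ≠ 0) (hw : w ≠ 0) (hz : z ≠ 0) :
    phi p a z * phi p b w - phi p b z * phi p a w = -(b / w) * phi p a b * phi p w z := by
  -- The weights 2 and 1 keep W², WB and W/B all nonconstant in u, so each generic condition fails
  -- only countably often.
  let B : ℂ → ℂ := fun u => b * Complex.exp (2 * u)
  let W : ℂ → ℂ := fun u => w * Complex.exp u
  have hB : ∀ u, B u ≠ 0 := fun u => mul_ne_zero hb (Complex.exp_ne_zero _)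
  have hW : ∀ u, W u ≠ 0 := fun u => mul_ne_zero hw (Complex.exp_ne_zero _)
  have hBd : Differentiable ℂ B := by fun_prop
  have hWd : Differentiable ℂ W := by fun_prop
  have key := eq_zero_of_countable (f := fun u => phi p a z * phi p (B u) (W u)
      - phi p (B u) z * phi p a (W u) + (B u / W u) * phi p a (B u) * phi p (W u) z)
    (S := {u | ∃ k : ℤ, w ^ 2 * Complex.exp (2 * u) = p ^ k} ∪
      ({u | ∃ k : ℤ, w * b * Complex.exp (3 * u) = p ^ k} ∪
        {u | ∃ k : ℤ, w / b * Complex.exp (-1 * u) = p ^ k})) ?_ ?_ ?_ 0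
  · simp only [B, W, mul_zero, Complex.exp_zero, mul_one] at key
    linear_combination key
  · unfold phi
    refine Differentiable.continuous (𝕜 := ℂ) fun u => ?_
    fun_prop (disch := simp_all)
  · exact (countable_zpow_exp p (pow_ne_zero 2 hw) two_ne_zero).union
      ((countable_zpow_exp p (mul_ne_zero hw hb) three_ne_zero).union
        (countable_zpow_exp p (div_ne_zero hw hb) (by norm_num)))
  · intro u hu
    simp only [Set.mem_union, not_or, Set.mem_ofPred_eq] at hu
    have := addition_formula_of_generic hp₀ hp ha (hB u) (hW u) hz
      (by
        rw [Ne, theta_eq_zero_iff hp₀ hp (pow_ne_zero 2 (hW u))]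
        convert hu.1 using 4
        simp only [W, mul_pow, ← Complex.exp_nat_mul]; norm_num)
      (mul_ne_zero
        (by
          rw [Ne, theta_eq_zero_iff hp₀ hp (mul_ne_zero (hW u) (hB u))]
          convert hu.2.1 using 4
          simp only [W, B]
          rw [show (3 : ℂ) * u = u + 2 * u by ring, Complex.exp_add]
          ring)
        (by
          rw [Ne, theta_eq_zero_iff hp₀ hp (mul_ne_zero (hW u) (inv_ne_zero (hB u)))]
          convert hu.2.2 using 4
          simp only [W, B]
          rw [show (-1 : ℂ) * u = u - 2 * u by ring, Complex.exp_sub]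
          field_simp))
    linear_combination this

end EllipticHypergeometric

namespace EllipticHypergeometric
open Complex Filter Topology

variable {p : ℂ}

/-! ### A partial fraction expansion for theta functions -/

/-- `θ(s₁x, …, s₅x; p)`. -/
noncomputable def five (p : ℂ) (s : Fin 8 → ℂ) (x : ℂ) : ℂ :=
  theta (s 0 * x) p * theta (s 1 * x) p * theta (s 2 * x) p * theta (s 3 * x) p * theta (s 4 * x) p

/-- `z³ ∏ θ(s_j/z; p) - z⁻¹ ∏ θ(s_j z; p)`. -/
noncomputable def bracket (p : ℂ) (s : Fin 8 → ℂ) (z : ℂ) : ℂ :=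
  z ^ 3 * (∏ j, theta (s j * z⁻¹) p) - z⁻¹ * ∏ j, theta (s j * z) p

/-- A combination of `θ(s₇z^±, s₈z^±; p)`, `θ(s₆z^±, s₈z^±; p)` and `θ(s₆z^±, s₇z^±; p)`. -/
noncomputable def combination (p : ℂ) (s : Fin 8 → ℂ) (z : ℂ) : ℂ :=
  -theta (s 7 / s 6) p * five p s (s 5) * (phi p (s 6) z * phi p (s 7) z)
    + theta (s 7 / s 5) p * five p s (s 6) * (phi p (s 5) z * phi p (s 7) z)
    - (s 7 / s 6) * theta (s 6 / s 5) p * five p s (s 7) * (phi p (s 5) z * phi p (s 6) z)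

/-- The difference of the two sides of the expansion. -/
noncomputable def defect (p : ℂ) (s : Fin 8 → ℂ) (z : ℂ) : ℂ :=
  s 5 * (theta (s 6 / s 5) p * theta (s 7 / s 5) p * theta (s 7 / s 6) p) * bracket p s z
    - theta (z ^ 2) p * combination p s z

theorem prod_theta (p : ℂ) (s : Fin 8 → ℂ) (x : ℂ) : ∏ j, theta (s j * x) p =
    five p s x * (theta (s 5 * x) p * theta (s 6 * x) p * theta (s 7 * x) p) := by
  rw [Fin.prod_univ_eight, five]; ring

theorem combination_inv (p : ℂ) (s : Fin 8 → ℂ) (z : ℂ) :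
    combination p s z⁻¹ = combination p s z := by
  simp only [combination, phi_inv]

theorem bracket_inv (p : ℂ) (s : Fin 8 → ℂ) {z : ℂ} (hz : z ≠ 0) :
    bracket p s z⁻¹ = -(z ^ 2)⁻¹ * bracket p s z := by
  simp only [bracket, inv_inv]
  field_simp
  ring

/-- This antisymmetry under z ↦ z⁻¹ forces zeros at z = ±1 and, together with `defect_mul`, at the
square roots of p. -/
theorem defect_inv (hp : ‖p‖ < 1) (s : Fin 8 → ℂ) {z : ℂ} (hz : z ≠ 0) :
    defect p s z⁻¹ = -(z ^ 2)⁻¹ * defect p s z := by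
  rw [defect, defect, bracket_inv p s hz, combination_inv, inv_pow,
    theta_inv hp (pow_ne_zero 2 hz)]
  ring

theorem theta_sq_mul (hp₀ : p ≠ 0) (hp : ‖p‖ < 1) {z : ℂ} (hz : z ≠ 0) :
    theta ((p * z) ^ 2) p = (p * z ^ 4)⁻¹ * theta (z ^ 2) p := by
  rw [show (p * z) ^ 2 = p * (p * z ^ 2) by ring,
    theta_mul_left hp₀ hp (mul_ne_zero hp₀ (pow_ne_zero 2 hz)),
    theta_mul_left hp₀ hp (pow_ne_zero 2 hz)]
  field_simp

theorem combination_mul (hp₀ : p ≠ 0) (hp : ‖p‖ < 1) {s : Fin 8 → ℂ} (hs : ∀ j, s j ≠ 0) {z : ℂ}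
    (hz : z ≠ 0) : combination p s (p * z) = (p ^ 2 * z ^ 4)⁻¹ * combination p s z := by
  simp only [combination, phi_mul hp₀ hp (hs _) hz]
  field_simp

/-- The two products acquire the factors (p⁶z⁸)⁻¹ and (p²z⁸)⁻¹. The prefactors z³ and z⁻¹ make up
the difference; the condition ∏ s_j = p² is exactly what this needs. -/
theorem bracket_mul (hp₀ : p ≠ 0) (hp : ‖p‖ < 1) {s : Fin 8 → ℂ} (hs : ∀ j, s j ≠ 0)
    (hb : ∏ j, s j = p ^ 2) {z : ℂ} (hz : z ≠ 0) :
    bracket p s (p * z) = (p ^ 3 * z ^ 8)⁻¹ * bracket p s z := by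
  have h1 : ∏ j, theta (s j * (p * z)) p = (p ^ 2 * z ^ 8)⁻¹ * ∏ j, theta (s j * z) p := by
    simp only [theta_mul_mul hp₀ hp (hs _) hz]
    rw [Finset.prod_mul_distrib]
    congr 1
    rw [← hb]
    simp only [Fin.prod_univ_eight]
    have := hs 0; have := hs 1; have := hs 2; have := hs 3
    have := hs 4; have := hs 5; have := hs 6; have := hs 7
    field_simp
  have h2 : ∏ j, theta (s j * (p * z)⁻¹) p = (p ^ 6 * z ^ 8)⁻¹ * ∏ j, theta (s j * z⁻¹) p := by
    simp only [theta_mul_mul_inv hp₀ hp (hs _) hz]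
    rw [Finset.prod_mul_distrib]
    congr 1
    have : ∏ j, -(s j * z⁻¹ / p) = (∏ j, s j) * (z⁻¹ / p) ^ 8 := by
      simp only [Fin.prod_univ_eight]; ring
    rw [this, hb]
    field_simp
  rw [bracket, h1, h2, bracket]
  field_simp

theorem defect_mul (hp₀ : p ≠ 0) (hp : ‖p‖ < 1) {s : Fin 8 → ℂ} (hs : ∀ j, s j ≠ 0)
    (hb : ∏ j, s j = p ^ 2) {z : ℂ} (hz : z ≠ 0) :
    defect p s (p * z) = (p ^ 3)⁻¹ * z ^ (-8 : ℤ) * defect p s z := by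
  rw [defect, defect, bracket_mul hp₀ hp hs hb hz, combination_mul hp₀ hp hs hz,
    theta_sq_mul hp₀ hp hz, zpow_neg]
  norm_cast
  field_simp

/-- At z = `s 5` the factor θ(s₆/z) of the first product in `bracket` is θ(1) = 0, and only one term
of `combination` survives. What remains on the two sides coincides. -/
theorem defect_five (hp : ‖p‖ < 1) {s : Fin 8 → ℂ} (hs : ∀ j, s j ≠ 0) : defect p s (s 5) = 0 := by
  have h5 := hs 5
  rw [defect, bracket, prod_theta, prod_theta, combination, phi_self hp h5, phi, phi,
    mul_inv_cancel₀ h5, theta_one hp, ← div_eq_mul_inv, ← div_eq_mul_inv, pow_two]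
  field_simp
  ring

theorem defect_six (hp : ‖p‖ < 1) {s : Fin 8 → ℂ} (hs : ∀ j, s j ≠ 0) : defect p s (s 6) = 0 := by
  have h5 := hs 5
  have h6 := hs 6
  rw [defect, bracket, prod_theta, prod_theta, combination, phi_self hp h6, phi, phi,
    mul_inv_cancel₀ h6, theta_one hp, ← div_eq_mul_inv, ← div_eq_mul_inv, pow_two,
    theta_div_comm hp h5 h6]
  field_simp
  ring

theorem defect_seven (hp : ‖p‖ < 1) {s : Fin 8 → ℂ} (hs : ∀ j, s j ≠ 0) :
    defect p s (s 7) = 0 := by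
  have h5 := hs 5
  have h6 := hs 6
  have h7 := hs 7
  rw [defect, bracket, prod_theta, prod_theta, combination, phi_self hp h7, phi, phi,
    mul_inv_cancel₀ h7, theta_one hp, ← div_eq_mul_inv, ← div_eq_mul_inv, pow_two,
    theta_div_comm hp h5 h7, theta_div_comm hp h6 h7]
  field_simp
  ring

theorem defect_of_sq_eq_one (hp : ‖p‖ < 1) (s : Fin 8 → ℂ) {z : ℂ} (hz : z ^ 2 = 1) :
    defect p s z = 0 := by
  have hz0 : z ≠ 0 := by rintro rfl; norm_num at hz
  have h := defect_inv hp s hz0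
  have h1 : z⁻¹ = z := inv_eq_of_mul_eq_one_left (by rw [← sq, hz])
  rw [h1, hz, inv_one] at h
  linear_combination h / 2

theorem defect_of_sq_eq (hp₀ : p ≠ 0) (hp : ‖p‖ < 1) {s : Fin 8 → ℂ} (hs : ∀ j, s j ≠ 0)
    (hb : ∏ j, s j = p ^ 2) {z : ℂ} (hz : z ^ 2 = p) : defect p s z = 0 := by
  have hz0 : z ≠ 0 := by rintro rfl; exact hp₀ (by rw [← hz]; norm_num)
  have h := defect_mul hp₀ hp hs hb (inv_ne_zero hz0)
  have h1 : p * z⁻¹ = z := by rw [← hz]; field_simp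
  rw [h1, defect_inv hp s hz0, zpow_neg] at h
  norm_cast at h
  rw [← hz] at h
  field_simp at h
  rw [hz] at h
  -- For z² = p one has z = p z⁻¹, and the multipliers from `defect_mul` and `defect_inv` combine to
  -- -z⁶/p³ = -1.
  have h2 : 2 * defect p s z = 0 := by linear_combination h
  simpa using h2

theorem differentiableOn_defect (hp : ‖p‖ < 1) {s : Fin 8 → ℂ} (hs : ∀ j, s j ≠ 0) :
    DifferentiableOn ℂ (defect p s) {0}ᶜ := by
  intro z hz
  have hz0 : z ≠ 0 := hz
  unfold defect bracket combination phi
  simp only [Fin.prod_univ_eight]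
  apply DifferentiableAt.differentiableWithinAt
  fun_prop (disch := simp_all)

/-- Nine zeros against a multiplier of order z⁻⁸: the six points `s 5`, `s 6`, `s 7` and their
inverses, the points ±1, and one square root of p. -/
theorem defect_of_generic (hp₀ : p ≠ 0) (hp : ‖p‖ < 1) {s : Fin 8 → ℂ} (hs : ∀ j, s j ≠ 0)
    (hb : ∏ j, s j = p ^ 2) (h55 : theta (s 5 ^ 2) p ≠ 0) (h66 : theta (s 6 ^ 2) p ≠ 0)
    (h77 : theta (s 7 ^ 2) p ≠ 0) (h56 : phi p (s 5) (s 6) ≠ 0) (h57 : phi p (s 5) (s 7) ≠ 0)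
    (h67 : phi p (s 6) (s 7) ≠ 0) {z : ℂ} (hz : z ≠ 0) : defect p s z = 0 := by
  obtain ⟨r, hr⟩ := IsAlgClosed.exists_pow_nat_eq p two_pos
  have hr0 : r ≠ 0 := by rintro rfl; exact hp₀ (by rw [← hr]; norm_num)
  have hinv : ∀ z : ℂ, z ≠ 0 ∧ defect p s z = 0 → z⁻¹ ≠ 0 ∧ defect p s z⁻¹ = 0 :=
    fun z h => ⟨inv_ne_zero h.1, by rw [defect_inv hp s h.1, h.2, mul_zero]⟩
  have z5 := And.intro (hs 5) (defect_five hp hs)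
  have z6 := And.intro (hs 6) (defect_six hp hs)
  have z7 := And.intro (hs 7) (defect_seven hp hs)
  have e1 : (1 : ℂ) ^ 2 = p ^ (0 : ℤ) := by simp
  have e2 : (-1 : ℂ) ^ 2 = p ^ (0 : ℤ) := by simp
  have e3 : r ^ 2 = p ^ (1 : ℤ) := by simpa using hr
  refine eq_zero_of_quasiPeriodic hp₀ hp
    [s 5, (s 5)⁻¹, s 6, (s 6)⁻¹, s 7, (s 7)⁻¹, 1, -1, r] 8 (p ^ 3)⁻¹ (defect p s)
    (by simp) (differentiableOn_defect hp hs) (fun z hz => defect_mul hp₀ hp hs hb hz) ?_ ?_ z hz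
  · simp only [List.forall_mem_cons]
    exact ⟨z5, hinv _ z5, z6, hinv _ z6, z7, hinv _ z7,
      ⟨one_ne_zero, defect_of_sq_eq_one hp s (by norm_num)⟩,
      ⟨by norm_num, defect_of_sq_eq_one hp s (by norm_num)⟩,
      ⟨hr0, defect_of_sq_eq hp₀ hp hs hb hr⟩, by simp⟩
  · have hsq : ∀ a : ℂ, a ≠ 0 → theta (a ^ 2) p ≠ 0 → theta (a⁻¹ / a) p ≠ 0 := by
      intro a ha h
      have h3 : a⁻¹ / a = (a ^ 2)⁻¹ := by field_simp
      rw [h3]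
      exact (theta_inv_eq_zero_iff hp (pow_ne_zero 2 ha)).not.2 h
    have f1 : theta (-1 / 1) p ≠ 0 := by
      rw [Ne, theta_eq_zero_iff hp₀ hp (by norm_num)]
      rintro ⟨k, hk⟩
      have h1 := zpow_eq_of_sq_eq hp₀ hp (e := -1) (m := 0) (k := k) (by simp)
        (by rw [← hk]; norm_num)
      obtain rfl : k = 0 := by omega
      norm_num at hk
    have f2 : theta (r / 1) p ≠ 0 := by
      rw [Ne, theta_eq_zero_iff hp₀ hp (by simpa using hr0)]
      rintro ⟨k, hk⟩
      have h1 := zpow_eq_of_sq_eq hp₀ hp e3 (k := k) (by rw [← hk, div_one])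
      omega
    have f3 : theta (r / -1) p ≠ 0 := by
      rw [Ne, theta_eq_zero_iff hp₀ hp (by simpa using hr0)]
      rintro ⟨k, hk⟩
      have h1 := zpow_eq_of_sq_eq hp₀ hp (e := r / -1) (m := 1) (k := k)
        (by rw [← e3]; ring) hk
      omega
    obtain ⟨a1, a2, a3, a4⟩ := theta_ne_zero_of_phi hp (hs 5) (hs 6) h56
    obtain ⟨b1, b2, b3, b4⟩ := theta_ne_zero_of_phi hp (hs 5) (hs 7) h57
    obtain ⟨c1, c2, c3, c4⟩ := theta_ne_zero_of_phi hp (hs 6) (hs 7) h67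
    have g := fun (j : Fin 8) (h : theta (s j ^ 2) p ≠ 0) (e : ℂ) (m : ℤ) (he : e ^ 2 = p ^ m) =>
      theta_ne_zero_of_sq hp₀ hp (hs j) he h
    simp only [List.pairwise_cons, List.forall_mem_cons]
    have hnil : ∀ x : ℂ, ∀ b ∈ ([] : List ℂ), theta (b / x) p ≠ 0 := by simp
    exact ⟨⟨hsq _ (hs 5) h55, a1, a2, b1, b2, (g 5 h55 _ _ e1).1, (g 5 h55 _ _ e2).1,
        (g 5 h55 _ _ e3).1, hnil _⟩,
      ⟨a3, a4, b3, b4, (g 5 h55 _ _ e1).2, (g 5 h55 _ _ e2).2, (g 5 h55 _ _ e3).2, hnil _⟩,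
      ⟨hsq _ (hs 6) h66, c1, c2, (g 6 h66 _ _ e1).1, (g 6 h66 _ _ e2).1, (g 6 h66 _ _ e3).1,
        hnil _⟩,
      ⟨c3, c4, (g 6 h66 _ _ e1).2, (g 6 h66 _ _ e2).2, (g 6 h66 _ _ e3).2, hnil _⟩,
      ⟨hsq _ (hs 7) h77, (g 7 h77 _ _ e1).1, (g 7 h77 _ _ e2).1, (g 7 h77 _ _ e3).1, hnil _⟩,
      ⟨(g 7 h77 _ _ e1).2, (g 7 h77 _ _ e2).2, (g 7 h77 _ _ e3).2, hnil _⟩,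
      ⟨f1, f2, hnil _⟩, ⟨f3, hnil _⟩, hnil _, List.Pairwise.nil⟩

theorem defect_eq_zero (hp₀ : p ≠ 0) (hp : ‖p‖ < 1) {s : Fin 8 → ℂ} (hs : ∀ j, s j ≠ 0)
    (hb : ∏ j, s j = p ^ 2) {z : ℂ} (hz : z ≠ 0) : defect p s z = 0 := by
  -- The exponents sum to 0, which preserves ∏ s_j = p². Those at 5, 6, 7 have nonzero pairwise sums
  -- and differences, so the generic conditions fail only for countably many u.
  let e : Fin 8 → ℂ := ![-13, 0, 0, 0, 0, 1, 3, 9]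
  let S : ℂ → Fin 8 → ℂ := fun u j => s j * Complex.exp (e j * u)
  have hS : ∀ u j, S u j ≠ 0 := fun u j => mul_ne_zero (hs j) (Complex.exp_ne_zero _)
  have hSd : ∀ j, Differentiable ℂ fun u => S u j := fun j => by fun_prop
  have hSb : ∀ u, ∏ j, S u j = p ^ 2 := by
    intro u
    simp only [S]
    rw [Finset.prod_mul_distrib, hb, ← Complex.exp_sum, ← Finset.sum_mul]
    have : ∑ j, e j = 0 := by simp [e, Fin.sum_univ_eight]; norm_num
    rw [this, zero_mul, Complex.exp_zero, mul_one]
  let N : Fin 8 → Fin 8 → Set ℂ := fun i j =>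
    {u | ∃ k : ℤ, s i * s j * Complex.exp ((e i + e j) * u) = p ^ k}
  let M : Fin 8 → Fin 8 → Set ℂ := fun i j =>
    {u | ∃ k : ℤ, s i / s j * Complex.exp ((e i - e j) * u) = p ^ k}
  have hN : ∀ i j, e i + e j ≠ 0 → (N i j).Countable := fun i j h =>
    countable_zpow_exp p (mul_ne_zero (hs i) (hs j)) h
  have hM : ∀ i j, e i - e j ≠ 0 → (M i j).Countable := fun i j h =>
    countable_zpow_exp p (div_ne_zero (hs i) (hs j)) h
  have hN' : ∀ i j u, u ∉ N i j → theta (S u i * S u j) p ≠ 0 := by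
    intro i j u hu
    rw [Ne, theta_eq_zero_iff hp₀ hp (mul_ne_zero (hS u i) (hS u j))]
    rintro ⟨k, hk⟩
    refine hu ⟨k, ?_⟩
    rw [← hk, add_mul, Complex.exp_add]
    ring
  have hM' : ∀ i j u, u ∉ M i j → theta (S u i * (S u j)⁻¹) p ≠ 0 := by
    intro i j u hu
    rw [Ne, theta_eq_zero_iff hp₀ hp (mul_ne_zero (hS u i) (inv_ne_zero (hS u j)))]
    rintro ⟨k, hk⟩
    refine hu ⟨k, ?_⟩
    rw [← hk, sub_mul, Complex.exp_sub]
    simp only [S]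
    field_simp
  have key := eq_zero_of_countable (f := fun u => defect p (S u) z)
    (S := N 5 5 ∪ N 6 6 ∪ N 7 7 ∪ N 5 6 ∪ N 5 7 ∪ N 6 7 ∪ M 5 6 ∪ M 5 7 ∪ M 6 7) ?_ ?_ ?_ 0
  · simpa [S] using key
  · refine Differentiable.continuous (𝕜 := ℂ) fun u => ?_
    have hS' := hS u
    have h0 := hSd 0; have h1 := hSd 1; have h2 := hSd 2; have h3 := hSd 3
    have h4 := hSd 4; have h5 := hSd 5; have h6 := hSd 6; have h7 := hSd 7
    unfold defect bracket combination phi five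
    simp only [Fin.prod_univ_eight]
    clear_value S
    fun_prop (disch := simp_all)
  · simp only [Set.countable_union]
    refine ⟨⟨⟨⟨⟨⟨⟨⟨hN _ _ ?_, hN _ _ ?_⟩, hN _ _ ?_⟩, hN _ _ ?_⟩, hN _ _ ?_⟩, hN _ _ ?_⟩,
      hM _ _ ?_⟩, hM _ _ ?_⟩, hM _ _ ?_⟩ <;> simp [e] <;> norm_num
  · intro u hu
    simp only [Set.mem_union, not_or] at hu
    obtain ⟨⟨⟨⟨⟨⟨⟨⟨h1, h2⟩, h3⟩, h4⟩, h5⟩, h6⟩, h7⟩, h8⟩, h9⟩ := hu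
    refine defect_of_generic hp₀ hp (hS u) (hSb u) ?_ ?_ ?_ ?_ ?_ ?_ hz
    · rw [sq]; exact hN' _ _ u h1
    · rw [sq]; exact hN' _ _ u h2
    · rw [sq]; exact hN' _ _ u h3
    · exact mul_ne_zero (hN' _ _ u h4) (hM' _ _ u h7)
    · exact mul_ne_zero (hN' _ _ u h5) (hM' _ _ u h8)
    · exact mul_ne_zero (hN' _ _ u h6) (hM' _ _ u h9)

end EllipticHypergeometric

namespace EllipticHypergeometric
open Complex Filter Topology

variable {p q : ℂ}

/-! ### Integrals over circles -/

theorem circleIntegral_div (f : ℂ → ℂ) {R : ℝ} (hR : R ≠ 0) :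
    (∮ z in C(0, R), f z / z) = Complex.I * ∫ θ in (0 : ℝ)..2 * Real.pi, f (circleMap 0 R θ) := by
  rw [circleIntegral, ← intervalIntegral.integral_const_mul]
  congr 1
  funext θ
  have h : circleMap 0 R θ ≠ 0 := circleMap_ne_center hR
  rw [deriv_circleMap, smul_eq_mul]
  field_simp

theorem integral_circleMap_rotate (f : ℂ → ℂ) (q : ℂ) :
    (∫ θ in (0 : ℝ)..2 * Real.pi, f (q * circleMap 0 1 θ)) =
      ∫ θ in (0 : ℝ)..2 * Real.pi, f (circleMap 0 ‖q‖ θ) := by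
  have h : ∀ θ : ℝ, q * circleMap 0 1 θ = circleMap 0 ‖q‖ (θ + arg q) := by
    intro θ
    conv_lhs => rw [← Complex.norm_mul_exp_arg_mul_I q]
    rw [circleMap_zero, circleMap_zero, ofReal_add, add_mul, Complex.exp_add]
    push_cast
    ring
  simp only [h]
  rw [intervalIntegral.integral_comp_add_right (fun θ => f (circleMap 0 ‖q‖ θ)), zero_add, add_comm]
  have hper : Function.Periodic (fun θ => f (circleMap 0 ‖q‖ θ)) (2 * Real.pi) := fun θ => by
    simp only [periodic_circleMap 0 ‖q‖ θ]
  have := hper.intervalIntegral_add_eq (arg q) 0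
  rwa [zero_add] at this

theorem integral_circleMap_inv (f : ℂ → ℂ) :
    (∫ θ in (0 : ℝ)..2 * Real.pi, f (circleMap 0 1 θ)⁻¹) =
      ∫ θ in (0 : ℝ)..2 * Real.pi, f (circleMap 0 1 θ) := by
  have h : ∀ θ : ℝ, (circleMap 0 1 θ)⁻¹ = circleMap 0 1 (-θ) := by
    intro θ
    rw [circleMap_zero, circleMap_zero, ofReal_neg, neg_mul, Complex.exp_neg]
    simp
  simp only [h]
  rw [intervalIntegral.integral_comp_neg (fun θ => f (circleMap 0 1 θ)), neg_zero]
  have hper : Function.Periodic (fun θ => f (circleMap 0 1 θ)) (2 * Real.pi) := fun θ => by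
    simp only [periodic_circleMap 0 1 θ]
  have := hper.intervalIntegral_add_eq (-(2 * Real.pi)) 0
  rwa [zero_add, neg_add_cancel] at this

/-- The circle q𝕋 is a rotated circle of radius |q|; Cauchy's theorem for g(z) dz/z on the annulus
does the rest. -/
theorem integral_circleMap_shift (hq₀ : q ≠ 0) (hq : ‖q‖ < 1) {g : ℂ → ℂ}
    (hc : ContinuousOn g {z | ‖q‖ ≤ ‖z‖ ∧ ‖z‖ ≤ 1})
    (hd : DifferentiableOn ℂ g {z | ‖q‖ < ‖z‖ ∧ ‖z‖ < 1}) :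
    (∫ θ in (0 : ℝ)..2 * Real.pi, g (q * circleMap 0 1 θ)) =
      ∫ θ in (0 : ℝ)..2 * Real.pi, g (circleMap 0 1 θ) := by
  have hn : 0 < ‖q‖ := norm_pos_iff.2 hq₀
  have hopen : IsOpen {z : ℂ | ‖q‖ < ‖z‖ ∧ ‖z‖ < 1} :=
    (isOpen_lt continuous_const continuous_norm).inter (isOpen_lt continuous_norm continuous_const)
  have h := Complex.circleIntegral_sub_center_inv_smul_eq_of_differentiable_on_annulus_off_countable
    (c := 0) hn hq.le (f := g) Set.countable_empty
    (hc.mono fun z hz => by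
      simp only [Set.mem_sdiff, mem_closedBall_zero_iff, mem_ball_zero_iff, not_lt] at hz
      exact ⟨hz.2, hz.1⟩)
    (fun z hz => by
      simp only [Set.mem_sdiff, mem_closedBall_zero_iff, mem_ball_zero_iff, not_le] at hz
      exact hd.differentiableAt (hopen.mem_nhds ⟨hz.1.2, hz.1.1⟩))
  simp only [sub_zero, smul_eq_mul, inv_mul_eq_div] at h
  rw [circleIntegral_div g one_ne_zero, circleIntegral_div g hn.ne'] at h
  rw [integral_circleMap_rotate g q]
  exact (mul_left_cancel₀ Complex.I_ne_zero h).symm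

/-! ### The kernel on the unit circle -/

theorem weight_eq (hp : ‖p‖ < 1) (hq : ‖q‖ < 1) {z : ℂ} (hz : ‖z‖ = 1) :
    (ellGamma p q (z ^ 2) * ellGamma p q (z⁻¹ ^ 2))⁻¹ = theta (z ^ 2) p * theta (z⁻¹ ^ 2) q := by
  have h : ‖p * q‖ < 1 := by
    rw [norm_mul]; exact mul_lt_one_of_nonneg_of_lt_one_left (norm_nonneg _) hp hq.le
  rw [inv_pow, ellGamma_mul_ellGamma_inv hp hq] <;>
    exact poch₂_ne_zero_of_norm_lt hp hq (by simpa [hz, norm_mul] using h)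

/-- `∏ Γ(s_j z^±)`. -/
noncomputable def gammaProd (p q : ℂ) (s : Fin 8 → ℂ) (z : ℂ) : ℂ :=
  ∏ j, ellGamma p q (s j * z) * ellGamma p q (s j * z⁻¹)

theorem kernel_eq (hp : ‖p‖ < 1) (hq : ‖q‖ < 1) (s : Fin 8 → ℂ) {z : ℂ} (hz : ‖z‖ = 1) :
    kernel p q s z = gammaProd p q s z * (theta (z ^ 2) p * theta (z⁻¹ ^ 2) q) := by
  rw [kernel, div_eq_mul_inv, weight_eq hp hq hz, gammaProd]

/-- The function whose difference `g(z) - g(qz)` is the integrand of the contiguous relation. -/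
noncomputable def primitive (p q : ℂ) (s : Fin 8 → ℂ) (z : ℂ) : ℂ :=
  (∏ j, ellGamma p q (s j * z) * ellGamma p q (q * s j * z⁻¹)) * theta (z⁻¹ ^ 2) q * z ^ 3

theorem primitive_sub (hp : ‖p‖ < 1) (hq₀ : q ≠ 0) (hq : ‖q‖ < 1) {s : Fin 8 → ℂ}
    (hs : ∀ j, ‖s j‖ < 1) {z : ℂ} (hz : ‖z‖ = 1) :
    primitive p q s z - primitive p q s (q * z) =
      gammaProd p q s z * theta (z⁻¹ ^ 2) q * bracket p s z := by
  have hz0 : z ≠ 0 := norm_pos_iff.1 (by rw [hz]; exact one_pos)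
  have h1 : ∀ j, ellGamma p q (q * s j * z⁻¹) =
      theta (s j * z⁻¹) p * ellGamma p q (s j * z⁻¹) := fun j => by
    rw [mul_assoc, ellGamma_mul hp hq₀ hq (poch₂_ne_zero_of_norm_lt hp hq (by simp [hz, hs j]))]
  have h2 : ∀ j, ellGamma p q (s j * (q * z)) = theta (s j * z) p * ellGamma p q (s j * z) :=
    fun j => by
    rw [mul_left_comm, ellGamma_mul hp hq₀ hq (poch₂_ne_zero_of_norm_lt hp hq (by simp [hz, hs j]))]
  have h3 : ∀ j, q * s j * (q * z)⁻¹ = s j * z⁻¹ := fun j => by field_simp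
  -- Two shifts by q give (q³z⁴)⁻¹; multiplied by (qz)³ this leaves the z⁻¹ in the second term of
  -- `bracket`.
  have h4 : theta ((q * z)⁻¹ ^ 2) q = (q ^ 3 * z ^ 4)⁻¹ * theta (z⁻¹ ^ 2) q := by
    have e : (q * z)⁻¹ ^ 2 = z⁻¹ ^ 2 / q / q := by field_simp
    have hz2 : z⁻¹ ^ 2 ≠ 0 := pow_ne_zero 2 (inv_ne_zero hz0)
    rw [e, theta_div_left hq₀ hq (div_ne_zero hz2 hq₀), theta_div_left hq₀ hq hz2]
    field_simp
  simp only [primitive, h1, h2, h3, h4, gammaProd, bracket, Finset.prod_mul_distrib]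
  generalize (∏ j, ellGamma p q (s j * z)) = A
  generalize (∏ j, ellGamma p q (s j * z⁻¹)) = B
  generalize (∏ j, theta (s j * z) p) = C
  generalize (∏ j, theta (s j * z⁻¹) p) = D
  generalize theta (z⁻¹ ^ 2) q = E
  field_simp

/-- The arguments s_j z and q s_j/z stay in the open unit disc on |q| ≤ |z| ≤ 1, so no gamma factor
has a pole there. -/
theorem differentiableAt_primitive (hp : ‖p‖ < 1) (hq₀ : q ≠ 0) (hq : ‖q‖ < 1) {s : Fin 8 → ℂ}
    (hs₀ : ∀ j, s j ≠ 0) (hs : ∀ j, ‖s j‖ < 1) {z : ℂ} (hz : ‖q‖ ≤ ‖z‖) (hz1 : ‖z‖ ≤ 1) :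
    DifferentiableAt ℂ (primitive p q s) z := by
  have hz' : 0 < ‖z‖ := (norm_pos_iff.2 hq₀).trans_le hz
  have hz0 : z ≠ 0 := norm_pos_iff.1 hz'
  have h1 : ∀ j, DifferentiableAt ℂ (fun z => ellGamma p q (s j * z)) z := fun j => by
    refine DifferentiableAt.comp z (g := ellGamma p q) (differentiableAt_ellGamma hp hq
      (mul_ne_zero (hs₀ j) hz0) (poch₂_ne_zero_of_norm_lt hp hq ?_))
      (differentiableAt_id.const_mul _)
    rw [norm_mul]
    exact mul_lt_one_of_nonneg_of_lt_one_left (norm_nonneg _) (hs j) hz1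
  have h2 : ∀ j, DifferentiableAt ℂ (fun z => ellGamma p q (q * s j * z⁻¹)) z := fun j => by
    refine DifferentiableAt.comp z (g := ellGamma p q) (differentiableAt_ellGamma hp hq
      (mul_ne_zero (mul_ne_zero hq₀ (hs₀ j)) (inv_ne_zero hz0))
      (poch₂_ne_zero_of_norm_lt hp hq ?_)) ((differentiableAt_inv hz0).const_mul _)
    rw [norm_mul, norm_mul, norm_inv, ← div_eq_mul_inv, div_lt_one hz']
    nlinarith [norm_nonneg q, hs j, norm_pos_iff.2 hq₀]
  have h3 : DifferentiableAt ℂ (fun z => theta (z⁻¹ ^ 2) q) z :=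
    DifferentiableAt.comp z (g := fun z => theta z q) (differentiableAt_theta hq
      (pow_ne_zero 2 (inv_ne_zero hz0))) ((differentiableAt_inv hz0).pow 2)
  unfold primitive
  refine (DifferentiableAt.mul ?_ h3).mul (differentiableAt_id.pow 3)
  exact DifferentiableAt.fun_finsetProd fun j _ => (h1 j).mul (h2 j)

/-- The contiguous relation, at the level of integrals. -/
theorem integral_kernel_mul_combination (hp₀ : p ≠ 0) (hp : ‖p‖ < 1) (hq₀ : q ≠ 0)
    (hq : ‖q‖ < 1) {s : Fin 8 → ℂ} (hs₀ : ∀ j, s j ≠ 0) (hs : ∀ j, ‖s j‖ < 1)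
    (hb : ∏ j, s j = p ^ 2) :
    (∮ z in C(0, 1), kernel p q s z * combination p s z / z) = 0 := by
  have hshift := integral_circleMap_shift hq₀ hq (g := primitive p q s)
    (fun z hz => (differentiableAt_primitive hp hq₀ hq hs₀ hs hz.1
      hz.2).continuousAt.continuousWithinAt)
    (fun z hz => (differentiableAt_primitive hp hq₀ hq hs₀ hs hz.1.le
      hz.2.le).differentiableWithinAt)
  have hn : ∀ θ : ℝ, ‖circleMap 0 1 θ‖ = 1 := fun θ => by simp
  set C := s 5 * (theta (s 6 / s 5) p * theta (s 7 / s 5) p * theta (s 7 / s 6) p) with hC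
  -- On the circle the kernel contains the factor θ(z²; p), and θ(z²; p) times `combination` is C
  -- times `bracket` by the partial fraction identity.
  have hpt : ∀ z : ℂ, ‖z‖ = 1 → kernel p q s z * combination p s z =
      C * (primitive p q s z - primitive p q s (q * z)) := by
    intro z hz
    have hz0 : z ≠ 0 := norm_pos_iff.1 (by rw [hz]; exact one_pos)
    have h := defect_eq_zero hp₀ hp hs₀ hb hz0
    rw [defect] at h
    rw [kernel_eq hp hq s hz, primitive_sub hp hq₀ hq hs hz]
    linear_combination (-gammaProd p q s z * theta (z⁻¹ ^ 2) q) * h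
  have hcont : ∀ c : ℂ, (∀ θ : ℝ, ‖q‖ ≤ ‖c * circleMap 0 1 θ‖ ∧ ‖c * circleMap 0 1 θ‖ ≤ 1) →
      Continuous fun θ => primitive p q s (c * circleMap 0 1 θ) := by
    intro c hc
    refine continuous_iff_continuousAt.2 fun θ => ?_
    exact ContinuousAt.comp (g := primitive p q s)
      (differentiableAt_primitive hp hq₀ hq hs₀ hs (hc θ).1 (hc θ).2).continuousAt
      ((continuous_const.mul (continuous_circleMap 0 1)).continuousAt)
  have hc1 := hcont 1 fun θ => by simp [hq.le]
  have hc2 := hcont q fun θ => by simp [hq.le]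
  simp only [one_mul] at hc1
  rw [circleIntegral_div _ one_ne_zero]
  simp only [hpt _ (hn _)]
  rw [intervalIntegral.integral_const_mul,
    intervalIntegral.integral_sub (hc1.intervalIntegrable _ _) (hc2.intervalIntegrable _ _),
    hshift, sub_self, mul_zero, mul_zero]

end EllipticHypergeometric

namespace EllipticHypergeometric
open Complex Filter Topology

variable {p q : ℂ}

/-! ### Shifts of parameters in the kernel -/

theorem kernel_shift (hp : ‖p‖ < 1) (hq₀ : q ≠ 0) (hq : ‖q‖ < 1) {s s' : Fin 8 → ℂ} (i : Fin 8)
    (hi : s' i = q * s i) (hj : ∀ j, j ≠ i → s' j = s j) (hs : ‖s i‖ < 1) {z : ℂ} (hz : ‖z‖ = 1) :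
    kernel p q s' z = phi p (s i) z * kernel p q s z := by
  have h1 : ellGamma p q (s' i * z) = theta (s i * z) p * ellGamma p q (s i * z) := by
    rw [hi, mul_assoc, ellGamma_mul hp hq₀ hq (poch₂_ne_zero_of_norm_lt hp hq (by simp [hz, hs]))]
  have h2 : ellGamma p q (s' i * z⁻¹) = theta (s i * z⁻¹) p * ellGamma p q (s i * z⁻¹) := by
    rw [hi, mul_assoc, ellGamma_mul hp hq₀ hq (poch₂_ne_zero_of_norm_lt hp hq (by simp [hz, hs]))]
  rw [kernel, kernel, ← Finset.mul_prod_erase _ _ (Finset.mem_univ i),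
    ← Finset.mul_prod_erase _ _ (Finset.mem_univ i), h1, h2, phi,
    Finset.prod_congr rfl fun j hj' => by rw [hj j (Finset.ne_of_mem_erase hj')]]
  ring

theorem continuousAt_kernel (hp : ‖p‖ < 1) (hq : ‖q‖ < 1) {s : Fin 8 → ℂ}
    (hs₀ : ∀ j, s j ≠ 0) (hs : ∀ j, ‖s j‖ < 1) {z : ℂ} (hz : ‖z‖ = 1) :
    ContinuousWithinAt (kernel p q s) (Metric.sphere 0 1) z := by
  have hz0 : z ≠ 0 := norm_pos_iff.1 (by rw [hz]; exact one_pos)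
  have h1 : ∀ j, ContinuousAt (fun z => ellGamma p q (s j * z)) z := fun j =>
    ContinuousAt.comp (g := ellGamma p q) (differentiableAt_ellGamma hp hq
      (mul_ne_zero (hs₀ j) hz0) (poch₂_ne_zero_of_norm_lt hp hq (by simp [hz, hs]))).continuousAt
      (continuousAt_id.const_mul _)
  have h2 : ∀ j, ContinuousAt (fun z => ellGamma p q (s j * z⁻¹)) z := fun j =>
    ContinuousAt.comp (g := ellGamma p q) (differentiableAt_ellGamma hp hq
      (mul_ne_zero (hs₀ j) (inv_ne_zero hz0))
      (poch₂_ne_zero_of_norm_lt hp hq (by simp [hz, hs]))).continuousAt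
      ((continuousAt_inv₀ hz0).const_mul _)
  have h3 : DifferentiableAt ℂ (fun z => theta (z ^ 2) p * theta (z⁻¹ ^ 2) q) z := by
    fun_prop (disch := simp_all)
  have h4 : ContinuousAt (fun z => gammaProd p q s z * (theta (z ^ 2) p * theta (z⁻¹ ^ 2) q)) z := by
    refine ContinuousAt.mul ?_ h3.continuousAt
    unfold gammaProd
    exact tendsto_finsetProd _ fun j _ => (h1 j).mul (h2 j)
  refine h4.continuousWithinAt.congr (fun y hy => ?_) (kernel_eq hp hq s hz)
  exact kernel_eq hp hq s (by simpa using hy)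

theorem circleIntegrable_kernel (hp : ‖p‖ < 1) (hq : ‖q‖ < 1) {s : Fin 8 → ℂ}
    (hs₀ : ∀ j, s j ≠ 0) (hs : ∀ j, ‖s j‖ < 1) :
    CircleIntegrable (fun z => kernel p q s z / z) 0 1 := by
  refine ContinuousOn.circleIntegrable zero_le_one fun z hz => ?_
  have hz1 : ‖z‖ = 1 := by simpa using hz
  have hz0 : z ≠ 0 := norm_pos_iff.1 (by rw [hz1]; exact one_pos)
  exact (continuousAt_kernel hp hq hs₀ hs hz1).div continuousWithinAt_id hz0

theorem vIntegral_linear (hp : ‖p‖ < 1) (hq : ‖q‖ < 1) {s t u : Fin 8 → ℂ}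
    (hs₀ : ∀ j, s j ≠ 0) (hs : ∀ j, ‖s j‖ < 1) (ht₀ : ∀ j, t j ≠ 0) (ht : ∀ j, ‖t j‖ < 1)
    (hu₀ : ∀ j, u j ≠ 0) (hu : ∀ j, ‖u j‖ < 1) {α β γ : ℂ} {f : ℂ → ℂ}
    (hf : (∮ z in C(0, 1), f z / z) = 0)
    (h : ∀ z, ‖z‖ = 1 → α * kernel p q s z + β * kernel p q t z + γ * kernel p q u z = f z) :
    α * vIntegral p q s + β * vIntegral p q t + γ * vIntegral p q u = 0 := by
  have h1 : CircleIntegrable (fun z => α • (kernel p q s z / z)) 0 1 :=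
    (circleIntegrable_kernel hp hq hs₀ hs).const_smul
  have h2 : CircleIntegrable (fun z => β • (kernel p q t z / z)) 0 1 :=
    (circleIntegrable_kernel hp hq ht₀ ht).const_smul
  have h3 : CircleIntegrable (fun z => γ • (kernel p q u z / z)) 0 1 :=
    (circleIntegrable_kernel hp hq hu₀ hu).const_smul
  have key : α • (∮ z in C(0, 1), kernel p q s z / z) + β • (∮ z in C(0, 1), kernel p q t z / z)
      + γ • (∮ z in C(0, 1), kernel p q u z / z) = 0 := by
    rw [← circleIntegral.integral_smul, ← circleIntegral.integral_smul,
      ← circleIntegral.integral_smul, ← circleIntegral.integral_add h1 h2,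
      ← circleIntegral.integral_add
        (f := fun z => α • (kernel p q s z / z) + β • (kernel p q t z / z)) (h1.add h2) h3]
    refine Eq.trans ?_ hf
    refine circleIntegral.integral_congr zero_le_one fun z hz => ?_
    simp only [← h z (mem_sphere_zero_iff_norm.1 hz), smul_eq_mul]
    ring
  simp only [smul_eq_mul] at key
  simp only [vIntegral]
  linear_combination kappa p q * key

/-- `s'` is obtained from `s` by multiplying the `i`-th entry by `q`. -/
def IsShift (q : ℂ) (i : Fin 8) (s s' : Fin 8 → ℂ) : Prop :=
  s' i = q * s i ∧ ∀ j, j ≠ i → s' j = s j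

theorem IsShift.ne_zero {i : Fin 8} {s s' : Fin 8 → ℂ} (h : IsShift q i s s') (hq₀ : q ≠ 0)
    (hs : ∀ j, s j ≠ 0) (j : Fin 8) : s' j ≠ 0 := by
  by_cases hj : j = i
  · rw [hj, h.1]; exact mul_ne_zero hq₀ (hs i)
  · rw [h.2 j hj]; exact hs j

theorem IsShift.norm_lt {i : Fin 8} {s s' : Fin 8 → ℂ} (h : IsShift q i s s') (hq : ‖q‖ < 1)
    (hs : ∀ j, ‖s j‖ < 1) (j : Fin 8) : ‖s' j‖ < 1 := by
  by_cases hj : j = i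
  · rw [hj, h.1, norm_mul]
    exact mul_lt_one_of_nonneg_of_lt_one_left (norm_nonneg _) hq (hs i).le
  · rw [h.2 j hj]; exact hs j

/-- The contiguous relation that follows from the addition formula. -/
theorem vIntegral_addition (hp₀ : p ≠ 0) (hp : ‖p‖ < 1) (hq₀ : q ≠ 0) (hq : ‖q‖ < 1)
    {s t u v : Fin 8 → ℂ} (hs₀ : ∀ j, s j ≠ 0) (hs : ∀ j, ‖s j‖ < 1) {i j k : Fin 8}
    (ht : IsShift q i s t) (hu : IsShift q j s u) (hv : IsShift q k s v) :
    phi p (s j) (s k) * vIntegral p q t - phi p (s i) (s k) * vIntegral p q u =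
      -(s j / s k) * phi p (s i) (s j) * vIntegral p q v := by
  have := vIntegral_linear hp hq (ht.ne_zero hq₀ hs₀) (ht.norm_lt hq hs) (hu.ne_zero hq₀ hs₀)
    (hu.norm_lt hq hs) (hv.ne_zero hq₀ hs₀) (hv.norm_lt hq hs) (α := phi p (s j) (s k))
    (β := -phi p (s i) (s k)) (γ := (s j / s k) * phi p (s i) (s j)) (f := fun _ => 0)
    (by simp [circleIntegral]) (fun z hz => by
      have hz0 : z ≠ 0 := norm_pos_iff.1 (by rw [hz]; exact one_pos)
      rw [kernel_shift hp hq₀ hq i ht.1 ht.2 (hs i) hz, kernel_shift hp hq₀ hq j hu.1 hu.2 (hs j) hz,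
        kernel_shift hp hq₀ hq k hv.1 hv.2 (hs k) hz]
      linear_combination kernel p q s z * addition_formula hp₀ hp (hs₀ i) (hs₀ j) (hs₀ k) hz0)
  linear_combination this

/-- The contiguous relation that follows from the partial fraction expansion. -/
theorem vIntegral_combination (hp₀ : p ≠ 0) (hp : ‖p‖ < 1) (hq₀ : q ≠ 0) (hq : ‖q‖ < 1)
    {s u v t₁ t₂ t₃ : Fin 8 → ℂ} (hs₀ : ∀ j, s j ≠ 0) (hs : ∀ j, ‖s j‖ < 1)
    (hb : ∏ j, s j = p ^ 2) (hu : IsShift q 6 s u) (hv : IsShift q 5 s v)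
    (h₁ : IsShift q 7 u t₁) (h₂ : IsShift q 7 v t₂) (h₃ : IsShift q 6 v t₃) :
    -theta (s 7 / s 6) p * five p s (s 5) * vIntegral p q t₁
      + theta (s 7 / s 5) p * five p s (s 6) * vIntegral p q t₂
      + -(s 7 / s 6 * theta (s 6 / s 5) p * five p s (s 7)) * vIntegral p q t₃ = 0 := by
  have hu₀ := hu.ne_zero hq₀ hs₀
  have hv₀ := hv.ne_zero hq₀ hs₀
  have hu' := hu.norm_lt hq hs
  have hv' := hv.norm_lt hq hs
  refine vIntegral_linear hp hq (h₁.ne_zero hq₀ hu₀) (h₁.norm_lt hq hu') (h₂.ne_zero hq₀ hv₀)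
    (h₂.norm_lt hq hv') (h₃.ne_zero hq₀ hv₀) (h₃.norm_lt hq hv')
    (integral_kernel_mul_combination hp₀ hp hq₀ hq hs₀ hs hb) (fun z hz => ?_)
  rw [kernel_shift hp hq₀ hq 7 h₁.1 h₁.2 (hu' 7) hz, kernel_shift hp hq₀ hq 7 h₂.1 h₂.2 (hv' 7) hz,
    kernel_shift hp hq₀ hq 6 h₃.1 h₃.2 (hv' 6) hz, kernel_shift hp hq₀ hq 6 hu.1 hu.2 (hs 6) hz,
    kernel_shift hp hq₀ hq 5 hv.1 hv.2 (hs 5) hz, hu.2 7 (by decide), hv.2 7 (by decide),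
    hv.2 6 (by decide), combination]
  ring

/-! ### Shifts of parameters in `U` -/

/-- The vector `(t₁, …, t₆, q⁻¹t₇, qt₈)`. -/
noncomputable def shiftUp (q : ℂ) (t : Fin 8 → ℂ) : Fin 8 → ℂ :=
  ![t 0, t 1, t 2, t 3, t 4, t 5, q⁻¹ * t 6, q * t 7]

/-- The vector `(t₁, …, t₆, qt₇, q⁻¹t₈)`. -/
noncomputable def shiftDown (q : ℂ) (t : Fin 8 → ℂ) : Fin 8 → ℂ :=
  ![t 0, t 1, t 2, t 3, t 4, t 5, q * t 6, q⁻¹ * t 7]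

/-- The vector `(t₁, …, t₄, q⁻¹t₅, qt₆, t₇, t₈)`. -/
noncomputable def shiftMid (q : ℂ) (t : Fin 8 → ℂ) : Fin 8 → ℂ :=
  ![t 0, t 1, t 2, t 3, q⁻¹ * t 4, q * t 5, t 6, t 7]

/-- `1 / Γ(t₇t₆^±, t₈t₆^±)`. -/
noncomputable def normU (p q : ℂ) (t : Fin 8 → ℂ) : ℂ :=
  (ellGamma p q (t 6 * t 5))⁻¹ * (ellGamma p q (t 6 / t 5))⁻¹ *
    (ellGamma p q (t 7 * t 5))⁻¹ * (ellGamma p q (t 7 / t 5))⁻¹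

/-- The denominator of `1 / Γ(t₇t₆^±, t₈t₆^±)`. -/
noncomputable def normDen (p q : ℂ) (t : Fin 8 → ℂ) : ℂ :=
  poch₂ (p * q / (t 6 * t 5)) p q * poch₂ (p * q / (t 6 / t 5)) p q *
    poch₂ (p * q / (t 7 * t 5)) p q * poch₂ (p * q / (t 7 / t 5)) p q

theorem U_eq (p q : ℂ) (t : Fin 8 → ℂ) : U p q t = V p q t * normU p q t := by
  rw [U, normU, div_eq_mul_inv, mul_inv, mul_inv, mul_inv]

theorem ellGamma_inv_div (hp : ‖p‖ < 1) (hq₀ : q ≠ 0) (hq : ‖q‖ < 1) {z : ℂ}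
    (h : poch₂ (p * q / z) p q ≠ 0) :
    (ellGamma p q (q⁻¹ * z))⁻¹ = theta (q⁻¹ * z) p * (ellGamma p q z)⁻¹ := by
  have h1 : p / (q⁻¹ * z) = p * q / z := by
    rw [inv_mul_eq_div, div_div_eq_mul_div]
  have := ellGamma_inv_eq hp hq₀ hq (z := q⁻¹ * z) (by rwa [h1])
  rwa [mul_inv_cancel_left₀ hq₀] at this

theorem ellGamma_inv_mul (hp : ‖p‖ < 1) (hq₀ : q ≠ 0) (hq : ‖q‖ < 1) {z : ℂ}
    (h : poch₂ (p * q / (q * z)) p q ≠ 0) :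
    theta z p * (ellGamma p q (q * z))⁻¹ = (ellGamma p q z)⁻¹ := by
  have h1 : p * q / (q * z) = p / z := by rw [mul_comm p q, mul_div_mul_left _ _ hq₀]
  rw [h1] at h
  rw [ellGamma_inv_eq hp hq₀ hq h]

theorem phi_eq (p a z : ℂ) : phi p a z = theta (a * z) p * theta (a / z) p := by
  rw [phi, div_eq_mul_inv]

theorem phi_mul_left_eq (p b a z : ℂ) :
    phi p (b * a) z = theta (b * (a * z)) p * theta (b * (a / z)) p := by
  rw [phi, div_eq_mul_inv, mul_assoc, mul_assoc]

/-- The two theta products are the coefficients of V(t) and of V(q⁻¹t₇, qt₈) in the addition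
relation. Hence θ(t₈t₆^±)(TU - U) is a common factor times the left-hand side of that relation. -/
theorem normU_shiftUp (hp : ‖p‖ < 1) (hq₀ : q ≠ 0) (hq : ‖q‖ < 1) {t : Fin 8 → ℂ}
    (h : normDen p q t ≠ 0) (h' : normDen p q (shiftUp q t) ≠ 0) :
    phi p (t 7) (t 5) * normU p q (shiftUp q t) =
      phi p (q⁻¹ * t 6) (t 5) * normU p q t := by
  have e5 : shiftUp q t 5 = t 5 := rfl
  have e6 : shiftUp q t 6 = q⁻¹ * t 6 := rfl
  have e7 : shiftUp q t 7 = q * t 7 := rfl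
  rw [normDen] at h
  rw [normDen, e5, e6, e7, mul_assoc q, mul_div_assoc q] at h'
  rw [normU, normU, e5, e6, e7, mul_assoc q, mul_div_assoc q, mul_assoc q⁻¹, mul_div_assoc q⁻¹,
    phi_eq, phi_mul_left_eq]
  rw [ellGamma_inv_div hp hq₀ hq (left_ne_zero_of_mul (left_ne_zero_of_mul
      (left_ne_zero_of_mul h))),
    ellGamma_inv_div hp hq₀ hq (right_ne_zero_of_mul (left_ne_zero_of_mul
      (left_ne_zero_of_mul h))),
    ← ellGamma_inv_mul hp hq₀ hq (right_ne_zero_of_mul (left_ne_zero_of_mul h')),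
    ← ellGamma_inv_mul hp hq₀ hq (right_ne_zero_of_mul h')]
  ring

theorem normU_shiftMid (hp : ‖p‖ < 1) (hq₀ : q ≠ 0) (hq : ‖q‖ < 1) {t : Fin 8 → ℂ}
    (h : normDen p q t ≠ 0) (h' : normDen p q (shiftMid q t) ≠ 0) :
    theta (t 6 * t 5) p * theta (t 7 * t 5) p * normU p q (shiftMid q t) =
      theta (q⁻¹ * (t 6 / t 5)) p * theta (q⁻¹ * (t 7 / t 5)) p * normU p q t := by
  have e5 : shiftMid q t 5 = q * t 5 := rfl
  have e6 : shiftMid q t 6 = t 6 := rfl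
  have e7 : shiftMid q t 7 = t 7 := rfl
  have e : ∀ x y : ℂ, x / (q * y) = q⁻¹ * (x / y) := fun x y => by field_simp
  rw [normDen] at h
  rw [normDen, e5, e6, e7, mul_left_comm _ q, mul_left_comm _ q] at h'
  rw [normU, normU, e5, e6, e7, e (t 6) (t 5), e (t 7) (t 5), mul_left_comm _ q,
    mul_left_comm _ q]
  rw [ellGamma_inv_div hp hq₀ hq (right_ne_zero_of_mul (left_ne_zero_of_mul
      (left_ne_zero_of_mul h))),
    ellGamma_inv_div hp hq₀ hq (right_ne_zero_of_mul h),
    ← ellGamma_inv_mul hp hq₀ hq (left_ne_zero_of_mul (left_ne_zero_of_mul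
      (left_ne_zero_of_mul h'))),
    ← ellGamma_inv_mul hp hq₀ hq (right_ne_zero_of_mul (left_ne_zero_of_mul h'))]
  ring

end EllipticHypergeometric

namespace EllipticHypergeometric
open Complex Filter Topology

variable {p q : ℂ}

/-! ### The equation and the contiguous relation for parameters in the unit disc -/

theorem forall_vec {α : Type*} {P : α → Prop} {a b c d e f g h : α} (ha : P a) (hb : P b)
    (hc : P c) (hd : P d) (he : P e) (hf : P f) (hg : P g) (hh : P h) (j : Fin 8) :
    P (![a, b, c, d, e, f, g, h] j) := by
  fin_cases j <;> assumption

/-- The operator with coefficients given by the parameters `w`, applied to `U` at `t`. -/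
noncomputable def opU (p q : ℂ) (w t : Fin 8 → ℂ) : ℂ :=
  coeffA p q w * (U p q (shiftUp q t) - U p q t) +
    coeffA p q (swap78 w) * (U p q (shiftDown q t) - U p q t) + coeffK p q w * U p q t

theorem V_of_norm_lt {t : Fin 8 → ℂ} (ht : ∀ j, ‖t j‖ < 1) : V p q t = vIntegral p q t :=
  if_pos ht

/-- Isolates the factor θ(t₈t₆^±; p), which is what turns TU - U into the left-hand side of the
addition relation. -/
theorem coeffA_eq (hp : ‖p‖ < 1) {w : Fin 8 → ℂ} (hw : ∀ j, w j ≠ 0) :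
    coeffA p q w = -(w 5 / w 7) * theta (q⁻¹ * w 7 / w 5) p * five p w (q⁻¹ * w 6) /
      (theta (w 7 / w 6) p * theta (w 6 / (q * w 7)) p) * phi p (w 7) (w 5) := by
  have h1 : ∀ k, w 6 * w k / q = w k * (q⁻¹ * w 6) := fun k => by ring
  have h2 : w 7 / (q * w 5) = q⁻¹ * w 7 / w 5 := by ring
  simp only [coeffA, thetas, List.map_cons, List.map_nil, List.prod_cons, List.prod_nil, mul_one,
    h1, h2, five, phi_eq, theta_div_comm hp (hw 5) (hw 7), mul_comm (w 7) (w 5)]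
  ring

theorem phi_quot (hp : ‖p‖ < 1) (hq₀ : q ≠ 0) {b c : ℂ} (hb : b ≠ 0) (hc : c ≠ 0) :
    phi p c (q⁻¹ * b) = -(q * c / b) * theta (q⁻¹ * (b * c)) p * theta (b / (q * c)) p := by
  have h1 : c / (q⁻¹ * b) = (b / (q * c))⁻¹ := by field_simp
  have h2 : c * (q⁻¹ * b) = q⁻¹ * (b * c) := by ring
  rw [phi_eq, h1, theta_inv hp (div_ne_zero hb (mul_ne_zero hq₀ hc)), h2, inv_div]
  ring

/-- The term of `𝒟` with the shift `T`. -/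
theorem coeffA_mul_sub (hp₀ : p ≠ 0) (hp : ‖p‖ < 1) (hq₀ : q ≠ 0) (hq : ‖q‖ < 1)
    {w t v : Fin 8 → ℂ} (ht₀ : ∀ j, t j ≠ 0) (ht : ∀ j, ‖t j‖ < 1)
    (hu : ∀ j, ‖shiftUp q t j‖ < 1) (hn : normDen p q t ≠ 0)
    (hn' : normDen p q (shiftUp q t) ≠ 0) (hw : ∀ j, w j ≠ 0) (h5 : w 5 = t 5) (h6 : w 6 = t 6)
    (h7 : w 7 = t 7) (hv : v = ![t 0, t 1, t 2, t 3, t 4, q * t 5, q⁻¹ * t 6, t 7])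
    (hθ : theta (t 6 / (q * t 7)) p ≠ 0) :
    coeffA p q w * (U p q (shiftUp q t) - U p q t) =
      -(theta (q⁻¹ * t 7 / t 5) p * five p w (q⁻¹ * t 6) * theta (q⁻¹ * (t 6 * t 7)) p /
        theta (t 7 / t 6) p) * normU p q t * vIntegral p q v := by
  -- The base vector has q⁻¹t₇ in place of t₇. Raising its eighth, seventh or sixth entry by q gives
  -- the shifted vector, t itself, and v.
  have key := vIntegral_addition hp₀ hp hq₀ hq
    (s := ![t 0, t 1, t 2, t 3, t 4, t 5, q⁻¹ * t 6, t 7]) (t := shiftUp q t) (u := t) (v := v)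
    (i := 7) (j := 6) (k := 5)
    (forall_vec (P := fun x : ℂ => x ≠ 0) (ht₀ 0) (ht₀ 1) (ht₀ 2) (ht₀ 3) (ht₀ 4) (ht₀ 5)
      (mul_ne_zero (inv_ne_zero hq₀) (ht₀ 6)) (ht₀ 7))
    (forall_vec (P := fun x : ℂ => ‖x‖ < 1) (ht 0) (ht 1) (ht 2) (ht 3) (ht 4) (ht 5) (hu 6) (ht 7))
    ⟨by simp [shiftUp], fun j hj => by fin_cases j <;> simp [shiftUp] at hj ⊢⟩
    ⟨by simp [hq₀], fun j hj => by fin_cases j <;> simp at hj ⊢⟩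
    ⟨by simp [hv], fun j hj => by fin_cases j <;> simp [hv] at hj ⊢⟩
  simp only [Matrix.cons_val] at key
  rw [phi_quot hp hq₀ (ht₀ 6) (ht₀ 7)] at key
  have hN := normU_shiftUp hp hq₀ hq hn hn'
  rw [coeffA_eq hp hw, U_eq, U_eq, V_of_norm_lt ht, V_of_norm_lt hu, h5, h6, h7]
  have e : ∀ X A B Y Z : ℂ, X * phi p (t 7) (t 5) * (A * normU p q (shiftUp q t) - B * Y) =
      X * (A * (phi p (t 7) (t 5) * normU p q (shiftUp q t)) - B * (phi p (t 7) (t 5) * Y)) :=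
    fun X A B Y Z => by ring
  rw [e _ _ _ _ 0, hN]
  have h5' := ht₀ 5; have h6' := ht₀ 6; have h7' := ht₀ 7
  have e2 : ∀ X A B N P Q : ℂ, X * (A * (P * N) - B * (Q * N)) = X * N * (P * A - Q * B) :=
    fun X A B N P Q => by ring
  rw [e2, key]
  generalize theta (t 7 / t 6) p = A
  generalize theta (t 6 / (q * t 7)) p = B at *
  generalize theta (q⁻¹ * t 7 / t 5) p = C
  generalize theta (q⁻¹ * (t 6 * t 7)) p = D
  -- The factor θ(t₈/t₇) is a denominator on both sides, so if it vanishes both sides are 0 by the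
  -- convention for division.
  by_cases hA : A = 0
  · simp [hA]
  field_simp

end EllipticHypergeometric

namespace EllipticHypergeometric
open Complex Filter Topology

variable {p q : ℂ}

/-! ### Permutation symmetry, and the elliptic hypergeometric equation in the unit disc -/

theorem kernel_comp_equiv (p q : ℂ) (t : Fin 8 → ℂ) (σ : Equiv.Perm (Fin 8)) :
    kernel p q (t ∘ σ) = kernel p q t := by
  funext z
  unfold kernel
  congr 1
  exact Equiv.prod_comp σ fun j => ellGamma p q (t j * z) * ellGamma p q (t j * z⁻¹)

theorem vIntegral_comp_equiv (p q : ℂ) (t : Fin 8 → ℂ) (σ : Equiv.Perm (Fin 8)) :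
    vIntegral p q (t ∘ σ) = vIntegral p q t := by
  rw [vIntegral, kernel_comp_equiv, vIntegral]

theorem forall_swap78 {P : ℂ → Prop} {t : Fin 8 → ℂ} (h : ∀ j, P (t j)) (j : Fin 8) :
    P (swap78 t j) := h _

theorem normDen_swap78 (p q : ℂ) (t : Fin 8 → ℂ) :
    normDen p q (swap78 t) = normDen p q t := by
  have h5 : swap78 t 5 = t 5 := rfl
  have h6 : swap78 t 6 = t 7 := rfl
  have h7 : swap78 t 7 = t 6 := rfl
  rw [normDen, normDen, h5, h6, h7]
  ring

theorem normU_swap78 (p q : ℂ) (t : Fin 8 → ℂ) :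
    normU p q (swap78 t) = normU p q t := by
  have h5 : swap78 t 5 = t 5 := rfl
  have h6 : swap78 t 6 = t 7 := rfl
  have h7 : swap78 t 7 = t 6 := rfl
  rw [normU, normU, h5, h6, h7]
  ring

theorem U_swap78_of_norm_lt {t : Fin 8 → ℂ} (ht : ∀ j, ‖t j‖ < 1) :
    U p q (swap78 t) = U p q t := by
  rw [U_eq, U_eq, normU_swap78, V_of_norm_lt ht,
    V_of_norm_lt (forall_swap78 (P := fun x => ‖x‖ < 1) ht), swap78, vIntegral_comp_equiv]

theorem shiftUp_swap78 (q : ℂ) (t : Fin 8 → ℂ) :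
    shiftUp q (swap78 t) = swap78 (shiftDown q t) := by
  funext j
  fin_cases j <;> rfl

/-- The term of `𝒟` with the shift `T⁻¹`. -/
theorem coeffA_swap_mul_sub (hp₀ : p ≠ 0) (hp : ‖p‖ < 1) (hq₀ : q ≠ 0) (hq : ‖q‖ < 1)
    {t v : Fin 8 → ℂ} (ht₀ : ∀ j, t j ≠ 0) (ht : ∀ j, ‖t j‖ < 1)
    (hd : ∀ j, ‖shiftDown q t j‖ < 1) (hn : normDen p q t ≠ 0)
    (hn' : normDen p q (shiftDown q t) ≠ 0)
    (hv : v = ![t 0, t 1, t 2, t 3, t 4, q * t 5, t 6, q⁻¹ * t 7])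
    (hθ : theta (t 7 / (q * t 6)) p ≠ 0) :
    coeffA p q (swap78 t) * (U p q (shiftDown q t) - U p q t) =
      -(theta (q⁻¹ * t 6 / t 5) p * five p t (q⁻¹ * t 7) * theta (q⁻¹ * (t 7 * t 6)) p /
        theta (t 6 / t 7) p) * normU p q t * vIntegral p q v := by
  have key := coeffA_mul_sub hp₀ hp hq₀ hq (w := swap78 t) (t := swap78 t)
    (v := ![t 0, t 1, t 2, t 3, t 4, q * t 5, q⁻¹ * t 7, t 6])
    (forall_swap78 (P := fun x => x ≠ 0) ht₀) (forall_swap78 (P := fun x => ‖x‖ < 1) ht)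
    (by rw [shiftUp_swap78]; exact forall_swap78 (P := fun x => ‖x‖ < 1) hd)
    (by rwa [normDen_swap78]) (by rwa [shiftUp_swap78, normDen_swap78])
    (forall_swap78 (P := fun x => x ≠ 0) ht₀) rfl rfl rfl rfl hθ
  rw [shiftUp_swap78, U_swap78_of_norm_lt hd, U_swap78_of_norm_lt ht, normU_swap78] at key
  have hv' : ![t 0, t 1, t 2, t 3, t 4, q * t 5, q⁻¹ * t 7, t 6] = v ∘ Equiv.swap 6 7 := by
    rw [hv]
    funext j
    fin_cases j <;> rfl
  rw [hv', vIntegral_comp_equiv] at key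
  exact key

/-- The elliptic hypergeometric equation, for parameters in the unit disc. -/
theorem opU_eq_zero_of_norm_lt (hp₀ : p ≠ 0) (hp : ‖p‖ < 1) (hq₀ : q ≠ 0) (hq : ‖q‖ < 1)
    {t : Fin 8 → ℂ} (hb : Balanced p q t) (ht : ∀ j, ‖t j‖ < 1)
    (hu : ∀ j, ‖shiftUp q t j‖ < 1) (hd : ∀ j, ‖shiftDown q t j‖ < 1) (hn : normDen p q t ≠ 0)
    (hnu : normDen p q (shiftUp q t) ≠ 0) (hnd : normDen p q (shiftDown q t) ≠ 0)
    (h1 : theta (t 6 / (q * t 7)) p ≠ 0) (h2 : theta (t 7 / (q * t 6)) p ≠ 0)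
    (h3 : theta (t 7 / t 6) p ≠ 0) : opU p q t t = 0 := by
  obtain ⟨ht₀, hprod⟩ := hb
  -- Dividing t₇ and t₈ by q turns ∏ t_j = p²q² into the condition ∏ s_j = p². Raising two of the
  -- last three entries gives t and the two vectors to which the terms with T and T⁻¹ collapse.
  have key := vIntegral_combination hp₀ hp hq₀ hq
    (s := ![t 0, t 1, t 2, t 3, t 4, t 5, q⁻¹ * t 6, q⁻¹ * t 7])
    (u := ![t 0, t 1, t 2, t 3, t 4, t 5, t 6, q⁻¹ * t 7])
    (v := ![t 0, t 1, t 2, t 3, t 4, q * t 5, q⁻¹ * t 6, q⁻¹ * t 7]) (t₁ := t)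
    (t₂ := ![t 0, t 1, t 2, t 3, t 4, q * t 5, q⁻¹ * t 6, t 7])
    (t₃ := ![t 0, t 1, t 2, t 3, t 4, q * t 5, t 6, q⁻¹ * t 7])
    (forall_vec (P := fun x : ℂ => x ≠ 0) (ht₀ 0) (ht₀ 1) (ht₀ 2) (ht₀ 3) (ht₀ 4) (ht₀ 5)
      (mul_ne_zero (inv_ne_zero hq₀) (ht₀ 6)) (mul_ne_zero (inv_ne_zero hq₀) (ht₀ 7)))
    (forall_vec (P := fun x : ℂ => ‖x‖ < 1) (ht 0) (ht 1) (ht 2) (ht 3) (ht 4) (ht 5) (hu 6) (hd 7))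
    (by
      rw [Fin.prod_univ_eight] at hprod ⊢
      simp only [Matrix.cons_val]
      field_simp
      linear_combination hprod)
    ⟨by simp [hq₀], fun j hj => by fin_cases j <;> simp at hj ⊢⟩
    ⟨by simp, fun j hj => by fin_cases j <;> simp at hj ⊢⟩
    ⟨by simp [hq₀], fun j hj => by fin_cases j <;> simp at hj ⊢⟩
    ⟨by simp [hq₀], fun j hj => by fin_cases j <;> simp at hj ⊢⟩
    ⟨by simp [hq₀], fun j hj => by fin_cases j <;> simp at hj ⊢⟩
  have e0 : ∀ x, five p ![t 0, t 1, t 2, t 3, t 4, t 5, q⁻¹ * t 6, q⁻¹ * t 7] x = five p t x :=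
    fun x => rfl
  have e1 : q⁻¹ * t 7 / (q⁻¹ * t 6) = t 7 / t 6 := by
    rw [mul_div_mul_left _ _ (inv_ne_zero hq₀)]
  have e2 : coeffK p q t = theta (q⁻¹ * (t 6 * t 7)) p * five p t (t 5) := by
    simp only [coeffK, thetas, List.map_cons, List.map_nil, List.prod_cons, List.prod_nil, mul_one,
      five, mul_comm (t 5), div_eq_inv_mul]
    ring
  simp only [Matrix.cons_val, e0, e1] at key
  rw [opU, coeffA_mul_sub hp₀ hp hq₀ hq ht₀ ht hu hn hnu ht₀ rfl rfl rfl rfl h1,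
    coeffA_swap_mul_sub hp₀ hp hq₀ hq ht₀ ht hd hn hnd rfl h2, U_eq, V_of_norm_lt ht, e2,
    mul_comm (t 7) (t 6), theta_div_comm hp (ht₀ 6) (ht₀ 7)]
  have h6' := ht₀ 6; have h7' := ht₀ 7
  generalize theta (t 7 / t 6) p = A at *
  generalize theta (q⁻¹ * (t 6 * t 7)) p = B at *
  generalize theta (q⁻¹ * t 7 / t 5) p = C at *
  generalize theta (q⁻¹ * t 6 / t 5) p = D at *
  generalize five p t (t 5) = E at *
  generalize five p t (q⁻¹ * t 6) = F at *
  generalize five p t (q⁻¹ * t 7) = G at *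
  generalize vIntegral p q t = v₁ at *
  generalize vIntegral p q ![t 0, t 1, t 2, t 3, t 4, q * t 5, q⁻¹ * t 6, t 7] = v₂ at *
  generalize vIntegral p q ![t 0, t 1, t 2, t 3, t 4, q * t 5, t 6, q⁻¹ * t 7] = v₃ at *
  generalize normU p q t = N at *
  have key' : -(C * F) * v₂ / A + t 7 / t 6 * D * G * v₃ / A + E * v₁ = 0 := by
    field_simp at key ⊢
    linear_combination -key
  field_simp at key' ⊢
  linear_combination B * N * key'

/-! ### The contiguous relation in the unit disc -/

/-- The right-hand side of the contiguous relation, as a function of the parameters. -/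
noncomputable def contiguousVec (p q : ℂ) (t : Fin 8 → ℂ) : ℂ :=
  t 3 * t 5 * (thetas [t 2 * t 3 * t 6 * t 7 / q ^ 2, t 6 * t 5, t 7 * t 5] p /
      thetas [t 2 * t 6 / q, t 2 * t 7 / q, t 3 * t 6 / q, t 3 * t 7 / q, q * t 5 / t 4] p) *
    thetas [t 4 * t 0 / q, t 4 * t 1 / q, t 4 * t 2 / q, t 4 * t 3 / q, t 4 * t 6 / q,
      t 4 * t 7 / q] p * U p q (shiftMid q t) -
  thetas [q * t 5 / t 7, t 5 * t 0, t 5 * t 1, t 5 * t 2, t 5 * t 3] p /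
      thetas [t 2 * t 7 / q, q / (t 3 * t 7)] p *
    (thetas [t 5 * t 7, t 6 / t 4, t 4 * t 6 / q, t 2 * t 3 * t 6 * t 7 / q ^ 2] p /
        thetas [q * t 5 / t 4, t 2 * t 6 / q, t 3 * t 6 / q] p -
      thetas [t 6 * t 7 / q, t 4 * t 5, t 2 * t 3 * t 5 * t 7 / q] p /
        thetas [t 2 * t 5, t 3 * t 5] p) * U p q t

/-- The parameters with `t₃' = q/t₈`, for which the coefficient of `T⁻¹` vanishes. -/
noncomputable def specialVec (q : ℂ) (t : Fin 8 → ℂ) : Fin 8 → ℂ :=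
  ![t 0, t 1, q / t 7, t 2 * t 3 * t 7 / q, t 4, t 5, t 6, t 7]

theorem vIntegral_relation_mid (hp₀ : p ≠ 0) (hp : ‖p‖ < 1) (hq₀ : q ≠ 0) (hq : ‖q‖ < 1)
    {t : Fin 8 → ℂ} (hb : Balanced p q t) (ht : ∀ j, ‖t j‖ < 1)
    (hu : ∀ j, ‖shiftUp q t j‖ < 1) (hm : ∀ j, ‖shiftMid q t j‖ < 1) {s : Fin 8 → ℂ}
    (hs : s = ![t 0, t 1, t 2, t 3, t 7, t 5, q⁻¹ * t 6, q⁻¹ * t 4]) :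
    -theta (t 4 / t 6) p * five p s (t 5) * vIntegral p q t
      + theta (q⁻¹ * t 4 / t 5) p * five p s (q⁻¹ * t 6) *
        vIntegral p q ![t 0, t 1, t 2, t 3, t 4, q * t 5, q⁻¹ * t 6, t 7]
      + -(t 4 / t 6 * theta (q⁻¹ * t 6 / t 5) p * five p s (q⁻¹ * t 4)) *
        vIntegral p q (shiftMid q t) = 0 := by
  obtain ⟨ht₀, hprod⟩ := hb
  subst hs
  -- The partial fraction relation with t₅ and t₈ interchanged, so that the shifted entries are t₆,
  -- t₇, t₅. It expresses V(qt₆, q⁻¹t₇) through V(t) and V(q⁻¹t₅, qt₆).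
  have key := vIntegral_combination hp₀ hp hq₀ hq
    (s := ![t 0, t 1, t 2, t 3, t 7, t 5, q⁻¹ * t 6, q⁻¹ * t 4])
    (u := ![t 0, t 1, t 2, t 3, t 7, t 5, t 6, q⁻¹ * t 4])
    (v := ![t 0, t 1, t 2, t 3, t 7, q * t 5, q⁻¹ * t 6, q⁻¹ * t 4])
    (t₁ := ![t 0, t 1, t 2, t 3, t 7, t 5, t 6, t 4])
    (t₂ := ![t 0, t 1, t 2, t 3, t 7, q * t 5, q⁻¹ * t 6, t 4])
    (t₃ := ![t 0, t 1, t 2, t 3, t 7, q * t 5, t 6, q⁻¹ * t 4])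
    (forall_vec (P := fun x : ℂ => x ≠ 0) (ht₀ 0) (ht₀ 1) (ht₀ 2) (ht₀ 3) (ht₀ 7) (ht₀ 5)
      (mul_ne_zero (inv_ne_zero hq₀) (ht₀ 6)) (mul_ne_zero (inv_ne_zero hq₀) (ht₀ 4)))
    (forall_vec (P := fun x : ℂ => ‖x‖ < 1) (ht 0) (ht 1) (ht 2) (ht 3) (ht 7) (ht 5) (hu 6) (hm 4))
    (by
      rw [Fin.prod_univ_eight] at hprod ⊢
      simp only [Matrix.cons_val]
      field_simp
      linear_combination hprod)
    ⟨by simp [hq₀], fun j hj => by fin_cases j <;> simp at hj ⊢⟩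
    ⟨by simp, fun j hj => by fin_cases j <;> simp at hj ⊢⟩
    ⟨by simp [hq₀], fun j hj => by fin_cases j <;> simp at hj ⊢⟩
    ⟨by simp [hq₀], fun j hj => by fin_cases j <;> simp at hj ⊢⟩
    ⟨by simp [hq₀], fun j hj => by fin_cases j <;> simp at hj ⊢⟩
  have p1 : ![t 0, t 1, t 2, t 3, t 7, t 5, t 6, t 4] = t ∘ Equiv.swap 4 7 := by
    funext j; fin_cases j <;> rfl
  have p2 : ![t 0, t 1, t 2, t 3, t 7, q * t 5, q⁻¹ * t 6, t 4] =
      ![t 0, t 1, t 2, t 3, t 4, q * t 5, q⁻¹ * t 6, t 7] ∘ Equiv.swap 4 7 := by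
    funext j; fin_cases j <;> rfl
  have p3 : ![t 0, t 1, t 2, t 3, t 7, q * t 5, t 6, q⁻¹ * t 4] =
      shiftMid q t ∘ Equiv.swap 4 7 := by
    funext j; fin_cases j <;> rfl
  rw [p1, p2, p3, vIntegral_comp_equiv, vIntegral_comp_equiv, vIntegral_comp_equiv] at key
  have e1 : q⁻¹ * t 4 / (q⁻¹ * t 6) = t 4 / t 6 := by
    rw [mul_div_mul_left _ _ (inv_ne_zero hq₀)]
  simp only [Matrix.cons_val, e1] at key
  exact key

end EllipticHypergeometric

namespace EllipticHypergeometric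
open Complex Filter Topology

variable {p q : ℂ}

/-- The contiguous relation for the special choice of `t₃'`, for parameters in the unit disc. -/
theorem contiguous_of_norm_lt (hp₀ : p ≠ 0) (hp : ‖p‖ < 1) (hq₀ : q ≠ 0) (hq : ‖q‖ < 1)
    {t : Fin 8 → ℂ} (hb : Balanced p q t) (ht : ∀ j, ‖t j‖ < 1)
    (hu : ∀ j, ‖shiftUp q t j‖ < 1) (hm : ∀ j, ‖shiftMid q t j‖ < 1) (hn : normDen p q t ≠ 0)
    (hnu : normDen p q (shiftUp q t) ≠ 0) (hnm : normDen p q (shiftMid q t) ≠ 0)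
    (h1 : theta (t 6 / (q * t 7)) p ≠ 0) (h2 : theta (t 7 / t 6) p ≠ 0)
    (h3 : theta (t 2 * t 6 / q) p ≠ 0) (h4 : theta (t 2 * t 7 / q) p ≠ 0)
    (h5 : theta (t 3 * t 6 / q) p ≠ 0) (h6 : theta (t 3 * t 7 / q) p ≠ 0)
    (h7 : theta (q * t 5 / t 4) p ≠ 0) (h8 : theta (t 2 * t 5) p ≠ 0)
    (h9 : theta (t 3 * t 5) p ≠ 0) :
    coeffA p q (specialVec q t) * (U p q (shiftUp q t) - U p q t) +
        coeffK p q (specialVec q t) * U p q t =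
      theta (t 2 * t 7 / q) p * theta (q / (t 3 * t 7)) p * contiguousVec p q t := by
  have ht₀ := hb.1
  -- `coeffA_mul_sub` reduces the T-term to the single value V(qt₆, q⁻¹t₇); this relation eliminates
  -- it in favour of the two values on the right-hand side.
  have key := vIntegral_relation_mid hp₀ hp hq₀ hq hb ht hu hm rfl
  have hN := normU_shiftMid hp hq₀ hq hn hnm
  have z2 := ht₀ 2; have z3 := ht₀ 3; have z4 := ht₀ 4; have z5 := ht₀ 5
  have z6 := ht₀ 6; have z7 := ht₀ 7
  have hw : ∀ j, specialVec q t j ≠ 0 :=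
    forall_vec (P := fun x : ℂ => x ≠ 0) (ht₀ 0) (ht₀ 1) (div_ne_zero hq₀ z7)
      (div_ne_zero (mul_ne_zero (mul_ne_zero z2 z3) z7) hq₀) z4 z5 z6 z7
  rw [coeffA_mul_sub hp₀ hp hq₀ hq ht₀ ht hu hn hnu hw rfl rfl rfl rfl h1, U_eq p q t,
    V_of_norm_lt ht, contiguousVec, U_eq p q t, U_eq p q (shiftMid q t), V_of_norm_lt ht,
    V_of_norm_lt hm]
  have e1 : five p (specialVec q t) (q⁻¹ * t 6) = theta (t 0 * t 6 / q) p * theta (t 1 * t 6 / q) p *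
      (-(t 6 / t 7) * theta (t 7 / t 6) p) * theta (t 2 * t 3 * t 6 * t 7 / q ^ 2) p *
      theta (t 4 * t 6 / q) p := by
    rw [← theta_div_comm hp z6 z7]
    simp only [five, specialVec, Matrix.cons_val]
    congr 1
    · congr 1
      · congr 1
        · congr 1 <;> (congr 1; ring)
        · congr 1; field_simp
      · congr 1; ring
    · congr 1; ring
  have e2 : coeffK p q (specialVec q t) = theta (t 6 * t 7 / q) p * (theta (t 5 * t 0) p *
      theta (t 5 * t 1) p * theta (q * t 5 / t 7) p * theta (t 2 * t 3 * t 5 * t 7 / q) p *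
      theta (t 4 * t 5) p) := by
    simp only [coeffK, specialVec, Matrix.cons_val, thetas, List.map_cons, List.map_nil,
      List.prod_cons, List.prod_nil, mul_one]
    have a1 : t 5 * (q / t 7) = q * t 5 / t 7 := by ring
    have a2 : t 5 * (t 2 * t 3 * t 7 / q) = t 2 * t 3 * t 5 * t 7 / q := by ring
    rw [a1, a2, mul_comm (t 5) (t 4)]
    ring
  have e3 : ∀ a : ℂ, five p ![t 0, t 1, t 2, t 3, t 7, t 5, q⁻¹ * t 6, q⁻¹ * t 4] a =
      theta (t 0 * a) p * theta (t 1 * a) p * theta (t 2 * a) p * theta (t 3 * a) p *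
      theta (t 7 * a) p := fun a => rfl
  have e4 : ∀ a b : ℂ, a * (q⁻¹ * b) = a * b / q := fun a b => by ring
  have e5 : ∀ a b : ℂ, q⁻¹ * (a * b) = a * b / q := fun a b => by ring
  have e6 : theta (q * t 5 / t 7) p = -(q * t 5 / t 7) * theta (q⁻¹ * t 7 / t 5) p := by
    rw [theta_div_comm hp (mul_ne_zero hq₀ z5) z7]
    congr 2
    field_simp
  have e7 : theta (q * t 5 / t 4) p = -(q * t 5 / t 4) * theta (q⁻¹ * t 4 / t 5) p := by
    rw [theta_div_comm hp (mul_ne_zero hq₀ z5) z4]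
    congr 2
    field_simp
  have e8 : theta (q / (t 3 * t 7)) p = -(q / (t 3 * t 7)) * theta (t 3 * t 7 / q) p :=
    theta_div_comm hp hq₀ (mul_ne_zero z3 z7)
  have e9 : theta (t 6 / t 4) p = -(t 6 / t 4) * theta (t 4 / t 6) p := theta_div_comm hp z6 z4
  have e10 : ∀ a : ℂ, q⁻¹ * (a / t 5) = q⁻¹ * a / t 5 := fun a => by ring
  rw [e7] at h7
  have h7' := right_ne_zero_of_mul h7
  rw [e3, e3, e3] at key
  simp only [e4, e10] at key hN
  simp only [e1, e2, e5, e6, e7, e8, e9, thetas, List.map_cons, List.map_nil,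
      List.prod_cons, List.prod_nil, mul_one]
  rw [mul_comm (t 7) (t 6)] at key
  simp only [mul_comm (t 5) (t 0), mul_comm (t 5) (t 1), mul_comm (t 5) (t 2), mul_comm (t 5) (t 3),
    mul_comm (t 5) (t 7), mul_comm (t 4) (t 0), mul_comm (t 4) (t 1), mul_comm (t 4) (t 2),
    mul_comm (t 4) (t 3), mul_comm (t 4) (t 7)]
  generalize theta (t 7 / t 6) p = R at *
  generalize theta (t 6 / (q * t 7)) p = S at *
  generalize theta (q⁻¹ * t 7 / t 5) p = X at *
  generalize theta (q⁻¹ * t 6 / t 5) p = Y at *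
  generalize theta (q⁻¹ * t 4 / t 5) p = Z at *
  generalize theta (t 4 / t 6) p = W at *
  generalize theta (t 0 * t 5) p = A₀ at *
  generalize theta (t 1 * t 5) p = A₁ at *
  generalize theta (t 2 * t 5) p = A₂ at *
  generalize theta (t 3 * t 5) p = A₃ at *
  generalize theta (t 4 * t 5) p = A₄ at *
  generalize theta (t 6 * t 5) p = A₆ at *
  generalize theta (t 7 * t 5) p = A₇ at *
  generalize theta (t 0 * t 6 / q) p = B₀ at *
  generalize theta (t 1 * t 6 / q) p = B₁ at *
  generalize theta (t 2 * t 6 / q) p = B₂ at *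
  generalize theta (t 3 * t 6 / q) p = B₃ at *
  generalize theta (t 4 * t 6 / q) p = B₄ at *
  generalize theta (t 6 * t 7 / q) p = B₇ at *
  generalize theta (t 0 * t 4 / q) p = D₀ at *
  generalize theta (t 1 * t 4 / q) p = D₁ at *
  generalize theta (t 2 * t 4 / q) p = D₂ at *
  generalize theta (t 3 * t 4 / q) p = D₃ at *
  generalize theta (t 7 * t 4 / q) p = D₇ at *
  generalize theta (t 2 * t 7 / q) p = C₂ at *
  generalize theta (t 3 * t 7 / q) p = C₃ at *
  generalize theta (t 2 * t 3 * t 6 * t 7 / q ^ 2) p = E at *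
  generalize theta (t 2 * t 3 * t 5 * t 7 / q) p = F at *
  generalize vIntegral p q t = v₁ at *
  generalize vIntegral p q ![t 0, t 1, t 2, t 3, t 4, q * t 5, q⁻¹ * t 6, t 7] = v₂ at *
  generalize vIntegral p q (shiftMid q t) = v₃ at *
  generalize normU p q t = N at *
  generalize normU p q (shiftMid q t) = N' at *
  generalize t 2 = a₂ at *
  generalize t 3 = a₃ at *
  generalize t 4 = a₄ at *
  generalize t 5 = a₅ at *
  generalize t 6 = a₆ at *
  generalize t 7 = a₇ at *
  have key' : Z * (B₀ * B₁ * B₂ * B₃ * B₇) * v₂ * a₆ = W * (A₀ * A₁ * A₂ * A₃ * A₇) * v₁ * a₆ +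
      a₄ * Y * (D₀ * D₁ * D₂ * D₃ * D₇) * v₃ := by
    field_simp at key
    linear_combination key
  clear key
  field_simp
  linear_combination X * N * E * B₄ * key' - E * B₄ * a₄ * (D₀ * D₁ * D₂ * D₃ * D₇) * v₃ * hN

end EllipticHypergeometric

namespace EllipticHypergeometric
open Complex Filter Topology

variable {p q : ℂ}

/-! ### Analytic continuation along curves in the balancing hypersurface -/

theorem complete_castSucc {t : Fin 8 → ℂ} (hb : Balanced p q t) :
    complete p q (fun i => t i.castSucc) = t := by
  have h := hb.2
  rw [Fin.prod_univ_castSucc] at h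
  have h0 : ∏ i : Fin 7, t i.castSucc ≠ 0 := Finset.prod_ne_zero_iff.2 fun i _ => hb.1 _
  funext j
  refine Fin.lastCases ?_ (fun i => ?_) j
  · rw [complete, Fin.snoc_last, ← h, mul_div_cancel_left₀ _ h0]
  · rw [complete, Fin.snoc_castSucc]

theorem balanced_complete (hp₀ : p ≠ 0) (hq₀ : q ≠ 0) {s : Fin 7 → ℂ} (hs : ∀ i, s i ≠ 0) :
    Balanced p q (complete p q s) := by
  have h0 : ∏ i : Fin 7, s i ≠ 0 := Finset.prod_ne_zero_iff.2 fun i _ => hs i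
  constructor
  · intro j
    refine Fin.lastCases ?_ (fun i => ?_) j
    · rw [complete, Fin.snoc_last]
      exact div_ne_zero (mul_ne_zero (pow_ne_zero 2 hp₀) (pow_ne_zero 2 hq₀)) h0
    · rw [complete, Fin.snoc_castSucc]
      exact hs i
  · rw [Fin.prod_univ_castSucc]
    simp only [complete, Fin.snoc_last, Fin.snoc_castSucc]
    exact mul_div_cancel₀ _ h0

theorem poleFactor_ne_zero_iff (hp : ‖p‖ < 1) (hq : ‖q‖ < 1) (t : Fin 8 → ℂ) :
    poleFactor p q t ≠ 0 ↔ ∀ j k : Fin 8, j < k → ∀ m n : ℕ, t j * t k * p ^ m * q ^ n ≠ 1 := by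
  simp only [poleFactor, Finset.prod_ne_zero_iff, Finset.mem_univ, true_implies, Finset.mem_Ioi,
    ne_eq, poch₂_eq_zero_iff hp hq, not_exists]

theorem poleFactor_ne_zero_of_norm_lt (hp : ‖p‖ < 1) (hq : ‖q‖ < 1) {t : Fin 8 → ℂ}
    (ht : ∀ j, ‖t j‖ < 1) : poleFactor p q t ≠ 0 := by
  simp only [poleFactor, Finset.prod_ne_zero_iff]
  intro j _ k _
  refine poch₂_ne_zero_of_norm_lt hp hq ?_
  rw [norm_mul]
  exact mul_lt_one_of_nonneg_of_lt_one_left (norm_nonneg _) (ht j) (ht k).le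

theorem VDefined.poleFactor_ne_zero (hp : ‖p‖ < 1) (hq : ‖q‖ < 1) {t : Fin 8 → ℂ}
    (h : VDefined p q t) : poleFactor p q t ≠ 0 := by
  rcases h.2 with h | h
  · exact poleFactor_ne_zero_of_norm_lt hp hq h
  · exact (poleFactor_ne_zero_iff hp hq t).2 h.2

/-- In the unit disc the continuation agrees with the integral, so one formula describes V on both
branches of its definition. -/
theorem exists_V_eq (hp : ‖p‖ < 1) (hq : ‖q‖ < 1) (h : ∃ F, IsContinuation p q F) :
    ∃ F : (Fin 7 → ℂ) → ℂ, DifferentiableOn ℂ F {s | ∀ i, s i ≠ 0} ∧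
      ∀ t, Balanced p q t → V p q t = F (fun i => t i.castSucc) / poleFactor p q t := by
  refine ⟨h.choose, h.choose_spec.1, fun t hb => ?_⟩
  by_cases ht : ∀ j, ‖t j‖ < 1
  · have h1 := h.choose_spec.2 (fun i => t i.castSucc) (fun i => hb.1 _)
      (by rwa [complete_castSucc hb])
    rw [V_of_norm_lt ht, h1, complete_castSucc hb,
      mul_div_cancel_left₀ _ (poleFactor_ne_zero_of_norm_lt hp hq ht)]
  · rw [V, if_neg ht, dif_pos h]

/-- An entire curve in the balancing hypersurface. -/
structure IsCurve (p q : ℂ) (γ : ℂ → Fin 8 → ℂ) : Prop where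
  differentiable : ∀ j, Differentiable ℂ fun w => γ w j
  balanced : ∀ w, Balanced p q (γ w)

theorem exists_isCurve (hp₀ : p ≠ 0) (hq₀ : q ≠ 0) {u t : Fin 8 → ℂ} (hu : Balanced p q u)
    (ht : Balanced p q t) : ∃ γ, IsCurve p q γ ∧ γ 0 = u ∧ γ 1 = t := by
  -- The first seven coordinates move exponentially from u to t and never vanish; the eighth is
  -- dictated by balancing.
  set s : ℂ → Fin 7 → ℂ := fun w i =>
    u i.castSucc * Complex.exp (w * Complex.log (t i.castSucc / u i.castSucc)) with hs
  have hs₀ : ∀ w i, s w i ≠ 0 := fun w i => mul_ne_zero (hu.1 _) (Complex.exp_ne_zero _)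
  have hsd : ∀ i, Differentiable ℂ fun w => s w i := fun i => by
    simp only [hs]; fun_prop
  refine ⟨fun w => complete p q (s w), ⟨fun j => ?_, fun w => balanced_complete hp₀ hq₀ (hs₀ w)⟩,
    ?_, ?_⟩
  · refine Fin.lastCases ?_ (fun i => ?_) j
    · have e : ∀ w, complete p q (s w) (Fin.last 7) = p ^ 2 * q ^ 2 / ∏ i, s w i := fun w => by
        rw [complete, Fin.snoc_last]
      simp only [e]
      refine Differentiable.div (differentiable_const _)
        (Differentiable.fun_finsetProd fun i _ => hsd i) fun w => ?_
      exact Finset.prod_ne_zero_iff.2 fun i _ => hs₀ w i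
    · have e : ∀ w, complete p q (s w) i.castSucc = s w i := fun w => by
        rw [complete, Fin.snoc_castSucc]
      simp only [e]
      exact hsd i
  · refine (congrArg (complete p q) (funext fun i => ?_)).trans (complete_castSucc hu)
    simp only [hs, zero_mul, Complex.exp_zero, mul_one]
  · refine (congrArg (complete p q) (funext fun i => ?_)).trans (complete_castSucc ht)
    simp only [hs, one_mul]
    rw [Complex.exp_log (div_ne_zero (ht.1 _) (hu.1 _)), mul_div_cancel₀ _ (hu.1 _)]

/-- The zeros of D are discrete, hence countable, so their complement is connected and dense and the
identity theorem applies on it. D may vanish at the starting point a; density supplies a nearby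
point where it does not. -/
theorem eq_zero_of_eventually_eq_zero {H D : ℂ → ℂ} (hD : Differentiable ℂ D)
    (hH : ∀ w, D w ≠ 0 → DifferentiableAt ℂ H w) {a b : ℂ} (hb : D b ≠ 0)
    (h : ∀ᶠ w in 𝓝 a, D w ≠ 0 → H w = 0) : H b = 0 := by
  have hDa : AnalyticOnNhd ℂ D Set.univ := fun w _ => hD.analyticAt w
  have hcod : D ⁻¹' {0}ᶜ ∈ codiscrete ℂ :=
    AnalyticOnNhd.preimage_zero_mem_codiscrete (x := b) (by simpa using hDa) hb
  obtain ⟨h1, h2⟩ := mem_codiscrete'.1 hcod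
  have h3 : (D ⁻¹' {0}ᶜ)ᶜ.Countable := by
    have := h2.to_subtype
    exact TopologicalSpace.separableSpace_iff_countable.1 inferInstance
  have h4 : IsPreconnected (D ⁻¹' {0}ᶜ) := by
    have := h3.isPathConnected_compl_of_one_lt_rank (by simp [Complex.rank_real_complex])
    rw [compl_compl] at this
    exact this.isConnected.isPreconnected
  have hHa : AnalyticOnNhd ℂ H (D ⁻¹' {0}ᶜ) :=
    DifferentiableOn.analyticOnNhd (fun w hw => (hH w hw).differentiableWithinAt) h1
  have hdense : Dense (D ⁻¹' {0}ᶜ) := by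
    have := h3.dense_compl ℝ
    rwa [compl_compl] at this
  obtain ⟨U, hU, hUo, haU⟩ := eventually_nhds_iff.1 h
  obtain ⟨z, hz, hzU⟩ := hdense.exists_mem_open hUo ⟨a, haU⟩
  refine hHa.eqOn_zero_of_preconnected_of_eventuallyEq_zero h4 hz ?_ hb
  filter_upwards [h1.mem_nhds hz, hUo.mem_nhds hzU] with w hw hwU
  exact hU w hwU hw

/-- Continuation of a relation H = 0 with denominator D: it spreads from an open set O containing
one balanced point to every balanced point with D ≠ 0, along a curve joining the two. -/
theorem eq_zero_of_balanced (hp₀ : p ≠ 0) (hq₀ : q ≠ 0) {H D : (Fin 8 → ℂ) → ℂ}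
    (hD : ∀ γ, IsCurve p q γ → Differentiable ℂ fun w => D (γ w))
    (hH : ∀ γ, IsCurve p q γ → ∀ w, D (γ w) ≠ 0 → DifferentiableAt ℂ (fun w => H (γ w)) w)
    {O : Set (Fin 8 → ℂ)} (hO : IsOpen O) {u : Fin 8 → ℂ} (hu : Balanced p q u) (huO : u ∈ O)
    (h : ∀ s ∈ O, Balanced p q s → D s ≠ 0 → H s = 0) {t : Fin 8 → ℂ} (ht : Balanced p q t)
    (hDt : D t ≠ 0) : H t = 0 := by
  obtain ⟨γ, hγ, h0, h1⟩ := exists_isCurve hp₀ hq₀ hu ht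
  have key := eq_zero_of_eventually_eq_zero (hD γ hγ) (hH γ hγ) (a := 0) (b := 1) (by rwa [h1])
  rw [h1] at key
  refine key ?_
  have hc : Continuous γ := continuous_pi fun j => (hγ.differentiable j).continuous
  filter_upwards [hc.continuousAt.preimage_mem_nhds (hO.mem_nhds (by rwa [h0]))] with w hw
  exact h _ hw (hγ.balanced w)

/-! ### Regularity along curves -/

theorem Differentiable.theta {f : ℂ → ℂ} (hp : ‖p‖ < 1) (hf : Differentiable ℂ f)
    (h : ∀ w, f w ≠ 0) : Differentiable ℂ fun w => theta (f w) p := fun w =>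
  DifferentiableAt.theta (hf w) hp (h w)

namespace IsCurve

variable {γ : ℂ → Fin 8 → ℂ}

theorem ne_zero (hγ : IsCurve p q γ) (w : ℂ) (j : Fin 8) : γ w j ≠ 0 := (hγ.balanced w).1 j

theorem shiftUp (hq₀ : q ≠ 0) (hγ : IsCurve p q γ) : IsCurve p q fun w => shiftUp q (γ w) := by
  have hd := hγ.differentiable
  refine ⟨fun j => ?_, fun w => ⟨?_, ?_⟩⟩
  · fin_cases j
    exacts [hd 0, hd 1, hd 2, hd 3, hd 4, hd 5, (hd 6).const_mul _, (hd 7).const_mul _]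
  · have h := hγ.ne_zero w
    exact forall_vec (P := fun x : ℂ => x ≠ 0) (h 0) (h 1) (h 2) (h 3) (h 4) (h 5)
      (mul_ne_zero (inv_ne_zero hq₀) (h 6)) (mul_ne_zero hq₀ (h 7))
  · rw [← (hγ.balanced w).2, Fin.prod_univ_eight, Fin.prod_univ_eight]
    simp only [EllipticHypergeometric.shiftUp, Matrix.cons_val]
    field_simp

theorem shiftDown (hq₀ : q ≠ 0) (hγ : IsCurve p q γ) :
    IsCurve p q fun w => shiftDown q (γ w) := by
  have hd := hγ.differentiable
  refine ⟨fun j => ?_, fun w => ⟨?_, ?_⟩⟩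
  · fin_cases j
    exacts [hd 0, hd 1, hd 2, hd 3, hd 4, hd 5, (hd 6).const_mul _, (hd 7).const_mul _]
  · have h := hγ.ne_zero w
    exact forall_vec (P := fun x : ℂ => x ≠ 0) (h 0) (h 1) (h 2) (h 3) (h 4) (h 5)
      (mul_ne_zero hq₀ (h 6)) (mul_ne_zero (inv_ne_zero hq₀) (h 7))
  · rw [← (hγ.balanced w).2, Fin.prod_univ_eight, Fin.prod_univ_eight]
    simp only [EllipticHypergeometric.shiftDown, Matrix.cons_val]
    field_simp

theorem shiftMid (hq₀ : q ≠ 0) (hγ : IsCurve p q γ) : IsCurve p q fun w => shiftMid q (γ w) := by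
  have hd := hγ.differentiable
  refine ⟨fun j => ?_, fun w => ⟨?_, ?_⟩⟩
  · fin_cases j
    exacts [hd 0, hd 1, hd 2, hd 3, (hd 4).const_mul _, (hd 5).const_mul _, hd 6, hd 7]
  · have h := hγ.ne_zero w
    exact forall_vec (P := fun x : ℂ => x ≠ 0) (h 0) (h 1) (h 2) (h 3)
      (mul_ne_zero (inv_ne_zero hq₀) (h 4)) (mul_ne_zero hq₀ (h 5)) (h 6) (h 7)
  · rw [← (hγ.balanced w).2, Fin.prod_univ_eight, Fin.prod_univ_eight]
    simp only [EllipticHypergeometric.shiftMid, Matrix.cons_val]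
    field_simp

theorem swap78 (hγ : IsCurve p q γ) : IsCurve p q fun w => swap78 (γ w) := by
  refine ⟨fun j => hγ.differentiable _, fun w => ⟨fun j => hγ.ne_zero w _, ?_⟩⟩
  rw [← (hγ.balanced w).2]
  exact Equiv.prod_comp (Equiv.swap 6 7) (γ w)

theorem differentiable_poleFactor (hp : ‖p‖ < 1) (hq : ‖q‖ < 1) (hγ : IsCurve p q γ) :
    Differentiable ℂ fun w => poleFactor p q (γ w) := by
  unfold poleFactor
  exact Differentiable.fun_finsetProd fun j _ => Differentiable.fun_finsetProd fun k _ =>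
    (differentiable_poch₂ hp hq).comp ((hγ.differentiable j).mul (hγ.differentiable k))

theorem differentiable_normDen (hp : ‖p‖ < 1) (hq : ‖q‖ < 1) (hγ : IsCurve p q γ) :
    Differentiable ℂ fun w => normDen p q (γ w) := by
  have h : ∀ f : ℂ → ℂ, Differentiable ℂ f → (∀ w, f w ≠ 0) →
      Differentiable ℂ fun w => poch₂ (p * q / f w) p q := fun f hf h0 =>
    (differentiable_poch₂ hp hq).comp ((differentiable_const _).div hf h0)
  have hm : ∀ j k, Differentiable ℂ fun w => γ w j * γ w k := fun j k =>
    (hγ.differentiable j).mul (hγ.differentiable k)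
  have hv : ∀ j k, Differentiable ℂ fun w => γ w j / γ w k := fun j k =>
    (hγ.differentiable j).div (hγ.differentiable k) fun w => hγ.ne_zero w k
  have hm₀ : ∀ j k w, γ w j * γ w k ≠ 0 := fun j k w => mul_ne_zero (hγ.ne_zero w j) (hγ.ne_zero w k)
  have hv₀ : ∀ j k w, γ w j / γ w k ≠ 0 := fun j k w => div_ne_zero (hγ.ne_zero w j) (hγ.ne_zero w k)
  unfold normDen
  exact (((h _ (hm 6 5) (hm₀ 6 5)).mul (h _ (hv 6 5) (hv₀ 6 5))).mul (h _ (hm 7 5) (hm₀ 7 5))).mul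
    (h _ (hv 7 5) (hv₀ 7 5))

theorem differentiableAt_normU (hp : ‖p‖ < 1) (hq : ‖q‖ < 1) (hγ : IsCurve p q γ) {w : ℂ}
    (hw : normDen p q (γ w) ≠ 0) : DifferentiableAt ℂ (fun w => normU p q (γ w)) w := by
  have h : ∀ f : ℂ → ℂ, DifferentiableAt ℂ f w → f w ≠ 0 → poch₂ (p * q / f w) p q ≠ 0 →
      DifferentiableAt ℂ (fun w => (ellGamma p q (f w))⁻¹) w := fun f hf h0 h1 =>
    DifferentiableAt.comp w (g := fun z => (ellGamma p q z)⁻¹)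
      (differentiableAt_ellGamma_inv hp hq h0 h1) hf
  have hm : ∀ j k, DifferentiableAt ℂ (fun w => γ w j * γ w k) w := fun j k =>
    ((hγ.differentiable j).mul (hγ.differentiable k)) w
  have hv : ∀ j k, DifferentiableAt ℂ (fun w => γ w j / γ w k) w := fun j k =>
    ((hγ.differentiable j).div (hγ.differentiable k) fun w => hγ.ne_zero w k) w
  have hm₀ : ∀ j k, γ w j * γ w k ≠ 0 := fun j k => mul_ne_zero (hγ.ne_zero w j) (hγ.ne_zero w k)
  have hv₀ : ∀ j k, γ w j / γ w k ≠ 0 := fun j k => div_ne_zero (hγ.ne_zero w j) (hγ.ne_zero w k)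
  simp only [normDen, mul_ne_zero_iff] at hw
  obtain ⟨⟨⟨h1, h2⟩, h3⟩, h4⟩ := hw
  unfold normU
  exact (((h _ (hm 6 5) (hm₀ 6 5) h1).mul (h _ (hv 6 5) (hv₀ 6 5) h2)).mul
    (h _ (hm 7 5) (hm₀ 7 5) h3)).mul (h _ (hv 7 5) (hv₀ 7 5) h4)

theorem differentiableAt_V (hp : ‖p‖ < 1) (hq : ‖q‖ < 1) (hF : ∃ F, IsContinuation p q F)
    (hγ : IsCurve p q γ) {w : ℂ} (hw : poleFactor p q (γ w) ≠ 0) :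
    DifferentiableAt ℂ (fun w => V p q (γ w)) w := by
  obtain ⟨F, hd, hV⟩ := exists_V_eq hp hq hF
  simp only [hV _ (hγ.balanced _)]
  refine DifferentiableAt.div ?_ (hγ.differentiable_poleFactor hp hq w) hw
  have hopen : IsOpen {s : Fin 7 → ℂ | ∀ i, s i ≠ 0} := by
    simp only [Set.ofPred_forall]
    exact isOpen_iInter_of_finite fun i => isOpen_ne_fun (continuous_apply i) continuous_const
  refine DifferentiableAt.comp w (g := F) (hd.differentiableAt (hopen.mem_nhds fun i =>
    hγ.ne_zero w i.castSucc)) ?_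
  exact differentiableAt_pi.2 fun i => hγ.differentiable i.castSucc w

theorem differentiableAt_U (hp : ‖p‖ < 1) (hq : ‖q‖ < 1) (hF : ∃ F, IsContinuation p q F)
    (hγ : IsCurve p q γ) {w : ℂ} (hw : poleFactor p q (γ w) ≠ 0) (hn : normDen p q (γ w) ≠ 0) :
    DifferentiableAt ℂ (fun w => U p q (γ w)) w := by
  simp only [U_eq]
  exact (hγ.differentiableAt_V hp hq hF hw).mul (hγ.differentiableAt_normU hp hq hn)

end IsCurve

end EllipticHypergeometric

namespace EllipticHypergeometric
open Complex Filter Topology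

variable {p q : ℂ}

/-! ### Base points for the continuation -/

theorem isOpen_norm_lt {f : (Fin 8 → ℂ) → Fin 8 → ℂ} (hf : Continuous f) :
    IsOpen {t | ∀ j, ‖f t j‖ < 1} := by
  simp only [Set.ofPred_forall]
  exact isOpen_iInter_of_finite fun j =>
    isOpen_lt ((continuous_apply j).comp hf).norm continuous_const

theorem continuous_shiftUp (q : ℂ) : Continuous (shiftUp q) := by
  refine continuous_pi fun j => ?_
  fin_cases j
  exacts [continuous_apply 0, continuous_apply 1, continuous_apply 2, continuous_apply 3,
    continuous_apply 4, continuous_apply 5, continuous_const.mul (continuous_apply 6),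
    continuous_const.mul (continuous_apply 7)]

theorem continuous_shiftDown (q : ℂ) : Continuous (shiftDown q) := by
  refine continuous_pi fun j => ?_
  fin_cases j
  exacts [continuous_apply 0, continuous_apply 1, continuous_apply 2, continuous_apply 3,
    continuous_apply 4, continuous_apply 5, continuous_const.mul (continuous_apply 6),
    continuous_const.mul (continuous_apply 7)]

theorem continuous_shiftMid (q : ℂ) : Continuous (shiftMid q) := by
  refine continuous_pi fun j => ?_
  fin_cases j
  exacts [continuous_apply 0, continuous_apply 1, continuous_apply 2, continuous_apply 3,
    continuous_const.mul (continuous_apply 4), continuous_const.mul (continuous_apply 5),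
    continuous_apply 6, continuous_apply 7]

theorem exists_pow_six (hp₀ : p ≠ 0) (hp : ‖p‖ < 1) : ∃ s : ℂ, s ≠ 0 ∧ ‖s‖ < 1 ∧ s ^ 6 = p := by
  obtain ⟨s, hs⟩ := IsAlgClosed.exists_pow_nat_eq p (n := 6) (by norm_num)
  refine ⟨s, ?_, ?_, hs⟩
  · rintro rfl
    exact hp₀ (by rw [← hs]; norm_num)
  · by_contra! h
    have : 1 ≤ ‖s‖ ^ 6 := one_le_pow₀ h
    rw [← norm_pow, hs] at this
    linarith

theorem norm_mul_lt_one {a b : ℂ} (ha : ‖a‖ < 1) (hb : ‖b‖ < 1) : ‖a * b‖ < 1 := by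
  rw [norm_mul]
  exact mul_lt_one_of_nonneg_of_lt_one_left (norm_nonneg _) ha hb.le

theorem norm_pow_three_lt_one {a : ℂ} (ha : ‖a‖ < 1) : ‖a ^ 3‖ < 1 := by
  rw [norm_pow]
  exact pow_lt_one₀ (norm_nonneg _) ha (by norm_num)

theorem exists_base_last (hp₀ : p ≠ 0) (hp : ‖p‖ < 1) (hq₀ : q ≠ 0) (hq : ‖q‖ < 1) :
    ∃ u : Fin 8 → ℂ, Balanced p q u ∧ (∀ j, ‖u j‖ < 1) ∧ (∀ j, ‖shiftUp q u j‖ < 1) ∧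
      ∀ j, ‖shiftDown q u j‖ < 1 := by
  obtain ⟨s, hs₀, hs, hs6⟩ := exists_pow_six hp₀ hp
  have h3 := norm_pow_three_lt_one hs
  have hq3 := norm_mul_lt_one hq h3
  have hz : q * s ^ 3 ≠ 0 := mul_ne_zero hq₀ (pow_ne_zero 3 hs₀)
  have e : q⁻¹ * (q * s ^ 3) = s ^ 3 := inv_mul_cancel_left₀ hq₀ _
  -- Since s⁶ = p the product is p²q². The two entries that get divided by q become s³, still inside
  -- the disc.
  refine ⟨![s, s, s, s, s, s, q * s ^ 3, q * s ^ 3], ⟨?_, ?_⟩, ?_, ?_, ?_⟩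
  · exact forall_vec (P := fun x : ℂ => x ≠ 0) hs₀ hs₀ hs₀ hs₀ hs₀ hs₀ hz hz
  · rw [Fin.prod_univ_eight, ← hs6]
    simp only [Matrix.cons_val]
    ring
  · exact forall_vec (P := fun x : ℂ => ‖x‖ < 1) hs hs hs hs hs hs hq3 hq3
  · refine forall_vec (P := fun x : ℂ => ‖x‖ < 1) hs hs hs hs hs hs ?_ (norm_mul_lt_one hq hq3)
    show ‖q⁻¹ * (q * s ^ 3)‖ < 1
    rwa [e]
  · refine forall_vec (P := fun x : ℂ => ‖x‖ < 1) hs hs hs hs hs hs (norm_mul_lt_one hq hq3) ?_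
    show ‖q⁻¹ * (q * s ^ 3)‖ < 1
    rwa [e]

theorem exists_base_mid (hp₀ : p ≠ 0) (hp : ‖p‖ < 1) (hq₀ : q ≠ 0) (hq : ‖q‖ < 1) :
    ∃ u : Fin 8 → ℂ, Balanced p q u ∧ (∀ j, ‖u j‖ < 1) ∧ (∀ j, ‖shiftUp q u j‖ < 1) ∧
      ∀ j, ‖shiftMid q u j‖ < 1 := by
  obtain ⟨s, hs₀, hs, hs6⟩ := exists_pow_six hp₀ hp
  have h3 := norm_pow_three_lt_one hs
  have hq3 := norm_mul_lt_one hq h3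
  have hz : q * s ^ 3 ≠ 0 := mul_ne_zero hq₀ (pow_ne_zero 3 hs₀)
  have e : q⁻¹ * (q * s ^ 3) = s ^ 3 := inv_mul_cancel_left₀ hq₀ _
  -- The same recipe, with qs³ at t₅ and t₇, the entries divided by q in the two shifts.
  refine ⟨![s, s, s, s, q * s ^ 3, s, q * s ^ 3, s], ⟨?_, ?_⟩, ?_, ?_, ?_⟩
  · exact forall_vec (P := fun x : ℂ => x ≠ 0) hs₀ hs₀ hs₀ hs₀ hz hs₀ hz hs₀
  · rw [Fin.prod_univ_eight, ← hs6]
    simp only [Matrix.cons_val]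
    ring
  · exact forall_vec (P := fun x : ℂ => ‖x‖ < 1) hs hs hs hs hq3 hs hq3 hs
  · refine forall_vec (P := fun x : ℂ => ‖x‖ < 1) hs hs hs hs hq3 hs ?_ (norm_mul_lt_one hq hs)
    show ‖q⁻¹ * (q * s ^ 3)‖ < 1
    rwa [e]
  · refine forall_vec (P := fun x : ℂ => ‖x‖ < 1) hs hs hs hs ?_ (norm_mul_lt_one hq hs) hq3 hs
    show ‖q⁻¹ * (q * s ^ 3)‖ < 1
    rwa [e]

/-! ### Continuation of the relations -/

/-- The chart behind the continuation singles out the eighth parameter, so this symmetry has to be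
continued from the disc, where the kernel is visibly symmetric. -/
theorem V_swap78 (hp₀ : p ≠ 0) (hp : ‖p‖ < 1) (hq₀ : q ≠ 0) (hq : ‖q‖ < 1) {t : Fin 8 → ℂ}
    (h : VDefined p q t) (h' : VDefined p q (swap78 t)) : V p q (swap78 t) = V p q t := by
  have hlt : ∀ s : Fin 8 → ℂ, (∀ j, ‖s j‖ < 1) → V p q (swap78 s) = V p q s := fun s hs => by
    rw [V_of_norm_lt hs, V_of_norm_lt (forall_swap78 (P := fun x => ‖x‖ < 1) hs), swap78,
      vIntegral_comp_equiv]
  rcases h.2 with ht | ⟨hF, -⟩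
  · exact hlt t ht
  obtain ⟨u, hu, hu1, -⟩ := exists_base_last hp₀ hp hq₀ hq
  refine sub_eq_zero.1 (eq_zero_of_balanced hp₀ hq₀
    (H := fun t => V p q (swap78 t) - V p q t)
    (D := fun t => poleFactor p q t * poleFactor p q (swap78 t))
    (fun γ hγ => (hγ.differentiable_poleFactor hp hq).mul
      (hγ.swap78.differentiable_poleFactor hp hq))
    (fun γ hγ w hw => (hγ.swap78.differentiableAt_V hp hq hF (right_ne_zero_of_mul hw)).sub
      (hγ.differentiableAt_V hp hq hF (left_ne_zero_of_mul hw)))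
    (O := {t | ∀ j, ‖t j‖ < 1}) (isOpen_norm_lt continuous_id) hu hu1
    (fun s hs _ _ => sub_eq_zero.2 (hlt s hs)) h.1
    (mul_ne_zero (h.poleFactor_ne_zero hp hq) (h'.poleFactor_ne_zero hp hq)))

/-- `U` is defined at `t`, in terms of non-vanishing. -/
theorem UDefined.normDen_ne_zero (hp : ‖p‖ < 1) (hq : ‖q‖ < 1) {t : Fin 8 → ℂ} (h : UDefined p q t) : normDen p q t ≠ 0 := by
  have h1 : ∀ z ∈ [t 6 * t 5, t 6 / t 5, t 7 * t 5, t 7 / t 5], poch₂ (p * q / z) p q ≠ 0 := by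
    intro z hz h0
    obtain ⟨m, n, hmn⟩ := (poch₂_eq_zero_iff hp hq).1 h0
    have hz0 : z ≠ 0 := by
      rintro rfl
      simp at hmn
    refine h.2 z hz m n ?_
    field_simp at hmn
    rw [← hmn]
    ring
  have a1 := h1 (t 6 * t 5) (by simp)
  have a2 := h1 (t 6 / t 5) (by simp)
  have a3 := h1 (t 7 * t 5) (by simp)
  have a4 := h1 (t 7 / t 5) (by simp)
  exact mul_ne_zero (mul_ne_zero (mul_ne_zero a1 a2) a3) a4

theorem differentiableAt_coeffA (hp : ‖p‖ < 1) (hq₀ : q ≠ 0) {γ : ℂ → Fin 8 → ℂ}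
    (hγ : ∀ j, Differentiable ℂ fun w => γ w j) {w : ℂ} (h0 : ∀ j, γ w j ≠ 0)
    (h1 : theta (γ w 7 / γ w 6) p ≠ 0) (h2 : theta (γ w 6 / (q * γ w 7)) p ≠ 0) :
    DifferentiableAt ℂ (fun w => coeffA p q (γ w)) w := by
  have d := fun j => hγ j w
  simp only [coeffA, thetas, List.map_cons, List.map_nil, List.prod_cons, List.prod_nil, mul_one]
  fun_prop (disch := simp_all)

theorem differentiableAt_coeffK (hp : ‖p‖ < 1) (hq₀ : q ≠ 0) {γ : ℂ → Fin 8 → ℂ}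
    (hγ : ∀ j, Differentiable ℂ fun w => γ w j) {w : ℂ} (h0 : ∀ j, γ w j ≠ 0) :
    DifferentiableAt ℂ (fun w => coeffK p q (γ w)) w := by
  have d := fun j => hγ j w
  simp only [coeffK, thetas, List.map_cons, List.map_nil, List.prod_cons, List.prod_nil, mul_one]
  fun_prop (disch := simp_all)

/-- The elliptic hypergeometric equation. -/
theorem opU_eq_zero (hp₀ : p ≠ 0) (hp : ‖p‖ < 1) (hq₀ : q ≠ 0) (hq : ‖q‖ < 1)
    {t : Fin 8 → ℂ} (ht : VDefined p q t) (hu : VDefined p q (shiftUp q t))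
    (hd : VDefined p q (shiftDown q t)) (hn : normDen p q t ≠ 0)
    (hnu : normDen p q (shiftUp q t) ≠ 0) (hnd : normDen p q (shiftDown q t) ≠ 0)
    (h1 : theta (t 6 / (q * t 7)) p ≠ 0) (h2 : theta (t 7 / (q * t 6)) p ≠ 0)
    (h3 : theta (t 7 / t 6) p ≠ 0) : opU p q t t = 0 := by
  -- If no continuation exists, `VDefined` can only hold in the unit disc, where the equation is
  -- already known.
  by_cases hF : ∃ F, IsContinuation p q F
  swap
  · have hlt : ∀ {s}, VDefined p q s → ∀ j, ‖s j‖ < 1 := fun hs =>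
      hs.2.resolve_right fun h => hF h.1
    exact opU_eq_zero_of_norm_lt hp₀ hp hq₀ hq ht.1 (hlt ht) (hlt hu) (hlt hd) hn hnu hnd h1 h2 h3
  obtain ⟨u, hbu, hu1, hu2, hu3⟩ := exists_base_last hp₀ hp hq₀ hq
  refine eq_zero_of_balanced hp₀ hq₀ (H := fun t => opU p q t t)
    (D := fun t => poleFactor p q t * poleFactor p q (shiftUp q t) *
      poleFactor p q (shiftDown q t) * (normDen p q t * normDen p q (shiftUp q t) *
      normDen p q (shiftDown q t)) * (theta (t 6 / (q * t 7)) p * theta (t 7 / (q * t 6)) p *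
      theta (t 7 / t 6) p)) ?_ ?_
    (O := {t | ∀ j, ‖t j‖ < 1} ∩ {t | ∀ j, ‖shiftUp q t j‖ < 1} ∩
      {t | ∀ j, ‖shiftDown q t j‖ < 1})
    (((isOpen_norm_lt continuous_id).inter (isOpen_norm_lt (continuous_shiftUp q))).inter
      (isOpen_norm_lt (continuous_shiftDown q))) hbu ⟨⟨hu1, hu2⟩, hu3⟩ ?_ ht.1
    (mul_ne_zero (mul_ne_zero (mul_ne_zero (mul_ne_zero (ht.poleFactor_ne_zero hp hq)
      (hu.poleFactor_ne_zero hp hq)) (hd.poleFactor_ne_zero hp hq))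
      (mul_ne_zero (mul_ne_zero hn hnu) hnd)) (mul_ne_zero (mul_ne_zero h1 h2) h3))
  · intro γ hγ
    have hγu := hγ.shiftUp hq₀
    have hγd := hγ.shiftDown hq₀
    have d : ∀ j, Differentiable ℂ fun w => γ w j := hγ.differentiable
    have n := hγ.ne_zero
    refine ((((hγ.differentiable_poleFactor hp hq).mul (hγu.differentiable_poleFactor hp hq)).mul
      (hγd.differentiable_poleFactor hp hq)).mul (((hγ.differentiable_normDen hp hq).mul
      (hγu.differentiable_normDen hp hq)).mul (hγd.differentiable_normDen hp hq))).mul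
      (((Differentiable.theta hp ((d 6).div ((d 7).const_mul q) ?_) ?_).mul
      (Differentiable.theta hp ((d 7).div ((d 6).const_mul q) ?_) ?_)).mul
      (Differentiable.theta hp ((d 7).div (d 6) ?_) ?_)) <;> intro w <;> simp [n, hq₀]
  · intro γ hγ w hw
    have hγu := hγ.shiftUp hq₀
    have hγd := hγ.shiftDown hq₀
    simp only [mul_ne_zero_iff] at hw
    obtain ⟨⟨⟨⟨p1, p2⟩, p3⟩, ⟨n1, n2⟩, n3⟩, ⟨a1, a2⟩, a3⟩ := hw
    have a3' : theta (γ w 6 / γ w 7) p ≠ 0 := by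
      rw [theta_div_comm hp (hγ.ne_zero w 6) (hγ.ne_zero w 7)]
      exact mul_ne_zero (neg_ne_zero.2 (div_ne_zero (hγ.ne_zero w 6) (hγ.ne_zero w 7))) a3
    have dU := hγ.differentiableAt_U hp hq hF p1 n1
    have dUu := hγu.differentiableAt_U hp hq hF p2 n2
    have dUd := hγd.differentiableAt_U hp hq hF p3 n3
    have cA := differentiableAt_coeffA hp hq₀ hγ.differentiable (hγ.ne_zero w) a3 a1
    have cA' := differentiableAt_coeffA hp hq₀ hγ.swap78.differentiable
      (hγ.swap78.ne_zero w) a3' a2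
    have cK := differentiableAt_coeffK hp hq₀ hγ.differentiable (hγ.ne_zero w)
    unfold opU
    exact ((cA.mul (dUu.sub dU)).add (cA'.mul (dUd.sub dU))).add (cK.mul dU)
  · rintro s ⟨⟨s1, s2⟩, s3⟩ hb hD
    simp only [mul_ne_zero_iff] at hD
    obtain ⟨⟨-, ⟨n1, n2⟩, n3⟩, ⟨a1, a2⟩, a3⟩ := hD
    exact opU_eq_zero_of_norm_lt hp₀ hp hq₀ hq hb s1 s2 s3 n1 n2 n3 a1 a2 a3

theorem differentiableAt_contiguousVec (hp : ‖p‖ < 1) (hq : ‖q‖ < 1) (hq₀ : q ≠ 0)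
    (hF : ∃ F, IsContinuation p q F) {γ : ℂ → Fin 8 → ℂ} (hγ : IsCurve p q γ) {w : ℂ}
    (p1 : poleFactor p q (γ w) ≠ 0) (p2 : poleFactor p q (shiftMid q (γ w)) ≠ 0)
    (n1 : normDen p q (γ w) ≠ 0) (n2 : normDen p q (shiftMid q (γ w)) ≠ 0)
    (h3 : theta (γ w 2 * γ w 6 / q) p ≠ 0) (h4 : theta (γ w 2 * γ w 7 / q) p ≠ 0)
    (h5 : theta (γ w 3 * γ w 6 / q) p ≠ 0) (h6 : theta (γ w 3 * γ w 7 / q) p ≠ 0)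
    (h6' : theta (q / (γ w 3 * γ w 7)) p ≠ 0)
    (h7 : theta (q * γ w 5 / γ w 4) p ≠ 0) (h8 : theta (γ w 2 * γ w 5) p ≠ 0)
    (h9 : theta (γ w 3 * γ w 5) p ≠ 0) :
    DifferentiableAt ℂ (fun w => contiguousVec p q (γ w)) w := by
  have dU := hγ.differentiableAt_U hp hq hF p1 n1
  have dUm := (hγ.shiftMid hq₀).differentiableAt_U hp hq hF p2 n2
  have d := fun j => hγ.differentiable j w
  have h0 := hγ.ne_zero w
  simp only [contiguousVec, thetas, List.map_cons, List.map_nil, List.prod_cons, List.prod_nil,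
    mul_one]
  have T : ∀ {f : ℂ → ℂ}, DifferentiableAt ℂ f w → f w ≠ 0 →
      DifferentiableAt ℂ (fun w => theta (f w) p) w := fun hf h => DifferentiableAt.theta hf hp h
  have m : ∀ j k, DifferentiableAt ℂ (fun w => theta (γ w j * γ w k) p) w := fun j k =>
    T ((d j).mul (d k)) (mul_ne_zero (h0 j) (h0 k))
  have m' : ∀ j k, DifferentiableAt ℂ (fun w => theta (γ w j * γ w k / q) p) w := fun j k =>
    T (((d j).mul (d k)).div_const q) (div_ne_zero (mul_ne_zero (h0 j) (h0 k)) hq₀)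
  have v : ∀ j k, DifferentiableAt ℂ (fun w => theta (q * γ w j / γ w k) p) w := fun j k =>
    T (((d j).const_mul q).div (d k) (h0 k)) (div_ne_zero (mul_ne_zero hq₀ (h0 j)) (h0 k))
  have v' : ∀ j k, DifferentiableAt ℂ (fun w => theta (γ w j / γ w k) p) w := fun j k =>
    T ((d j).div (d k) (h0 k)) (div_ne_zero (h0 j) (h0 k))
  have e : ∀ n : ℕ, ∀ k l, DifferentiableAt ℂ
      (fun w => theta (γ w 2 * γ w 3 * γ w k * γ w l / q ^ n) p) w := fun n k l =>
    T (((((d 2).mul (d 3)).mul (d k)).mul (d l)).div_const (q ^ n))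
      (div_ne_zero (mul_ne_zero (mul_ne_zero (mul_ne_zero (h0 2) (h0 3)) (h0 k)) (h0 l))
        (pow_ne_zero n hq₀))
  have e1 := e 1 5 7
  simp only [pow_one] at e1
  have i : DifferentiableAt ℂ (fun w => theta (q / (γ w 3 * γ w 7)) p) w :=
    T ((differentiableAt_const q).div ((d 3).mul (d 7)) (mul_ne_zero (h0 3) (h0 7)))
      (div_ne_zero hq₀ (mul_ne_zero (h0 3) (h0 7)))
  refine DifferentiableAt.sub (DifferentiableAt.mul ?_ dUm) (DifferentiableAt.mul ?_ dU)
  · refine ((((d 3).mul (d 5)).mul (((e 2 6 7).mul ((m 6 5).mul (m 7 5))).div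
      ((m' 2 6).mul ((m' 2 7).mul ((m' 3 6).mul ((m' 3 7).mul (v 5 4))))) ?_)).mul
      ((m' 4 0).mul ((m' 4 1).mul ((m' 4 2).mul ((m' 4 3).mul ((m' 4 6).mul (m' 4 7)))))))
    exact mul_ne_zero h3 (mul_ne_zero h4 (mul_ne_zero h5 (mul_ne_zero h6 h7)))
  · refine (((v 5 7).mul ((m 5 0).mul ((m 5 1).mul ((m 5 2).mul (m 5 3))))).div
      ((m' 2 7).mul i) (mul_ne_zero h4 h6')).mul
      ((((m 5 7).mul ((v' 6 4).mul ((m' 4 6).mul (e 2 6 7)))).div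
      ((v 5 4).mul ((m' 2 6).mul (m' 3 6))) (mul_ne_zero h7 (mul_ne_zero h3 h5))).sub
      (((m' 6 7).mul ((m 4 5).mul e1)).div ((m 2 5).mul (m 3 5)) (mul_ne_zero h8 h9)))

/-- The contiguous relation for the special choice of `t₃'`. -/
theorem contiguous_special (hp₀ : p ≠ 0) (hp : ‖p‖ < 1) (hq₀ : q ≠ 0) (hq : ‖q‖ < 1)
    {t : Fin 8 → ℂ} (ht : VDefined p q t) (hu : VDefined p q (shiftUp q t))
    (hm : VDefined p q (shiftMid q t)) (hn : normDen p q t ≠ 0)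
    (hnu : normDen p q (shiftUp q t) ≠ 0) (hnm : normDen p q (shiftMid q t) ≠ 0)
    (h1 : theta (t 6 / (q * t 7)) p ≠ 0) (h2 : theta (t 7 / t 6) p ≠ 0)
    (h3 : theta (t 2 * t 6 / q) p ≠ 0) (h4 : theta (t 2 * t 7 / q) p ≠ 0)
    (h5 : theta (t 3 * t 6 / q) p ≠ 0) (h6 : theta (t 3 * t 7 / q) p ≠ 0)
    (h7 : theta (q * t 5 / t 4) p ≠ 0) (h8 : theta (t 2 * t 5) p ≠ 0)
    (h9 : theta (t 3 * t 5) p ≠ 0) :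
    coeffA p q (specialVec q t) * (U p q (shiftUp q t) - U p q t) +
        coeffK p q (specialVec q t) * U p q t =
      theta (t 2 * t 7 / q) p * theta (q / (t 3 * t 7)) p * contiguousVec p q t := by
  by_cases hF : ∃ F, IsContinuation p q F
  swap
  · have hlt : ∀ {s}, VDefined p q s → ∀ j, ‖s j‖ < 1 := fun hs =>
      hs.2.resolve_right fun h => hF h.1
    exact contiguous_of_norm_lt hp₀ hp hq₀ hq ht.1 (hlt ht) (hlt hu) (hlt hm) hn hnu hnm h1 h2 h3
      h4 h5 h6 h7 h8 h9
  obtain ⟨u, hbu, hu1, hu2, hu3⟩ := exists_base_mid hp₀ hp hq₀ hq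
  refine sub_eq_zero.1 (eq_zero_of_balanced hp₀ hq₀
    (H := fun t => coeffA p q (specialVec q t) * (U p q (shiftUp q t) - U p q t) +
        coeffK p q (specialVec q t) * U p q t -
      theta (t 2 * t 7 / q) p * theta (q / (t 3 * t 7)) p * contiguousVec p q t)
    (D := fun t => poleFactor p q t * poleFactor p q (shiftUp q t) *
      poleFactor p q (shiftMid q t) * (normDen p q t * normDen p q (shiftUp q t) *
      normDen p q (shiftMid q t)) * (theta (t 6 / (q * t 7)) p * theta (t 7 / t 6) p *
      theta (t 2 * t 6 / q) p * theta (t 2 * t 7 / q) p * theta (t 3 * t 6 / q) p *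
      theta (t 3 * t 7 / q) p * theta (q * t 5 / t 4) p * theta (t 2 * t 5) p *
      theta (t 3 * t 5) p)) ?_ ?_
    (O := {t | ∀ j, ‖t j‖ < 1} ∩ {t | ∀ j, ‖shiftUp q t j‖ < 1} ∩
      {t | ∀ j, ‖shiftMid q t j‖ < 1})
    (((isOpen_norm_lt continuous_id).inter (isOpen_norm_lt (continuous_shiftUp q))).inter
      (isOpen_norm_lt (continuous_shiftMid q))) hbu ⟨⟨hu1, hu2⟩, hu3⟩ ?_ ht.1 ?_)
  · intro γ hγ
    have hγu := hγ.shiftUp hq₀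
    have hγm := hγ.shiftMid hq₀
    have n := hγ.ne_zero
    refine ((((hγ.differentiable_poleFactor hp hq).mul (hγu.differentiable_poleFactor hp hq)).mul
      (hγm.differentiable_poleFactor hp hq)).mul (((hγ.differentiable_normDen hp hq).mul
      (hγu.differentiable_normDen hp hq)).mul (hγm.differentiable_normDen hp hq))).mul ?_
    intro w
    have d := fun j => hγ.differentiable j w
    fun_prop (disch := simp_all)
  · intro γ hγ w hw
    have hγu := hγ.shiftUp hq₀
    simp only [mul_ne_zero_iff] at hw
    obtain ⟨⟨⟨⟨p1, p2⟩, p3⟩, ⟨n1, n2⟩, n3⟩, ⟨⟨⟨⟨⟨⟨⟨a1, a2⟩, a3⟩, a4⟩, a5⟩, a6⟩, a7⟩, a8⟩, a9⟩ := hw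
    have n := hγ.ne_zero
    have d := hγ.differentiable
    have a6' : theta (q / (γ w 3 * γ w 7)) p ≠ 0 := by
      have hz : γ w 3 * γ w 7 ≠ 0 := mul_ne_zero (n w 3) (n w 7)
      rw [theta_div_comm hp hq₀ hz]
      exact mul_ne_zero (neg_ne_zero.2 (div_ne_zero hq₀ hz)) a6
    have dS : ∀ j, Differentiable ℂ fun w => specialVec q (γ w) j := fun j => by
      fin_cases j
      exacts [d 0, d 1, (differentiable_const q).div (d 7) fun w => n w 7,
        (((d 2).mul (d 3)).mul (d 7)).div_const q, d 4, d 5, d 6, d 7]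
    have nS : ∀ j, specialVec q (γ w) j ≠ 0 :=
      forall_vec (P := fun x : ℂ => x ≠ 0) (n w 0) (n w 1) (div_ne_zero hq₀ (n w 7))
        (div_ne_zero (mul_ne_zero (mul_ne_zero (n w 2) (n w 3)) (n w 7)) hq₀) (n w 4) (n w 5)
        (n w 6) (n w 7)
    have dU := hγ.differentiableAt_U hp hq hF p1 n1
    have dUu := hγu.differentiableAt_U hp hq hF p2 n2
    have cA := differentiableAt_coeffA hp hq₀ dS nS a2 a1
    have cK := differentiableAt_coeffK hp hq₀ dS nS
    have dR := differentiableAt_contiguousVec hp hq hq₀ hF hγ p1 p3 n1 n3 a3 a4 a5 a6 a6' a7 a8 a9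
    refine ((cA.mul (dUu.sub dU)).add (cK.mul dU)).sub (DifferentiableAt.mul ?_ dR)
    have d' := fun j => hγ.differentiable j w
    fun_prop (disch := simp_all)
  · rintro s ⟨⟨s1, s2⟩, s3⟩ hb hD
    simp only [mul_ne_zero_iff] at hD
    obtain ⟨⟨-, ⟨n1, n2⟩, n3⟩, ⟨⟨⟨⟨⟨⟨⟨a1, a2⟩, a3⟩, a4⟩, a5⟩, a6⟩, a7⟩, a8⟩, a9⟩ := hD
    exact sub_eq_zero.2 (contiguous_of_norm_lt hp₀ hp hq₀ hq hb s1 s2 s3 n1 n2 n3 a1 a2 a3 a4 a5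
      a6 a7 a8 a9)
  · simp only [mul_ne_zero_iff]
    exact ⟨⟨⟨⟨ht.poleFactor_ne_zero hp hq, hu.poleFactor_ne_zero hp hq⟩,
      hm.poleFactor_ne_zero hp hq⟩, ⟨hn, hnu⟩, hnm⟩, ⟨⟨⟨⟨⟨⟨⟨h1, h2⟩, h3⟩, h4⟩, h5⟩, h6⟩, h7⟩, h8⟩, h9⟩

end EllipticHypergeometric

namespace EllipticHypergeometric
open Complex Filter Topology

variable {p q : ℂ}

/-! ### The operator identity -/

/-- With r² = ab, a pair u, v of product ab corresponds to (u/r)^{±1}, so θ(xu)θ(xv) = θ(xr(u/r)^±).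
All products here are then of the form in the addition formula. -/
theorem theta_exchange (hp₀ : p ≠ 0) (hp : ‖p‖ < 1) {x a b a' b' a'' b'' : ℂ} (hx : x ≠ 0)
    (ha : a ≠ 0) (hb : b ≠ 0) (h' : a * b = a' * b') (h'' : a * b = a'' * b'') :
    theta (x * a') p * theta (x * b') p * (theta (a / a'') p * theta (a / b'') p) -
        theta (a / a') p * theta (a / b') p * (theta (x * a'') p * theta (x * b'') p) =
      a / a' * (theta (a' / a'') p * theta (a' / b'') p) * (theta (x * a) p * theta (x * b) p) := by
  have hab : a * b ≠ 0 := mul_ne_zero ha hb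
  obtain ⟨r, hr⟩ : ∃ r : ℂ, a * b = r * r := by
    obtain ⟨r, hr⟩ := IsAlgClosed.exists_pow_nat_eq (a * b) (n := 2) (by norm_num)
    exact ⟨r, by rw [← hr, pow_two]⟩
  have hr₀ : r ≠ 0 := by rintro rfl; exact hab (by rw [hr, mul_zero])
  have ha' : a' ≠ 0 := by rintro rfl; exact hab (by rw [h', zero_mul])
  have hb' : b' ≠ 0 := by rintro rfl; exact hab (by rw [h', mul_zero])
  have ha'' : a'' ≠ 0 := by rintro rfl; exact hab (by rw [h'', zero_mul])
  have hb'' : b'' ≠ 0 := by rintro rfl; exact hab (by rw [h'', mul_zero])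
  have e1 : ∀ {u v : ℂ}, u ≠ 0 → a * b = u * v →
      phi p (x * r) (u / r) = theta (x * u) p * theta (x * v) p := by
    intro u v hu huv
    have hv : x * r / (u / r) = x * v := by
      field_simp
      rw [pow_two, ← hr, huv]
    rw [phi_eq, hv, mul_div_assoc', mul_right_comm, mul_div_cancel_right₀ _ hr₀]
  have e2 : ∀ {s u v : ℂ}, u ≠ 0 → v ≠ 0 → a * b = u * v →
      phi p (s / r) (u / r) = theta (s / u) p * theta (s / v) p := by
    intro s u v hu hv huv
    have h1 : s / r * (u / r) = s / v := by
      rw [div_mul_div_comm, ← hr, huv]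
      field_simp
    rw [phi_eq, h1, div_div_div_cancel_right₀ hr₀, mul_comm]
  have key := addition_formula hp₀ hp (a := x * r) (b := a / r) (z := a' / r) (w := a'' / r)
    (mul_ne_zero hx hr₀) (div_ne_zero ha hr₀) (div_ne_zero ha'' hr₀) (div_ne_zero ha' hr₀)
  have e3 : phi p (a'' / r) (a' / r) = -(a'' / a') * (theta (a' / a'') p * theta (a' / b'') p) := by
    rw [← e2 ha'' hb'' h'', phi_eq, phi_eq, div_div_div_cancel_right₀ hr₀,
      div_div_div_cancel_right₀ hr₀, theta_div_comm hp ha'' ha', mul_comm (a'' / r)]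
    ring
  rw [e1 ha' h', e2 ha'' hb'' h'', e2 ha' hb' h', e1 ha'' h'', e1 ha rfl, e3,
    div_div_div_cancel_right₀ hr₀] at key
  generalize theta (a' / a'') p * theta (a' / b'') p = A at *
  generalize theta (x * a) p * theta (x * b) p = B at *
  rw [key]
  field_simp

/-- Each of the three coefficients of 𝒟 is a factor free of t₃, t₄ times θ(yt₃, yt₄; p), with y =
t₇/q, t₈/q, t₆. The identity is `theta_exchange` for these three values of y. -/
theorem opD_identity (hp₀ : p ≠ 0) (hp : ‖p‖ < 1) (hq₀ : q ≠ 0) {t : Fin 6 → ℂ}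
    (ht : ∀ i, t i ≠ 0) {c : ℂ} (hc : c ≠ 0) {t₃' t₄' t₃'' t₄'' : ℂ}
    (h' : t 2 * t 3 = t₃' * t₄') (h'' : t 2 * t 3 = t₃'' * t₄'')
    (h0 : thetas [t 2 / t₃'', t 2 / t₄''] p ≠ 0) (f : ℂ → ℂ) {x : ℂ} (hx : x ≠ 0) :
    opD p q (replace34 t t₃' t₄') c f x -
        thetas [t 2 / t₃', t 2 / t₄'] p / thetas [t 2 / t₃'', t 2 / t₄''] p *
          opD p q (replace34 t t₃'' t₄'') c f x =
      t 2 / t₃' * (thetas [t₃' / t₃'', t₃' / t₄''] p / thetas [t 2 / t₃'', t 2 / t₄''] p) *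
        opD p q t c f x := by
  have h2 : ∀ u v : ℂ, thetas [u, v] p = theta u p * theta v p := fun u v => by
    simp only [thetas, List.map_cons, List.map_nil, List.prod_cons, List.prod_nil, mul_one]
  have hE := fun (y : ℂ) (hy : y ≠ 0) => theta_exchange hp₀ hp hy (ht 2) (ht 3) h' h''
  simp only [← h2] at hE
  have ht' : t = replace34 t (t 2) (t 3) := by
    funext j
    fin_cases j <;> rfl
  obtain ⟨A, hA⟩ : ∃ A, ∀ u v, coeffA p q (par (replace34 t u v) c x) =
      A * thetas [c * x⁻¹ / q * u, c * x⁻¹ / q * v] p := by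
    refine ⟨thetas [c * x / (q * t 5), t 5 * (c * x), t 5 / (c * x)] p /
      thetas [c * x / (c * x⁻¹), c * x⁻¹ / (q * (c * x))] p *
      thetas [c * x⁻¹ * t 0 / q, c * x⁻¹ * t 1 / q, c * x⁻¹ * t 4 / q] p, fun u v => ?_⟩
    simp only [coeffA, par, replace34, Matrix.cons_val, thetas, List.map_cons, List.map_nil,
      List.prod_cons, List.prod_nil, mul_one, div_mul_eq_mul_div]
    ring
  obtain ⟨B, hB⟩ : ∃ B, ∀ u v, coeffA p q (swap78 (par (replace34 t u v) c x)) =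
      B * thetas [c * x / q * u, c * x / q * v] p := by
    refine ⟨thetas [c * x⁻¹ / (q * t 5), t 5 * (c * x⁻¹), t 5 / (c * x⁻¹)] p /
      thetas [c * x⁻¹ / (c * x), c * x / (q * (c * x⁻¹))] p *
      thetas [c * x * t 0 / q, c * x * t 1 / q, c * x * t 4 / q] p, fun u v => ?_⟩
    have hs : swap78 (par (replace34 t u v) c x) =
        ![t 0, t 1, u, v, t 4, t 5, c * x, c * x⁻¹] := by
      funext j
      fin_cases j <;> rfl
    simp only [hs, coeffA, Matrix.cons_val, thetas, List.map_cons, List.map_nil,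
      List.prod_cons, List.prod_nil, mul_one, div_mul_eq_mul_div]
    ring
  obtain ⟨C, hC⟩ : ∃ C, ∀ u v, coeffK p q (par (replace34 t u v) c x) =
      C * thetas [t 5 * u, t 5 * v] p := by
    refine ⟨theta (c * x⁻¹ * (c * x) / q) p * thetas [t 5 * t 0, t 5 * t 1, t 5 * t 4] p,
      fun u v => ?_⟩
    simp only [coeffK, par, replace34, Matrix.cons_val, thetas, List.map_cons, List.map_nil,
      List.prod_cons, List.prod_nil, mul_one]
    ring
  have hO : ∀ u v, opD p q (replace34 t u v) c f x =
      A * thetas [c * x⁻¹ / q * u, c * x⁻¹ / q * v] p * (f (q * x) - f x) +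
      B * thetas [c * x / q * u, c * x / q * v] p * (f (q⁻¹ * x) - f x) +
      C * thetas [t 5 * u, t 5 * v] p * f x := fun u v => by
    rw [opD, hA, hB, hC]
  have hO' : opD p q t c f x = _ := (congrArg (fun t => opD p q t c f x) ht').trans (hO _ _)
  rw [hO', hO, hO]
  have k1 := hE (c * x⁻¹ / q) (div_ne_zero (mul_ne_zero hc (inv_ne_zero hx)) hq₀)
  have k2 := hE (c * x / q) (div_ne_zero (mul_ne_zero hc hx) hq₀)
  have k3 := hE (t 5) (ht 5)
  generalize thetas [t 2 / t₃'', t 2 / t₄''] p = D at *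
  generalize thetas [t 2 / t₃', t 2 / t₄'] p = D' at *
  generalize t 2 / t₃' = r at *
  generalize f (q * x) - f x = f₁
  generalize f (q⁻¹ * x) - f x = f₂
  have e : ∀ z, z / D = z * D⁻¹ := fun z => div_eq_mul_inv _ _
  have hD := mul_inv_cancel₀ h0
  simp only [e]
  generalize D⁻¹ = D₁ at *
  linear_combination D₁ * (A * f₁ * k1 + B * f₂ * k2 + C * f x * k3) -
    (A * thetas [c * x⁻¹ / q * t₃', c * x⁻¹ / q * t₄'] p * f₁ +
      B * thetas [c * x / q * t₃', c * x / q * t₄'] p * f₂ +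
      C * thetas [t 5 * t₃', t 5 * t₄'] p * f x) * hD

/-! ### The contiguous relation -/

theorem par_mul (q : ℂ) (t : Fin 6 → ℂ) (c x : ℂ) :
    par t c (q * x) = shiftUp q (par t c x) := by
  have e1 : c * (q * x)⁻¹ = q⁻¹ * (c * x⁻¹) := by rw [mul_inv]; ring
  have e2 : c * (q * x) = q * (c * x) := by ring
  rw [par, e1, e2]
  rfl

theorem par_inv_mul (q : ℂ) (t : Fin 6 → ℂ) (c x : ℂ) :
    par t c (q⁻¹ * x) = shiftDown q (par t c x) := by
  have e1 : c * (q⁻¹ * x)⁻¹ = q * (c * x⁻¹) := by rw [mul_inv, inv_inv]; ring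
  have e2 : c * (q⁻¹ * x) = q⁻¹ * (c * x) := by ring
  rw [par, e1, e2]
  rfl

theorem par_inv (t : Fin 6 → ℂ) (c x : ℂ) : par t c x⁻¹ = swap78 (par t c x) := by
  rw [par, inv_inv]
  funext j
  fin_cases j <;> rfl

theorem par_shift56 (q : ℂ) (t : Fin 6 → ℂ) (c x : ℂ) :
    par (shift56 q t) c x = shiftMid q (par t c x) := rfl

theorem contiguousRHS_eq (p q : ℂ) (t : Fin 6 → ℂ) (c x : ℂ) :
    contiguousRHS p q t c x = contiguousVec p q (par t c x) := by
  simp only [contiguousRHS, contiguousVec, Ufun, par_shift56]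
  rfl

theorem opD_Ufun (p q : ℂ) (t s : Fin 6 → ℂ) (c x : ℂ) :
    opD p q s c (Ufun p q t c) x = opU p q (par s c x) (par t c x) := by
  rw [opD, opU, Ufun, Ufun, Ufun, par_mul, par_inv_mul]

theorem par_specialVec (q : ℂ) (t : Fin 6 → ℂ) (c x : ℂ) :
    par (replace34 t (q / (c * x)) (t 2 * t 3 * (c * x) / q)) c x = specialVec q (par t c x) := rfl

/-- The choice t₃' = q/t₈ makes the factor θ(t₈t₃'/q; p) equal to θ(1; p) = 0. -/
theorem coeffA_swap_specialVec (hp : ‖p‖ < 1) (hq₀ : q ≠ 0) {t : Fin 8 → ℂ} (h : t 7 ≠ 0) :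
    coeffA p q (swap78 (specialVec q t)) = 0 := by
  have hs : swap78 (specialVec q t) =
      ![t 0, t 1, q / t 7, t 2 * t 3 * t 7 / q, t 4, t 5, t 7, t 6] := by
    funext j
    fin_cases j <;> rfl
  have e : t 7 * (q / t 7) / q = 1 := by field_simp
  simp only [hs, coeffA, Matrix.cons_val, thetas, List.map_cons, List.map_nil,
      List.prod_cons, List.prod_nil, mul_one, e, theta_one hp, zero_mul, mul_zero]

theorem contiguous (hp₀ : p ≠ 0) (hp : ‖p‖ < 1) (hq₀ : q ≠ 0) (hq : ‖q‖ < 1) {t : Fin 6 → ℂ}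
    (ht : ∀ i, t i ≠ 0) {c : ℂ} (hc : c ≠ 0) {t₃' t₄' : ℂ} (h' : t 2 * t 3 = t₃' * t₄') {x : ℂ}
    (hx : x ≠ 0) (u0 : VDefined p q (par t c x)) (uu : VDefined p q (par t c (q * x)))
    (ud : VDefined p q (par t c (q⁻¹ * x))) (um : VDefined p q (par (shift56 q t) c x))
    (n0 : normDen p q (par t c x) ≠ 0) (nu : normDen p q (par t c (q * x)) ≠ 0)
    (nd : normDen p q (par t c (q⁻¹ * x)) ≠ 0) (nm : normDen p q (par (shift56 q t) c x) ≠ 0)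
    (hθ : thetas [t 2 / t₃', t 2 / t₄'] p ≠ 0) (hcd : constDenominators p q t ≠ 0)
    (hxd : xDenominators p q t c x ≠ 0) :
    opD p q (replace34 t t₃' t₄') c (Ufun p q t c) x / thetas [t 2 / t₃', t 2 / t₄'] p =
      contiguousRHS p q t c x := by
  rw [par_mul] at uu nu
  rw [par_inv_mul] at ud nd
  rw [par_shift56] at um nm
  simp only [constDenominators, xDenominators, thetas, List.map_cons, List.map_nil, List.prod_cons,
    List.prod_nil, mul_one, mul_ne_zero_iff] at hcd hxd
  obtain ⟨d1, d2, -, d4, d5, d6, d7, d8, d9⟩ := hxd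
  have hE := opU_eq_zero hp₀ hp hq₀ hq u0 uu ud n0 nu nd d2 d4 d1
  have hC := contiguous_special hp₀ hp hq₀ hq u0 uu um n0 nu nm d2 d1 d5 d6 d7 d8 hcd.1 hcd.2.1
    hcd.2.2
  have hcx : c * x ≠ 0 := mul_ne_zero hc hx
  have hsp : opU p q (specialVec q (par t c x)) (par t c x) =
      theta (t 2 * (c * x) / q) p * theta (q / (t 3 * (c * x))) p * contiguousRHS p q t c x := by
    rw [contiguousRHS_eq, opU, coeffA_swap_specialVec hp hq₀ hcx, zero_mul, add_zero]
    exact hC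
  have hΘ : thetas [t 2 / (q / (c * x)), t 2 / (t 2 * t 3 * (c * x) / q)] p =
      theta (t 2 * (c * x) / q) p * theta (q / (t 3 * (c * x))) p := by
    have e1 : t 2 / (q / (c * x)) = t 2 * (c * x) / q := by rw [div_div_eq_mul_div]
    have e2 : t 2 / (t 2 * t 3 * (c * x) / q) = q / (t 3 * (c * x)) := by
      have h2 := ht 2; have h3 := ht 3
      field_simp
    rw [e1, e2]
    simp only [thetas, List.map_cons, List.map_nil, List.prod_cons, List.prod_nil, mul_one]
  have h0 : theta (t 2 * (c * x) / q) p * theta (q / (t 3 * (c * x))) p ≠ 0 := mul_ne_zero d6 d9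
  -- Because 𝒟(t)U = 0 the right-hand side disappears, and the value for t₃' is proportional to the
  -- value for the special pair. The pair depends on x, which is harmless since the identity is
  -- pointwise in x.
  have key := opD_identity hp₀ hp hq₀ ht hc h' (t₃'' := q / (c * x))
    (t₄'' := t 2 * t 3 * (c * x) / q) (by field_simp) (by rwa [hΘ]) (Ufun p q t c) hx
  rw [opD_Ufun p q t t, hE, mul_zero, sub_eq_zero, opD_Ufun p q t (replace34 t (q / (c * x)) _),
    par_specialVec, hsp, hΘ] at key
  rw [key, div_mul_eq_mul_div, mul_left_comm, mul_div_cancel_left₀ _ h0, mul_div_cancel_left₀ _ hθ]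

end EllipticHypergeometric

namespace EllipticHypergeometric
open Complex Filter Topology MeasureTheory

variable {p q : ℂ}

/-! ### Generic points -/

/-- The multiplicative group generated by `p` and `q`. -/
def lattice (p q : ℂ) : Set ℂ := {z | ∃ i j : ℤ, z = p ^ i * q ^ j}

theorem countable_lattice (p q : ℂ) : (lattice p q).Countable := by
  have : lattice p q = Set.range fun n : ℤ × ℤ => p ^ n.1 * q ^ n.2 := by
    ext z
    constructor
    · rintro ⟨i, j, h⟩
      exact ⟨(i, j), h.symm⟩
    · rintro ⟨n, h⟩
      exact ⟨n.1, n.2, h.symm⟩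
  rw [this]
  exact Set.countable_range _

theorem mul_mem_lattice (hp₀ : p ≠ 0) (hq₀ : q ≠ 0) {a z : ℂ} (ha : a ∈ lattice p q)
    (hz : z ∈ lattice p q) : a * z ∈ lattice p q := by
  obtain ⟨i, j, rfl⟩ := ha
  obtain ⟨k, l, rfl⟩ := hz
  exact ⟨i + k, j + l, by rw [zpow_add₀ hp₀, zpow_add₀ hq₀]; ring⟩

theorem inv_mem_lattice {z : ℂ} (hz : z ∈ lattice p q) : z⁻¹ ∈ lattice p q := by
  obtain ⟨k, l, rfl⟩ := hz
  exact ⟨-k, -l, by rw [zpow_neg, zpow_neg, mul_inv]⟩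

theorem inv_notMem_lattice {z : ℂ} (hz : z ∉ lattice p q) : z⁻¹ ∉ lattice p q := fun h =>
  hz (by simpa using inv_mem_lattice h)

theorem mul_notMem_lattice (hp₀ : p ≠ 0) (hq₀ : q ≠ 0) {a z : ℂ} (ha : a ∈ lattice p q)
    (hz : z ∉ lattice p q) : a * z ∉ lattice p q := fun h => hz (by
  have ha₀ : a ≠ 0 := by
    obtain ⟨i, j, rfl⟩ := ha
    exact mul_ne_zero (zpow_ne_zero _ hp₀) (zpow_ne_zero _ hq₀)
  simpa [ha₀] using mul_mem_lattice hp₀ hq₀ (inv_mem_lattice ha) h)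

theorem zpow_mem_lattice_left (p q : ℂ) (n : ℤ) : p ^ n ∈ lattice p q := ⟨n, 0, by simp⟩

theorem left_mem_lattice (p q : ℂ) : p ∈ lattice p q := ⟨1, 0, by simp⟩

theorem right_mem_lattice (p q : ℂ) : q ∈ lattice p q := ⟨0, 1, by simp⟩

theorem poch₂_ne_zero (hp : ‖p‖ < 1) (hq : ‖q‖ < 1) {z : ℂ} (hz : z ∉ lattice p q) : poch₂ z p q ≠ 0 := by
  intro h
  obtain ⟨m, n, h⟩ := (poch₂_eq_zero_iff hp hq).1 h
  refine hz ⟨-m, -n, ?_⟩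
  rw [zpow_neg, zpow_neg, zpow_natCast, zpow_natCast, ← mul_inv]
  exact eq_inv_of_mul_eq_one_left (by rw [← mul_assoc, h])

theorem poch₂_mul_div_ne_zero (hp₀ : p ≠ 0) (hp : ‖p‖ < 1) (hq₀ : q ≠ 0) (hq : ‖q‖ < 1) {z : ℂ}
    (hz : z ∉ lattice p q) : poch₂ (p * q / z) p q ≠ 0 := by
  refine poch₂_ne_zero hp hq ?_
  rw [div_eq_mul_inv]
  exact mul_notMem_lattice hp₀ hq₀ (mul_mem_lattice hp₀ hq₀ (left_mem_lattice p q)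
    (right_mem_lattice p q)) (inv_notMem_lattice hz)

theorem theta_ne_zero (hp₀ : p ≠ 0) (hp : ‖p‖ < 1) {z : ℂ} (hz₀ : z ≠ 0)
    (hz : z ∉ lattice p q) : theta z p ≠ 0 := by
  intro h
  obtain ⟨k, rfl⟩ := (theta_eq_zero_iff hp₀ hp hz₀).1 h
  exact hz (zpow_mem_lattice_left p q k)

/-- The points that avoid the zeros and poles of all the functions `Γ(e_k x^±)`, `θ(e_k x^±; p)`,
`Γ(x^{±2})`, `θ(x^{±2}; p)` and of their translates. -/
def Generic (p q : ℂ) (e : Fin 8 → ℂ) (x : ℂ) : Prop :=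
  x ≠ 0 ∧ (∀ k, e k * x ∉ lattice p q ∧ e k * x⁻¹ ∉ lattice p q) ∧ x ^ 2 ∉ lattice p q

theorem Generic.inv {e : Fin 8 → ℂ} {x : ℂ} (h : Generic p q e x) : Generic p q e x⁻¹ :=
  ⟨inv_ne_zero h.1, fun k => ⟨(h.2.1 k).2, by rw [inv_inv]; exact (h.2.1 k).1⟩, by
    rw [inv_pow]; exact inv_notMem_lattice h.2.2⟩

theorem Generic.mul (hp₀ : p ≠ 0) (hq₀ : q ≠ 0) {e : Fin 8 → ℂ} {x a : ℂ}
    (ha : a ∈ lattice p q) (h : Generic p q e x) : Generic p q e (a * x) := by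
  have ha₀ : a ≠ 0 := by
    obtain ⟨i, j, rfl⟩ := ha
    exact mul_ne_zero (zpow_ne_zero _ hp₀) (zpow_ne_zero _ hq₀)
  refine ⟨mul_ne_zero ha₀ h.1, fun k => ⟨?_, ?_⟩, ?_⟩
  · rw [mul_left_comm]
    exact mul_notMem_lattice hp₀ hq₀ ha (h.2.1 k).1
  · rw [mul_inv, mul_left_comm]
    exact mul_notMem_lattice hp₀ hq₀ (inv_mem_lattice ha) (h.2.1 k).2
  · rw [mul_pow, pow_two a]
    exact mul_notMem_lattice hp₀ hq₀ (mul_mem_lattice hp₀ hq₀ ha ha) h.2.2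

/-- Countable sets have measure zero on the circle, so integrands need only be compared at generic
points. -/
theorem countable_not_generic {e : Fin 8 → ℂ} (he : ∀ k, e k ≠ 0) :
    {x | ¬ Generic p q e x}.Countable := by
  have hL := countable_lattice p q
  have h1 : ∀ k, {x | e k * x ∈ lattice p q}.Countable := fun k =>
    hL.preimage (mul_right_injective₀ (he k))
  have h2 : ∀ k, {x | e k * x⁻¹ ∈ lattice p q}.Countable := fun k =>
    hL.preimage ((mul_right_injective₀ (he k)).comp inv_injective)
  have h3 : {x : ℂ | x ^ 2 ∈ lattice p q}.Countable := by
    have : {x : ℂ | x ^ 2 ∈ lattice p q} ⊆ ⋃ l ∈ lattice p q, {x : ℂ | x ^ 2 = l} := fun x hx =>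
      Set.mem_biUnion (x := x ^ 2) hx rfl
    refine (hL.biUnion fun l _ => ?_).mono this
    rcases Set.eq_empty_or_nonempty {x : ℂ | x ^ 2 = l} with h | ⟨y, hy⟩
    · rw [h]; exact Set.countable_empty
    · refine (Set.toFinite {y, -y}).countable.mono fun x hx => ?_
      exact sq_eq_sq_iff_eq_or_eq_neg.1 (Eq.trans hx (Eq.symm hy))
  refine ((((Set.countable_iUnion h1).union (Set.countable_iUnion h2)).union h3).union
    (Set.countable_singleton 0)).mono fun x hx => ?_
  by_contra hn
  simp only [Set.mem_union, Set.mem_iUnion, Set.mem_ofPred_eq, Set.mem_singleton_iff, not_or,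
    not_exists] at hn
  exact hx ⟨hn.2, fun k => ⟨hn.1.1.1 k, hn.1.1.2 k⟩, hn.1.2⟩

theorem ae_circleMap_notMem {S : Set ℂ} (hS : S.Countable) :
    ∀ᵐ θ : ℝ, circleMap 0 1 θ ∉ S := by
  rw [ae_iff]
  simp only [not_not]
  exact (hS.preimage_circleMap 0 one_ne_zero).measure_zero _

/-! ### Integrals of differences -/

/-- The substitution x ↦ x⁻¹ identifies the terms in pairs, leaving twice the difference of the
means of g over |x| = 1 and |x| = |q|⁻¹, which is zero by Cauchy. Integrability holds because F
agrees almost everywhere with a continuous function. -/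
theorem integral_boundary (hq₀ : q ≠ 0) (hq : ‖q‖ < 1) {g : ℂ → ℂ}
    (hc : ContinuousOn g {x | 1 ≤ ‖x‖ ∧ ‖x‖ ≤ ‖q‖⁻¹})
    (hd : DifferentiableOn ℂ g {x | 1 < ‖x‖ ∧ ‖x‖ < ‖q‖⁻¹}) {F : ℂ → ℂ} {S : Set ℂ}
    (hS : S.Countable) (hF : ∀ x, ‖x‖ = 1 → x ∉ S →
      F x = g x + g x⁻¹ - g (q⁻¹ * x⁻¹) - g (q⁻¹ * x)) :
    CircleIntegrable (fun x => F x / x) 0 1 ∧ (∮ x in C(0, 1), F x / x) = 0 := by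
  have hn : 0 < ‖q‖ := norm_pos_iff.2 hq₀
  have hq1 : 1 ≤ ‖q‖⁻¹ := (one_le_inv₀ hn).2 hq.le
  have h1 : ∀ θ : ℝ, ‖circleMap 0 1 θ‖ = 1 := fun θ => by simp
  have hcm : Continuous (circleMap 0 1) := continuous_circleMap 0 1
  have hcm₀ : ∀ θ : ℝ, circleMap 0 1 θ ≠ 0 := fun θ => circleMap_ne_center one_ne_zero
  have hci : Continuous fun θ => (circleMap 0 1 θ)⁻¹ := hcm.inv₀ hcm₀
  have c1 : Continuous fun θ => g (circleMap 0 1 θ) :=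
    hc.comp_continuous hcm fun θ => by simp [hq1]
  have c2 : Continuous fun θ => g (circleMap 0 1 θ)⁻¹ :=
    hc.comp_continuous hci fun θ => by simp [hq1]
  have c3 : Continuous fun θ => g (q⁻¹ * (circleMap 0 1 θ)⁻¹) :=
    hc.comp_continuous (continuous_const.mul hci) fun θ => by simp [hq1]
  have c4 : Continuous fun θ => g (q⁻¹ * circleMap 0 1 θ) :=
    hc.comp_continuous (continuous_const.mul hcm) fun θ => by simp [hq1]
  have hae : ∀ᵐ θ : ℝ, F (circleMap 0 1 θ) = g (circleMap 0 1 θ) + g (circleMap 0 1 θ)⁻¹ -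
      g (q⁻¹ * (circleMap 0 1 θ)⁻¹) - g (q⁻¹ * circleMap 0 1 θ) := by
    filter_upwards [ae_circleMap_notMem hS] with θ hθ using hF _ (h1 θ) hθ
  constructor
  · have hcont : Continuous fun θ => (g (circleMap 0 1 θ) + g (circleMap 0 1 θ)⁻¹ -
      g (q⁻¹ * (circleMap 0 1 θ)⁻¹) - g (q⁻¹ * circleMap 0 1 θ)) / circleMap 0 1 θ :=
      (((c1.add c2).sub c3).sub c4).div hcm hcm₀
    refine (hcont.intervalIntegrable 0 (2 * Real.pi)).congr_ae (ae_restrict_of_ae ?_)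
    filter_upwards [hae] with θ hθ
    rw [hθ]
  · rw [circleIntegral_div _ one_ne_zero, intervalIntegral.integral_congr_ae
      (hae.mono fun θ h _ => h)]
    have i1 := c1.intervalIntegrable (μ := volume) 0 (2 * Real.pi)
    have i2 := c2.intervalIntegrable (μ := volume) 0 (2 * Real.pi)
    have i3 := c3.intervalIntegrable (μ := volume) 0 (2 * Real.pi)
    have i4 := c4.intervalIntegrable (μ := volume) 0 (2 * Real.pi)
    rw [intervalIntegral.integral_sub ((i1.add i2).sub i3) i4,
      intervalIntegral.integral_sub (i1.add i2) i3, intervalIntegral.integral_add i1 i2,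
      integral_circleMap_inv g, integral_circleMap_inv fun x => g (q⁻¹ * x)]
    have hmap : ∀ x : ℂ, ‖q⁻¹ * x‖ = ‖x‖ / ‖q‖ := fun x => by
      rw [norm_mul, norm_inv, inv_mul_eq_div]
    have e1 : ∀ x : ℂ, ‖q‖ < ‖x‖ ∧ ‖x‖ < 1 → 1 < ‖q⁻¹ * x‖ ∧ ‖q⁻¹ * x‖ < ‖q‖⁻¹ := fun x hx => by
      rw [hmap, one_lt_div hn, inv_eq_one_div, div_lt_div_iff_of_pos_right hn]
      exact hx
    have e2 : ∀ x : ℂ, ‖q‖ ≤ ‖x‖ ∧ ‖x‖ ≤ 1 → 1 ≤ ‖q⁻¹ * x‖ ∧ ‖q⁻¹ * x‖ ≤ ‖q‖⁻¹ := fun x hx => by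
      rw [hmap, one_le_div hn, inv_eq_one_div, div_le_div_iff_of_pos_right hn]
      exact hx
    have key := integral_circleMap_shift hq₀ hq (g := fun z => g (q⁻¹ * z))
      (hc.comp (continuous_const.mul continuous_id).continuousOn e2)
      (hd.comp (differentiable_id.const_mul q⁻¹).differentiableOn e1)
    simp only [inv_mul_cancel_left₀ hq₀] at key
    rw [key]
    ring

theorem circleIntegral_eq_zero_of_ae {F : ℂ → ℂ} {S : Set ℂ} (hS : S.Countable)
    (hF : ∀ x, ‖x‖ = 1 → x ∉ S → F x = 0) : (∮ x in C(0, 1), F x / x) = 0 := by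
  rw [circleIntegral_div _ one_ne_zero, intervalIntegral.integral_congr_ae (g := fun _ => 0)]
  · simp
  · filter_upwards [ae_circleMap_notMem hS] with θ hθ _ using hF _ (by simp) hθ

/-! ### The symmetric form of the operator -/

theorem theta_p_pow_four_mul (hp₀ : p ≠ 0) (hp : ‖p‖ < 1) {z : ℂ} (hz : z ≠ 0) :
    theta (z * p ^ 4) p = (z ^ 4 * p ^ 6)⁻¹ * theta z p := by
  have e : z * p ^ 4 = p * (p * (p * (p * z))) := by ring
  have h1 := mul_ne_zero hp₀ hz
  have h2 := mul_ne_zero hp₀ h1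
  have h3 := mul_ne_zero hp₀ h2
  rw [e, theta_mul_left hp₀ hp h3, theta_mul_left hp₀ hp h2, theta_mul_left hp₀ hp h1,
    theta_mul_left hp₀ hp hz]
  field_simp

/-- The factor between the two forms of the operator. -/
noncomputable def opConst (p q : ℂ) (t : Fin 6 → ℂ) (c : ℂ) : ℂ :=
  -(t 0 * t 1 * t 2 * t 3 * t 4) * t 5 ^ 5 * c ^ 8 * p ^ 6 / q ^ 4

theorem opConst_ne_zero (hp₀ : p ≠ 0) (hq₀ : q ≠ 0) {t : Fin 6 → ℂ} (ht : ∀ i, t i ≠ 0) {c : ℂ}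
    (hc : c ≠ 0) : opConst p q t c ≠ 0 := by
  simp [opConst, hp₀, hq₀, ht, hc]

/-- Inverting the theta arguments that contain x⁻¹ produces powers of x. The shift by p⁴ in ε₆
contributes (t₆cx)⁻⁴, which cancels them and leaves a constant. -/
theorem coeffA_eq_potA (hp₀ : p ≠ 0) (hp : ‖p‖ < 1) (hq₀ : q ≠ 0) {t : Fin 6 → ℂ}
    (ht : ∀ i, t i ≠ 0) {c : ℂ} (hc : c ≠ 0) {x : ℂ} (hx : x ≠ 0) :
    coeffA p q (par t c x) = opConst p q t c * potA p q (eps p q t c) x := by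
  have h0 := ht 0; have h1 := ht 1; have h2 := ht 2
  have h3 := ht 3; have h4 := ht 4; have h5 := ht 5
  have a : ∀ i, theta (c * x⁻¹ * t i / q) p =
      -(c * x⁻¹ * t i / q) * theta (q / (c * t i) * x) p := fun i => by
    have hi := ht i
    have e : q / (c * t i) * x = (c * x⁻¹ * t i / q)⁻¹ := by field_simp
    have hz : c * x⁻¹ * t i / q ≠ 0 := by simp [hc, hx, hi, hq₀]
    rw [e, theta_inv hp hz]
    field_simp
  have b : theta (c * t 5 * p ^ 4 * x) p = ((t 5 * (c * x)) ^ 4 * p ^ 6)⁻¹ *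
      theta (t 5 * (c * x)) p := by
    rw [← theta_p_pow_four_mul hp₀ hp (mul_ne_zero h5 (mul_ne_zero hc hx))]
    congr 1
    ring
  have d : theta (t 5 / (c * x)) p = -(t 5 / (c * x)) * theta (c / t 5 * x) p := by
    have e : c / t 5 * x = c * x / t 5 := by ring
    rw [e, theta_div_comm hp h5 (mul_ne_zero hc hx)]
  have f : theta (c * x⁻¹ / (q * (c * x))) p = -(q * x ^ 2)⁻¹ * theta (q * x ^ 2) p := by
    rw [← theta_inv hp (mul_ne_zero hq₀ (pow_ne_zero 2 hx))]
    congr 1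
    field_simp
  have g : c * x / (c * x⁻¹) = x ^ 2 := by field_simp
  have h : c / t 5 / q * x = c * x / (q * t 5) := by field_simp
  simp only [coeffA, par, potA, eps, Fin.prod_univ_eight, Matrix.cons_val, thetas, List.map_cons,
    List.map_nil, List.prod_cons, List.prod_nil, mul_one, a, b, d, f, g, h, opConst]
  generalize theta (c * x / (q * t 5)) p = A₁
  generalize theta (t 5 * (c * x)) p = A₂
  generalize theta (c / t 5 * x) p = A₃
  generalize theta (x ^ 2) p = A₄
  generalize theta (q * x ^ 2) p = A₅
  generalize theta (q / (c * t 0) * x) p = B₀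
  generalize theta (q / (c * t 1) * x) p = B₁
  generalize theta (q / (c * t 2) * x) p = B₂
  generalize theta (q / (c * t 3) * x) p = B₃
  generalize theta (q / (c * t 4) * x) p = B₄
  field_simp

theorem coeffK_eq_potNu (hp₀ : p ≠ 0) (hp : ‖p‖ < 1) (hq₀ : q ≠ 0) {t : Fin 6 → ℂ}
    (ht : ∀ i, t i ≠ 0) {c : ℂ} (hc : c ≠ 0) {x : ℂ} (hx : x ≠ 0) :
    coeffK p q (par t c x) = opConst p q t c * potNu p q (eps p q t c) := by
  have h0 := ht 0; have h1 := ht 1; have h2 := ht 2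
  have h3 := ht 3; have h4 := ht 4; have h5 := ht 5
  have a : ∀ i, theta (q / (c * t i) * (c / t 5) / q) p =
      -(t 5 * t i)⁻¹ * theta (t 5 * t i) p := fun i => by
    have hi := ht i
    rw [← theta_inv hp (mul_ne_zero h5 hi)]
    congr 1
    field_simp
  have b : theta (c * t 5 * p ^ 4 * (c / t 5) / q) p = ((c ^ 2 / q) ^ 4 * p ^ 6)⁻¹ *
      theta (c ^ 2 / q) p := by
    rw [← theta_p_pow_four_mul hp₀ hp (div_ne_zero (pow_ne_zero 2 hc) hq₀)]
    congr 1
    field_simp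
  have d : c * x⁻¹ * (c * x) / q = c ^ 2 / q := by field_simp
  have e0 : eps p q t c (Fin.castAdd 2 0) = q / (c * t 0) := rfl
  have e1 : eps p q t c (Fin.castAdd 2 1) = q / (c * t 1) := rfl
  have e2 : eps p q t c (Fin.castAdd 2 2) = q / (c * t 2) := rfl
  have e3 : eps p q t c (Fin.castAdd 2 3) = q / (c * t 3) := rfl
  have e4 : eps p q t c (Fin.castAdd 2 4) = q / (c * t 4) := rfl
  have e5 : eps p q t c (Fin.castAdd 2 5) = c * t 5 * p ^ 4 := rfl
  have e7 : eps p q t c 7 = c / t 5 := rfl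
  rw [potNu, Fin.prod_univ_six, e0, e1, e2, e3, e4, e5, e7]
  simp only [coeffK, par, Matrix.cons_val, thetas, List.map_cons,
    List.map_nil, List.prod_cons, List.prod_nil, mul_one, a, b, d, opConst]
  generalize theta (c ^ 2 / q) p = A
  generalize theta (t 5 * t 0) p = B₀
  generalize theta (t 5 * t 1) p = B₁
  generalize theta (t 5 * t 2) p = B₂
  generalize theta (t 5 * t 3) p = B₃
  generalize theta (t 5 * t 4) p = B₄
  field_simp

theorem opD_eq_opDx (hp₀ : p ≠ 0) (hp : ‖p‖ < 1) (hq₀ : q ≠ 0) {t : Fin 6 → ℂ}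
    (ht : ∀ i, t i ≠ 0) {c : ℂ} (hc : c ≠ 0) {x : ℂ} (hx : x ≠ 0) (f : ℂ → ℂ) :
    opD p q t c f x = opConst p q t c * opDx p q (eps p q t c) f x := by
  rw [opD, opDx, ← par_inv, coeffA_eq_potA hp₀ hp hq₀ ht hc hx,
    coeffA_eq_potA hp₀ hp hq₀ ht hc (inv_ne_zero hx), coeffK_eq_potNu hp₀ hp hq₀ ht hc hx]
  ring

end EllipticHypergeometric

namespace EllipticHypergeometric
open Complex Filter Topology MeasureTheory

variable {p q : ℂ}

/-! ### Conjugation of the operator -/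

theorem alphaFun_inv (p q : ℂ) (e : Fin 8 → ℂ) (x : ℂ) :
    alphaFun p q e x⁻¹ = alphaFun p q e x := by
  simp only [alphaFun, inv_inv, mul_comm]

theorem weight_inv (p q x : ℂ) : weight p q x⁻¹ = weight p q x := by
  simp only [weight, inv_inv, mul_comm]

theorem alphaFun_ne_zero (hp₀ : p ≠ 0) (hp : ‖p‖ < 1) (hq₀ : q ≠ 0) (hq : ‖q‖ < 1)
    {e : Fin 8 → ℂ} {x : ℂ} (hx : Generic p q e x) : alphaFun p q e x ≠ 0 := by
  have h : ∀ {z}, z ∉ lattice p q → ellGamma p q z ≠ 0 := fun hz =>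
    ellGamma_ne_zero (poch₂_ne_zero hp hq hz) (poch₂_mul_div_ne_zero hp₀ hp hq₀ hq hz)
  exact Finset.prod_ne_zero_iff.2 fun k _ => mul_ne_zero (h (hx.2.1 k).1) (h (hx.2.1 k).2)

theorem alphaFun_mul (hp₀ : p ≠ 0) (hp : ‖p‖ < 1) (hq₀ : q ≠ 0) (hq : ‖q‖ < 1)
    {e : Fin 8 → ℂ} {x : ℂ} (hx : Generic p q e x) :
    alphaFun p q e (q * x) * ∏ k, theta (e k * (q * x)⁻¹) p =
      alphaFun p q e x * ∏ k, theta (e k * x) p := by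
  rw [alphaFun, alphaFun, ← Finset.prod_mul_distrib, ← Finset.prod_mul_distrib]
  refine Finset.prod_congr rfl fun k _ => ?_
  have h1 := ellGamma_mul hp hq₀ hq (poch₂_ne_zero hp hq (hx.2.1 k).1)
  have h2 := ellGamma_mul hp hq₀ hq
    (poch₂_ne_zero hp hq ((hx.mul hp₀ hq₀ (right_mem_lattice p q)).2.1 k).2)
  have e1 : q * (e k * (q * x)⁻¹) = e k * x⁻¹ := by
    rw [mul_inv]
    field_simp
  rw [e1] at h2
  rw [mul_left_comm, h1, h2]
  ring

theorem weight_of_generic (hp₀ : p ≠ 0) (hp : ‖p‖ < 1) (hq₀ : q ≠ 0) (hq : ‖q‖ < 1)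
    {x : ℂ} (hx : x ^ 2 ∉ lattice p q) :
    weight p q x = theta (x ^ 2) p * theta (x ^ 2)⁻¹ q := by
  rw [weight, inv_pow, one_div, ellGamma_mul_ellGamma_inv hp hq]
  · exact poch₂_ne_zero hp hq (mul_notMem_lattice hp₀ hq₀ (mul_mem_lattice hp₀ hq₀
      (left_mem_lattice p q) (right_mem_lattice p q)) hx)
  · exact poch₂_mul_div_ne_zero hp₀ hp hq₀ hq hx

/-- Cross-multiplied, this is the ratio of weights at x and qx. It supplies the denominators of A in
`alphaFun_mul_weight_mul_potA`, as `alphaFun_mul` supplies the numerators. -/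
theorem weight_mul (hp₀ : p ≠ 0) (hp : ‖p‖ < 1) (hq₀ : q ≠ 0) (hq : ‖q‖ < 1)
    {x : ℂ} (hx₀ : x ≠ 0) (hx : x ^ 2 ∉ lattice p q) (hx' : (q * x) ^ 2 ∉ lattice p q) :
    weight p q x * (theta ((q * x)⁻¹ ^ 2) p * theta (q * (q * x)⁻¹ ^ 2) p) =
      weight p q (q * x) * (theta (x ^ 2) p * theta (q * x ^ 2) p) := by
  have h2 : x ^ 2 ≠ 0 := pow_ne_zero 2 hx₀
  have h3 : q * x ≠ 0 := mul_ne_zero hq₀ hx₀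
  have e1 : theta ((q * x) ^ 2)⁻¹ q =
      -((x ^ 2)⁻¹ / q / q) * (-((x ^ 2)⁻¹ / q) * theta (x ^ 2)⁻¹ q) := by
    rw [← theta_div_left hq₀ hq (inv_ne_zero h2),
      ← theta_div_left hq₀ hq (div_ne_zero (inv_ne_zero h2) hq₀)]
    congr 1
    field_simp
  have e2 : theta (q * (q * x)⁻¹ ^ 2) p = -(q * x ^ 2)⁻¹ * theta (q * x ^ 2) p := by
    rw [← theta_inv hp (mul_ne_zero hq₀ h2)]
    congr 1
    field_simp
  rw [weight_of_generic hp₀ hp hq₀ hq hx, weight_of_generic hp₀ hp hq₀ hq hx', e1, e2, inv_pow,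
    theta_inv hp (pow_ne_zero 2 h3)]
  generalize theta (x ^ 2) p = A
  generalize theta (q * x ^ 2) p = B
  generalize theta (x ^ 2)⁻¹ q = C
  generalize theta ((q * x) ^ 2) p = D
  field_simp

theorem Generic.theta_sq (hp₀ : p ≠ 0) (hp : ‖p‖ < 1) (hq₀ : q ≠ 0) {e : Fin 8 → ℂ} {x : ℂ}
    (hx : Generic p q e x) : theta (x ^ 2) p ≠ 0 ∧ theta (q * x ^ 2) p ≠ 0 :=
  ⟨theta_ne_zero hp₀ hp (pow_ne_zero 2 hx.1) hx.2.2,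
    theta_ne_zero hp₀ hp (mul_ne_zero hq₀ (pow_ne_zero 2 hx.1))
      (mul_notMem_lattice hp₀ hq₀ (right_mem_lattice p q) hx.2.2)⟩

/-- The symmetry of 𝒟_x for the weight α/Γ(x^{±2}): the coefficient of T at x matches that of T⁻¹ at
qx. -/
theorem alphaFun_mul_weight_mul_potA (hp₀ : p ≠ 0) (hp : ‖p‖ < 1) (hq₀ : q ≠ 0) (hq : ‖q‖ < 1)
    {e : Fin 8 → ℂ} {x : ℂ} (hx : Generic p q e x) :
    alphaFun p q e (q * x) * weight p q (q * x) * potA p q e (q * x)⁻¹ =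
      alphaFun p q e x * weight p q x * potA p q e x := by
  have hx' := hx.mul hp₀ hq₀ (right_mem_lattice p q)
  have h1 := alphaFun_mul hp₀ hp hq₀ hq hx
  have h2 := weight_mul hp₀ hp hq₀ hq hx.1 hx.2.2 hx'.2.2
  obtain ⟨n1, n2⟩ := hx.theta_sq hp₀ hp hq₀
  obtain ⟨n3, n4⟩ := hx'.inv.theta_sq hp₀ hp hq₀
  simp only [potA, thetas, List.map_cons, List.map_nil, List.prod_cons, List.prod_nil, mul_one]
  generalize theta (x ^ 2) p = A at *
  generalize theta (q * x ^ 2) p = B at *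
  generalize theta ((q * x)⁻¹ ^ 2) p = C at *
  generalize theta (q * (q * x)⁻¹ ^ 2) p = D at *
  generalize ∏ k, theta (e k * x) p = E at *
  generalize ∏ k, theta (e k * (q * x)⁻¹) p = G at *
  generalize weight p q (q * x) = w' at *
  generalize alphaFun p q e (q * x) = a' at *
  rw [mul_div_assoc', mul_div_assoc', div_eq_div_iff (mul_ne_zero n3 n4) (mul_ne_zero n1 n2)]
  linear_combination w' * (A * B) * h1 - alphaFun p q e x * E * h2

/-- The integrand of `⟨χ, 𝒟φ⟩`, where `χ = αψ` and `𝒟ψ = 0`, is a sum of differences. -/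
theorem integrand_eq (hp₀ : p ≠ 0) (hp : ‖p‖ < 1) (hq₀ : q ≠ 0) (hq : ‖q‖ < 1)
    {e : Fin 8 → ℂ} {ψ φ h : ℂ → ℂ}
    (hh : ∀ y, h y = alphaFun p q e y * ψ y * potA p q e y * φ (q * y) * weight p q y) {x : ℂ}
    (hx : Generic p q e x) (hψ : opDx p q e ψ x = 0) (h1 : ψ x⁻¹ = ψ x)
    (h2 : ψ (q * x)⁻¹ = ψ (q * x)) (h3 : φ x⁻¹ = φ x) (h4 : φ (q * x⁻¹) = φ (q⁻¹ * x)) :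
    alphaFun p q e x * ψ x * opDx p q e φ x * weight p q x =
      h x + h x⁻¹ - h (q⁻¹ * x⁻¹) - h (q⁻¹ * x) := by
  have k1 := alphaFun_mul_weight_mul_potA hp₀ hp hq₀ hq hx
  have k2 := alphaFun_mul_weight_mul_potA hp₀ hp hq₀ hq hx.inv
  have e1 : q⁻¹ * x⁻¹ = (q * x)⁻¹ := (mul_inv _ _).symm
  have e2 : q⁻¹ * x = (q * x⁻¹)⁻¹ := by rw [mul_inv, inv_inv]
  have e3 : q * (q * x)⁻¹ = x⁻¹ := by rw [mul_inv, mul_inv_cancel_left₀ hq₀]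
  have e4 : q * (q * x⁻¹)⁻¹ = x := by rw [← e2, mul_inv_cancel_left₀ hq₀]
  rw [opDx] at hψ
  rw [alphaFun_inv, weight_inv] at k2
  rw [hh, hh, hh (q⁻¹ * x⁻¹), hh (q⁻¹ * x), e1, e3, e2, e4, alphaFun_inv, alphaFun_inv p q e (q * x),
    alphaFun_inv p q e (q * x⁻¹), weight_inv, weight_inv p q (q * x), weight_inv p q (q * x⁻¹), opDx,
    h1, h2, h3, h4, ← e2]
  rw [← e2] at k2
  -- The equation for ψ replaces the diagonal part (ν - A(x) - A(x⁻¹))ψ(x)φ(x) by shifts of ψ. The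
  -- symmetry at x and at x⁻¹ then identifies those terms with h at (qx)⁻¹ and q⁻¹x.
  linear_combination (alphaFun p q e x * φ x * weight p q x) * hψ +
    ψ (q * x) * φ x * k1 + ψ (q⁻¹ * x) * φ x * k2

theorem Ufun_inv (hp₀ : p ≠ 0) (hp : ‖p‖ < 1) (hq₀ : q ≠ 0) (hq : ‖q‖ < 1) {t : Fin 6 → ℂ}
    {c x : ℂ} (h : VDefined p q (par t c x)) (h' : VDefined p q (par t c x⁻¹)) :
    Ufun p q t c x⁻¹ = Ufun p q t c x := by
  rw [par_inv] at h'
  rw [Ufun, Ufun, par_inv, U_eq, U_eq, normU_swap78, V_swap78 hp₀ hp hq₀ hq h h']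

theorem eps_ne_zero (hp₀ : p ≠ 0) (hq₀ : q ≠ 0) {t : Fin 6 → ℂ} (ht : ∀ i, t i ≠ 0) {c : ℂ}
    (hc : c ≠ 0) : ∀ k, eps p q t c k ≠ 0 := by
  have h : ∀ i, q / (c * t i) ≠ 0 := fun i => div_ne_zero hq₀ (mul_ne_zero hc (ht i))
  have h7 := div_ne_zero hc (ht 5)
  exact forall_vec (P := fun x : ℂ => x ≠ 0) (h 0) (h 1) (h 2) (h 3) (h 4)
    (mul_ne_zero (mul_ne_zero hc (ht 5)) (pow_ne_zero 4 hp₀)) (div_ne_zero h7 hq₀) h7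

/-- Modulo the lattice generated by p and q, the arguments t₇t₆^±, t₈t₆^± are those built from ε₆
and ε₈, so genericity of x covers the normalisation of U. -/
theorem normDen_par_ne_zero (hp₀ : p ≠ 0) (hp : ‖p‖ < 1) (hq₀ : q ≠ 0) (hq : ‖q‖ < 1)
    {t : Fin 6 → ℂ} {c x : ℂ} (hx : Generic p q (eps p q t c) x) :
    normDen p q (par t c x) ≠ 0 := by
  have a1 : ∀ y, c * t 5 * p ^ 4 * y ∉ lattice p q → c * y * t 5 ∉ lattice p q := fun y hy h => by
    refine hy ?_
    have := mul_mem_lattice hp₀ hq₀ (zpow_mem_lattice_left p q 4) h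
    have e : c * t 5 * p ^ 4 * y = p ^ (4 : ℤ) * (c * y * t 5) := by
      rw [show (4 : ℤ) = ((4 : ℕ) : ℤ) from rfl, zpow_natCast]; ring
    rwa [e]
  have a2 : ∀ y, c / t 5 * y ∉ lattice p q → c * y / t 5 ∉ lattice p q := fun y hy => by
    rwa [div_mul_eq_mul_div] at hy
  have b := fun {z} => poch₂_mul_div_ne_zero hp₀ hp hq₀ hq (z := z)
  exact mul_ne_zero (mul_ne_zero (mul_ne_zero (b (a1 _ (hx.2.1 5).2)) (b (a2 _ (hx.2.1 7).2)))
    (b (a1 _ (hx.2.1 5).1))) (b (a2 _ (hx.2.1 7).1))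

theorem Generic.theta_quot (hp₀ : p ≠ 0) (hp : ‖p‖ < 1) (hq₀ : q ≠ 0) {e : Fin 8 → ℂ} {c x : ℂ}
    (hc : c ≠ 0) (hx : Generic p q e x) :
    theta (c * x / (c * x⁻¹)) p ≠ 0 ∧ theta (c * x⁻¹ / (q * (c * x))) p ≠ 0 := by
  have hx₀ := hx.1
  have e1 : c * x / (c * x⁻¹) = x ^ 2 := by field_simp
  have e2 : c * x⁻¹ / (q * (c * x)) = (q * x ^ 2)⁻¹ := by field_simp
  rw [e1, e2, Ne, Ne, theta_inv_eq_zero_iff hp (mul_ne_zero hq₀ (pow_ne_zero 2 hx₀))]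
  exact hx.theta_sq hp₀ hp hq₀

theorem opDx_Ufun (hp₀ : p ≠ 0) (hp : ‖p‖ < 1) (hq₀ : q ≠ 0) (hq : ‖q‖ < 1) {t : Fin 6 → ℂ}
    (ht : ∀ i, t i ≠ 0) {c : ℂ} (hc : c ≠ 0) {x : ℂ} (hx : Generic p q (eps p q t c) x)
    (h0 : VDefined p q (par t c x)) (hu : VDefined p q (par t c (q * x)))
    (hd : VDefined p q (par t c (q⁻¹ * x))) :
    opDx p q (eps p q t c) (Ufun p q t c) x = 0 := by
  have n0 := normDen_par_ne_zero hp₀ hp hq₀ hq hx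
  have nu := normDen_par_ne_zero hp₀ hp hq₀ hq (hx.mul hp₀ hq₀ (right_mem_lattice p q))
  have nd := normDen_par_ne_zero hp₀ hp hq₀ hq
    (hx.mul hp₀ hq₀ (inv_mem_lattice (right_mem_lattice p q)))
  rw [par_mul] at hu nu
  rw [par_inv_mul] at hd nd
  obtain ⟨d1, d2⟩ := hx.theta_quot hp₀ hp hq₀ hc
  obtain ⟨-, d3⟩ := hx.inv.theta_quot hp₀ hp hq₀ hc
  rw [inv_inv] at d3
  have key := opU_eq_zero hp₀ hp hq₀ hq h0 hu hd n0 nu nd d2 d3 d1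
  rw [← opD_Ufun, opD_eq_opDx hp₀ hp hq₀ ht hc hx.1] at key
  exact (mul_eq_zero.1 key).resolve_left (opConst_ne_zero hp₀ hq₀ ht hc)

theorem xDenominators_ne_zero (hp₀ : p ≠ 0) (hp : ‖p‖ < 1) (hq₀ : q ≠ 0) {t : Fin 6 → ℂ}
    (ht : ∀ i, t i ≠ 0) {c : ℂ} (hc : c ≠ 0) {x : ℂ} (hx : Generic p q (eps p q t c) x) :
    xDenominators p q t c x ≠ 0 := by
  obtain ⟨d1, d2⟩ := hx.theta_quot hp₀ hp hq₀ hc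
  obtain ⟨d3, d4⟩ := hx.inv.theta_quot hp₀ hp hq₀ hc
  rw [inv_inv] at d3 d4
  have hx₀ := hx.1
  have hz : ∀ i, ∀ y, y ≠ 0 → q / (c * t i) * y⁻¹ ∉ lattice p q → theta (t i * (c * y) / q) p ≠ 0 ∧
      theta (q / (t i * (c * y))) p ≠ 0 := fun i y hy h => by
    have hi := ht i
    have e1 : q / (t i * (c * y)) = q / (c * t i) * y⁻¹ := by field_simp
    have e2 : t i * (c * y) / q = (q / (c * t i) * y⁻¹)⁻¹ := by field_simp
    have h0 : q / (c * t i) * y⁻¹ ≠ 0 :=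
      mul_ne_zero (div_ne_zero hq₀ (mul_ne_zero hc hi)) (inv_ne_zero hy)
    rw [e1, e2, Ne, theta_inv_eq_zero_iff hp h0]
    exact ⟨theta_ne_zero hp₀ hp h0 h, theta_ne_zero hp₀ hp h0 h⟩
  have z1 := hz 2 x hx₀ (hx.2.1 2).2
  have z2 := hz 2 x⁻¹ (inv_ne_zero hx₀) (hx.inv.2.1 2).2
  have z3 := hz 3 x hx₀ (hx.2.1 3).2
  have z4 := hz 3 x⁻¹ (inv_ne_zero hx₀) (hx.inv.2.1 3).2
  simp only [xDenominators, thetas, List.map_cons, List.map_nil, List.prod_cons,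
    List.prod_nil, mul_one, mul_ne_zero_iff]
  exact ⟨d1, d2, d3, d4, z2.1, z1.1, z4.1, z3.1, z3.2⟩

theorem opDx_mul_of_periodic {e : Fin 8 → ℂ} {β : ℂ → ℂ} (hq₀ : q ≠ 0)
    (hβ : ∀ x, x ≠ 0 → β (q * x) = β x) (f : ℂ → ℂ) {x : ℂ} (hx : x ≠ 0) :
    opDx p q e (fun x => β x * f x) x = β x * opDx p q e f x := by
  have h := hβ (q⁻¹ * x) (mul_ne_zero (inv_ne_zero hq₀) hx)
  rw [mul_inv_cancel_left₀ hq₀] at h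
  rw [opDx, opDx, hβ x hx, ← h]
  ring

theorem circleIntegral_congr_of_countable {F G : ℂ → ℂ} {S : Set ℂ} (hS : S.Countable)
    (h : ∀ x, ‖x‖ = 1 → x ∉ S → F x = G x) (hF : CircleIntegrable (fun x => F x / x) 0 1) :
    CircleIntegrable (fun x => G x / x) 0 1 ∧
      (∮ x in C(0, 1), G x / x) = ∮ x in C(0, 1), F x / x := by
  have hae : ∀ᵐ θ : ℝ, F (circleMap 0 1 θ) = G (circleMap 0 1 θ) := by
    filter_upwards [ae_circleMap_notMem hS] with θ hθ using h _ (by simp) hθ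
  constructor
  · refine IntervalIntegrable.congr_ae hF (ae_restrict_of_ae ?_)
    filter_upwards [hae] with θ hθ
    rw [hθ]
  · rw [circleIntegral_div _ one_ne_zero, circleIntegral_div _ one_ne_zero]
    congr 1
    refine intervalIntegral.integral_congr_ae ?_
    filter_upwards [hae] with θ hθ _ using hθ.symm

/-! ### Biorthogonality -/

/-- Collects the points x for which one of the four arguments of h in `integrand_eq` falls into the
exceptional set. -/
theorem countable_translates {S : Set ℂ} (hS : S.Countable) (hq₀ : q ≠ 0) :
    {x : ℂ | x ∈ S ∨ x⁻¹ ∈ S ∨ q⁻¹ * x⁻¹ ∈ S ∨ q⁻¹ * x ∈ S}.Countable := by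
  have h := mul_right_injective₀ (inv_ne_zero hq₀)
  exact hS.union ((hS.preimage inv_injective).union
    ((hS.preimage (h.comp inv_injective)).union (hS.preimage h)))

theorem biorthogonality (hp₀ : p ≠ 0) (hp : ‖p‖ < 1) (hq₀ : q ≠ 0) (hq : ‖q‖ < 1)
    {t s : Fin 6 → ℂ} (hs : ∀ i, s i ≠ 0) {c : ℂ} (hc : c ≠ 0) {β : ℂ → ℂ}
    (hβ : ∀ x, x ≠ 0 → β x⁻¹ = β x) (hdt : DefinedOnCircle p q t c)
    (hds : DefinedOnCircle p q s c)
    (hno : NoObstruction p q (eps p q s c) (chiFun p q s c) (fun x => β x * Ufun p q t c x)) :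
    pairing p q (opDxStar p q (eps p q s c) (chiFun p q s c)) (fun x => β x * Ufun p q t c x) = 0 ∧
    pairing p q (chiFun p q s c) (opDx p q (eps p q s c) (fun x => β x * Ufun p q t c x)) = 0 ∧
    PairingConverges p q (chiFun p q s c)
      (opDx p q (eps p q s c) (fun x => β x * Ufun p q t c x)) := by
  obtain ⟨St, hSt, ht⟩ := hdt
  obtain ⟨Ss, hSs, hs'⟩ := hds
  obtain ⟨g, hgc, hgd, Sg, hSg, hg⟩ := hno
  have hn : 0 < ‖q‖ := norm_pos_iff.2 hq₀
  have hq1 : 1 ≤ ‖q‖⁻¹ := (one_le_inv₀ hn).2 hq.le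
  have hB := (((countable_translates hSt hq₀).union (countable_translates hSs hq₀)).union
    (countable_translates hSg hq₀)).union (countable_not_generic (p := p) (q := q)
      (eps_ne_zero hp₀ hq₀ hs hc))
  set B := _ ∪ {x | ¬ Generic p q (eps p q s c) x}
  have hzero : ∀ x, ‖x‖ = 1 → x ∉ B → opDx p q (eps p q s c) (Ufun p q s c) x = 0 := by
    intro x hx hxB
    simp only [B, Set.mem_union, Set.mem_ofPred_eq, not_or, not_not] at hxB
    obtain ⟨⟨⟨-, ⟨b, -⟩⟩, -⟩, hgen⟩ := hxB
    obtain ⟨v1, v2, v3⟩ := hs' x hx b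
    exact opDx_Ufun hp₀ hp hq₀ hq hs hc hgen v1 v2 v3
  have key := integral_boundary hq₀ hq hgc hgd hB
    (F := fun x => chiFun p q s c x * opDx p q (eps p q s c) (fun x => β x * Ufun p q t c x) x *
      weight p q x) (by
    intro x hx hxB
    have hz := hzero x hx hxB
    simp only [B, Set.mem_union, Set.mem_ofPred_eq, not_or, not_not] at hxB
    obtain ⟨⟨⟨⟨a1, a2, -⟩, ⟨b1, b2, -⟩⟩, ⟨c1, c2, c3, c4⟩⟩, hgen⟩ := hxB
    have hx₀ := hgen.1
    have hxi : ‖x⁻¹‖ = 1 := by rw [norm_inv, hx, inv_one]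
    obtain ⟨u1, u2, u3⟩ := ht x hx a1
    obtain ⟨v1, v2, v3⟩ := hs' x hx b1
    obtain ⟨u4, u5, u6⟩ := ht x⁻¹ hxi a2
    obtain ⟨v4, v5, v6⟩ := hs' x⁻¹ hxi b2
    have e1 : q⁻¹ * x⁻¹ = (q * x)⁻¹ := (mul_inv _ _).symm
    have e2 : q * x⁻¹ = (q⁻¹ * x)⁻¹ := by rw [mul_inv, inv_inv]
    have hq' : ‖q⁻¹ * x‖ = ‖q‖⁻¹ := by rw [norm_mul, hx, norm_inv, mul_one]
    have hq'' : ‖q⁻¹ * x⁻¹‖ = ‖q‖⁻¹ := by rw [norm_mul, hxi, norm_inv, mul_one]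
    -- The arguments x, x⁻¹ lie on the inner circle and q⁻¹x, q⁻¹x⁻¹ on the outer one, where g still
    -- agrees with the product outside the exceptional set.
    rw [← hg x hx.ge (hx.le.trans hq1) c1, ← hg x⁻¹ hxi.ge (hxi.le.trans hq1) c2,
      ← hg _ (hq1.trans hq''.ge) hq''.le c3, ← hg _ (hq1.trans hq'.ge) hq'.le c4]
    exact integrand_eq hp₀ hp hq₀ hq (fun y => rfl) hgen hz (Ufun_inv hp₀ hp hq₀ hq v1 v4)
      (Ufun_inv hp₀ hp hq₀ hq v2 (e1 ▸ v6))
      (by simp only [hβ x hx₀, Ufun_inv hp₀ hp hq₀ hq u1 u4])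
      (by
        simp only [e2]
        rw [hβ _ (mul_ne_zero (inv_ne_zero hq₀) hx₀), Ufun_inv hp₀ hp hq₀ hq u3 (e2 ▸ u5)]))
  refine ⟨?_, ?_, key.1⟩
  -- Conjugation by α turns 𝒟_x^*χ into α𝒟_xψ, which is zero at generic points; this pairing
  -- vanishes without integration by parts.
  · rw [pairing, circleIntegral_eq_zero_of_ae hB, mul_zero]
    intro x hx hxB
    have hz := hzero x hx hxB
    simp only [B, Set.mem_union, Set.mem_ofPred_eq, not_or, not_not] at hxB
    have hgen := hxB.2
    have ha : ∀ {y}, Generic p q (eps p q s c) y →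
        (alphaFun p q (eps p q s c) y)⁻¹ * chiFun p q s c y = Ufun p q s c y := fun hy => by
      rw [chiFun, inv_mul_cancel_left₀ (alphaFun_ne_zero hp₀ hp hq₀ hq hy)]
    rw [opDx] at hz
    rw [opDxStar, opDx, ha hgen, ha (hgen.mul hp₀ hq₀ (right_mem_lattice p q)),
      ha (hgen.mul hp₀ hq₀ (inv_mem_lattice (right_mem_lattice p q))), hz]
    ring
  · rw [pairing, key.2, mul_zero]

theorem biorthogonality_contiguous (hp₀ : p ≠ 0) (hp : ‖p‖ < 1) (hq₀ : q ≠ 0) (hq : ‖q‖ < 1)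
    {t : Fin 6 → ℂ} (ht : ∀ i, t i ≠ 0) {c : ℂ} (hc : c ≠ 0) {t₃' t₄' : ℂ}
    (h' : t 2 * t 3 = t₃' * t₄') {β : ℂ → ℂ} (hβ : ∀ x, x ≠ 0 → β (q * x) = β x)
    (hdt : DefinedOnCircle p q t c) (hdm : DefinedOnCircle p q (shift56 q t) c)
    (hθ : thetas [t 2 / t₃', t 2 / t₄'] p ≠ 0) (hcd : constDenominators p q t ≠ 0)
    (h0 : pairing p q (chiFun p q (replace34 t t₃' t₄') c)
      (opDx p q (eps p q (replace34 t t₃' t₄') c) (fun x => β x * Ufun p q t c x)) = 0)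
    (h1 : PairingConverges p q (chiFun p q (replace34 t t₃' t₄') c)
      (opDx p q (eps p q (replace34 t t₃' t₄') c) (fun x => β x * Ufun p q t c x))) :
    pairing p q (chiFun p q (replace34 t t₃' t₄') c)
        (fun x => β x * contiguousRHS p q t c x) = 0 ∧
      PairingConverges p q (chiFun p q (replace34 t t₃' t₄') c)
        (fun x => β x * contiguousRHS p q t c x) := by
  obtain ⟨St, hSt, hVt⟩ := hdt
  obtain ⟨Sm, hSm, hVm⟩ := hdm
  set s := replace34 t t₃' t₄' with hs_def
  have hab : t₃' * t₄' ≠ 0 := h' ▸ mul_ne_zero (ht 2) (ht 3)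
  have hs : ∀ i, s i ≠ 0 := by
    intro i
    fin_cases i
    exacts [ht 0, ht 1, left_ne_zero_of_mul hab, right_ne_zero_of_mul hab, ht 4, ht 5]
  have hm : ∀ i, shift56 q t i ≠ 0 := by
    intro i
    fin_cases i
    exacts [ht 0, ht 1, ht 2, ht 3, mul_ne_zero (inv_ne_zero hq₀) (ht 4), mul_ne_zero hq₀ (ht 5)]
  have hB := ((hSt.union hSm).union (countable_not_generic (p := p) (q := q)
      (eps_ne_zero hp₀ hq₀ ht hc))).union (countable_not_generic (p := p) (q := q)
      (eps_ne_zero hp₀ hq₀ hm hc))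
  -- By the contiguous relation, K 𝒟_x(ε')βψ = βR at generic points; K converts between the two
  -- forms of the operator and carries the theta denominator.
  set K := opConst p q s c / thetas [t 2 / t₃', t 2 / t₄'] p
  have hc1 := CircleIntegrable.const_smul (a := K) h1
  have e : ∀ x a : ℂ, K * (a / x) = K * a / x := fun x a => by rw [mul_div_assoc]
  have key := circleIntegral_congr_of_countable hB
    (F := fun x => K * (chiFun p q s c x *
      opDx p q (eps p q s c) (fun x => β x * Ufun p q t c x) x * weight p q x))
    (G := fun x => chiFun p q s c x * (β x * contiguousRHS p q t c x) * weight p q x)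
    (fun x hx hxB => ?_) (by simpa only [smul_eq_mul, e, Pi.smul_def] using hc1)
  · refine ⟨?_, key.1⟩
    rw [pairing, key.2]
    simp only [← e]
    rw [circleIntegral.integral_const_mul, mul_left_comm]
    exact mul_eq_zero_of_right _ h0
  · simp only [Set.mem_union, Set.mem_ofPred_eq, not_or, not_not] at hxB
    obtain ⟨⟨⟨a1, a2⟩, g1⟩, g2⟩ := hxB
    obtain ⟨u1, u2, u3⟩ := hVt x hx a1
    have hC := contiguous hp₀ hp hq₀ hq ht hc h' g1.1 u1 u2 u3 (hVm x hx a2).1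
      (normDen_par_ne_zero hp₀ hp hq₀ hq g1)
      (normDen_par_ne_zero hp₀ hp hq₀ hq (g1.mul hp₀ hq₀ (right_mem_lattice p q)))
      (normDen_par_ne_zero hp₀ hp hq₀ hq (g1.mul hp₀ hq₀ (inv_mem_lattice (right_mem_lattice p q))))
      (normDen_par_ne_zero hp₀ hp hq₀ hq g2) hθ hcd (xDenominators_ne_zero hp₀ hp hq₀ ht hc g1)
    rw [opDx_mul_of_periodic hq₀ hβ _ g1.1, ← hC, ← hs_def, opD_eq_opDx hp₀ hp hq₀ hs hc g1.1]
    ring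

end EllipticHypergeometric

/-! ### Assembly of the three statements -/

open EllipticHypergeometric in
theorem mainTheorem6
    (p q : ℂ) (hp₀ : p ≠ 0) (hp : ‖p‖ < 1) (hq₀ : q ≠ 0) (hq : ‖q‖ < 1)
    (t : Fin 6 → ℂ) (ht : ∀ i, t i ≠ 0) (c : ℂ) (hc : c ≠ 0)
    (t₃' t₄' : ℂ) (h' : t 2 * t 3 = t₃' * t₄') :
    -- the operator identity
    (∀ t₃'' t₄'' : ℂ, t 2 * t 3 = t₃'' * t₄'' → thetas [t 2 / t₃'', t 2 / t₄''] p ≠ 0 →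
      ∀ (f : ℂ → ℂ) (x : ℂ), x ≠ 0 →
        opD p q (replace34 t t₃' t₄') c f x -
            thetas [t 2 / t₃', t 2 / t₄'] p / thetas [t 2 / t₃'', t 2 / t₄''] p *
              opD p q (replace34 t t₃'' t₄'') c f x =
          t 2 / t₃' * (thetas [t₃' / t₃'', t₃' / t₄''] p / thetas [t 2 / t₃'', t 2 / t₄''] p) *
            opD p q t c f x) ∧
    -- the contiguous relation
    (∀ x : ℂ, x ≠ 0 →
      UDefined p q (par t c x) → UDefined p q (par t c (q * x)) →
      UDefined p q (par t c (q⁻¹ * x)) → UDefined p q (par (shift56 q t) c x) →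
      thetas [t 2 / t₃', t 2 / t₄'] p ≠ 0 →
      constDenominators p q t ≠ 0 → xDenominators p q t c x ≠ 0 →
        opD p q (replace34 t t₃' t₄') c (Ufun p q t c) x / thetas [t 2 / t₃', t 2 / t₄'] p =
          contiguousRHS p q t c x) ∧
    -- the family of biorthogonality relations
    (∀ β : ℂ → ℂ, (∀ x, x ≠ 0 → β x⁻¹ = β x) →
      DefinedOnCircle p q t c → DefinedOnCircle p q (replace34 t t₃' t₄') c →
      NoObstruction p q (eps p q (replace34 t t₃' t₄') c)
        (chiFun p q (replace34 t t₃' t₄') c) (fun x => β x * Ufun p q t c x) →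
      -- for every such function `β`
      (0 = pairing p q
          (opDxStar p q (eps p q (replace34 t t₃' t₄') c) (chiFun p q (replace34 t t₃' t₄') c))
          (fun x => β x * Ufun p q t c x) ∧
        pairing p q
          (opDxStar p q (eps p q (replace34 t t₃' t₄') c) (chiFun p q (replace34 t t₃' t₄') c))
          (fun x => β x * Ufun p q t c x) =
        pairing p q (chiFun p q (replace34 t t₃' t₄') c)
          (opDx p q (eps p q (replace34 t t₃' t₄') c) (fun x => β x * Ufun p q t c x)) ∧
        PairingConverges p q (chiFun p q (replace34 t t₃' t₄') c)
          (opDx p q (eps p q (replace34 t t₃' t₄') c) (fun x => β x * Ufun p q t c x))) ∧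
      -- for `β` invariant under `x ↦ q x`, such as `β = 1`: orthogonality to the right-hand
      -- side of the contiguous relation
      ((∀ x, x ≠ 0 → β (q * x) = β x) →
        DefinedOnCircle p q (shift56 q t) c →
        thetas [t 2 / t₃', t 2 / t₄'] p ≠ 0 → constDenominators p q t ≠ 0 →
        pairing p q (chiFun p q (replace34 t t₃' t₄') c)
            (fun x => β x * contiguousRHS p q t c x) = 0 ∧
          PairingConverges p q (chiFun p q (replace34 t t₃' t₄') c)
            (fun x => β x * contiguousRHS p q t c x))) := by
  refine ⟨fun t₃'' t₄'' h'' h0 f x hx => opD_identity hp₀ hp hq₀ ht hc h' h'' h0 f hx,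
    fun x hx h0 hu hd hm hθ hcd hxd => contiguous hp₀ hp hq₀ hq ht hc h' hx h0.1 hu.1 hd.1 hm.1
      (h0.normDen_ne_zero hp hq) (hu.normDen_ne_zero hp hq) (hd.normDen_ne_zero hp hq)
      (hm.normDen_ne_zero hp hq) hθ hcd hxd, fun β hβ hdt hds hno => ?_⟩
  have hab : t₃' * t₄' ≠ 0 := h' ▸ mul_ne_zero (ht 2) (ht 3)
  have hs : ∀ i, replace34 t t₃' t₄' i ≠ 0 := by
    intro i
    fin_cases i
    exacts [ht 0, ht 1, left_ne_zero_of_mul hab, right_ne_zero_of_mul hab, ht 4, ht 5]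
  obtain ⟨b1, b2, b3⟩ := biorthogonality hp₀ hp hq₀ hq hs hc hβ hdt hds hno
  exact ⟨⟨b1.symm, b1.trans b2.symm, b3⟩, fun hβq hdm hθ hcd =>
    biorthogonality_contiguous hp₀ hp hq₀ hq ht hc h' hβq hdt hdm hθ hcd b2 b3⟩
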